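/- Setting. Commutative topological groups are complete and Hausdorff. For a set system $\mathfrak S\subset\mathfrak P(X)$: $\mathfrak S$ is an *interval system* if for all $A,B\in\mathfrak S$ the sets $A\setminus B$ and $A\cap B$ are countable disjoint unions of elements of $\mathfrak S$; it is *locally finite* if for all $A,B\in\mathfrak S$ the set $A\cap B$, and, when $A\subset B$, the set $B\setminus A$, is a finite disjoint union of elements of $\mathfrak S$. $\Sigma_0\mathfrak S$ is the family of finite unions of elements of $\mathfrak S$. A *measure* $\mu:\mathfrak S\to\mathcal W$ is a $\sigma$-additive set function: $\mu(A)=\sum_\lambda\mu(A_\lambda)$ (unconditional sum) for each countable disjoint decomposition $A=\bigcup_\lambda A_\lambda$ in $\mathfrak S$. Let $L:\mathcal V\times\mathcal W\to\mathcal Z$ be biadditive and continuous in its second variable. Integrals. A step function is a finite sum $s=\sum_{j\in J}c_j\chi_{E_j}$, $c_j\in\mathcal V$, $E_j\in\mathfrak S$. For $\mathcal A\subset\mathcal V\times X$ and $D\subset X$ let $\mathcal A^D=\{v: (v,x)\in\mathcal A\text{ for all }x\in D\}$. $\mathcal A$ is an *envelope* over $\mathfrak S$ if it contains the graph of a step function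 and, for some countable $\mathfrak D\subset\mathfrak S$, $\mathcal A=\bigcup_{D\in\mathfrak D}(\mathcal A^D\times D)\cup(\{0\}\times(X\setminus\bigcup\mathfrak D))$; it approximates $f$ if it contains the graph of $f$. Put $$\int^{\mathrm p}L(\mathcal A,\mu)=\overline{\Bigl\{\sum_{j\in J}L(c_j,\mu(E_j)) : J\text{ finite},\ \sum_{j\in J}c_j\chi_{E_j}\subset\mathcal A\Bigr\}}.$$ $a\in\mathcal Z$ is the *integral* of $f:X\to\mathcal V$ if for each neighborhood $\mathcal T$ of $0$ in $\mathcal Z$ there is an envelope $\mathcal A$ approximating $f$ with $\int^{\mathrm p}L(\mathcal A,\mu)\subset a+\mathcal T$. $a$ is the *extended Lebesgue–McShane integral* of $f$ if for each neighborhood $\mathcal T$ of $0$ there is $A\in\Sigma_0\mathfrak S$ such that for all $B\in\Sigma_0\mathfrak S$ with $A\subset B$ there is an envelope $\mathcal B$ approximating $f|_B$ ($f$ on $B$, $0$ elsewhere) with $\int^{\mathrm p}L(\mathcal B,\mu)\subset a+\mathcal T$. A set $N\subset X$ is *weakly $L,\mu$-negligible* if every $f:X\to\mathcal V$ vanishing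 outside $N$ has integral $0$. Stone completion. $\mathfrak X_{\mathfrak S}$ is the set of maximal filters on the closure of $\mathfrak S$ under $\cup,\cap,\setminus$; $\beta A=\{\mathbf x\in\mathfrak X_{\mathfrak S}:A\in\mathbf x\}$, $\beta\mathfrak S=\{\beta A:A\in\mathfrak S\}$ and $\beta_*\mu=\mu\circ\beta^{-1}$. A topology on $X$ is *compatible* with $\mathfrak S$ if each $\mathbf x\in\mathfrak X_{\mathfrak S}$ converges, as a filter base, to exactly one point $\lim\mathbf x\in X$. Then the *McShane $L,\mu$-integral* of $f:X\to\mathcal V$ is the extended Lebesgue–McShane integral of $f\circ\lim:\mathfrak X_{\mathfrak S}\to\mathcal V$ with respect to $L,\beta_*\mu$. Statement. Let $\mathfrak S\subset\mathfrak P(X)$ be a locally finite interval system, let $X$ carry a topology compatible with $\mathfrak S$, let $\mu:\mathfrak S\to\mathcal W$ be a measure and $L$ as above. Assume that for all $S,B\in\mathfrak S$ (i) the set $\bigl((B\cap\lim(\beta S))\setminus S\bigr)\cup\bigl(S\setminus\lim(\beta S)\bigr)$ is weakly $L,\mu$-negligible; (ii) the set $\bigl(\beta S\setminus\lim^{-1}(S)\bigr)\cup\bigl((\beta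 B\cap\lim^{-1}(S))\setminus\beta S\bigr)$ is weakly $L,\beta_*\mu$-negligible. Then a function $f:X\to\mathcal V$ is extended Lebesgue–McShane $L,\mu$-integrable if and only if it is McShane $L,\mu$-integrable, and in this case the two integrals are equal. In particular, the system $\mathfrak I$ of bounded, possibly degenerate intervals of $\mathbb R$ is compatible with the usual topology of $\mathbb R$, and for $f:\mathbb R\to\mathbb R$ and $a\in\mathbb R$ the following are equivalent: $f$ is Lebesgue integrable with $\int f\,dx=a$; $a$ is the extended Lebesgue–McShane integral of $f$ over $\mathfrak I$ with respect to length and multiplication; $a$ is the corresponding McShane integral of $f$; $a$ is the classical McShane (gauge) integral of $f$ on $\mathbb R$, i.e. for each $\varepsilon>0$ there are $\delta:\mathbb R\to(0,\infty)$ and $R$ such that $\bigl|\sum_i f(t_i)(v_i-u_i)-a\bigr|<\varepsilon$ for each finite family of non-overlapping intervals $[u_i,v_i]$ covering $[-R,R]$ with tags $t_i\in\mathbb R$ such that $[u_i,v_i]\subset(t_i-\delta(t_i),t_i+\delta(t_i))$. -/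

import Mathlib

open Set Filter Topology

namespace LMInt

universe u v w z

/-! ### Interval systems -/

section Systems

variable {X : Type u}

/-- `A` is the union of a countable family of pairwise disjoint members of `𝔖`. -/
def CountablyDecomposes (𝔖 : Set (Set X)) (A : Set X) : Prop :=
  ∃ 𝔈 : Set (Set X), 𝔈 ⊆ 𝔖 ∧ 𝔈.Countable ∧ 𝔈.PairwiseDisjoint id ∧ ⋃₀ 𝔈 = A

/-- `A` is the union of a finite family of pairwise disjoint members of `𝔖`. -/
def FinitelyDecomposes (𝔖 : Set (Set X)) (A : Set X) : Prop :=
  ∃ 𝔈 : Set (Set X), 𝔈 ⊆ 𝔖 ∧ 𝔈.Finite ∧ 𝔈.PairwiseDisjoint id ∧ ⋃₀ 𝔈 = A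

/-- Interval systems: differences and intersections decompose countably. -/
def IsIntervalSystem (𝔖 : Set (Set X)) : Prop :=
  ∀ A ∈ 𝔖, ∀ B ∈ 𝔖, CountablyDecomposes 𝔖 (A \ B) ∧ CountablyDecomposes 𝔖 (A ∩ B)

/-- Local finiteness: intersections, and differences of nested members, decompose finitely. -/
def IsLocallyFinite (𝔖 : Set (Set X)) : Prop :=
  ∀ A ∈ 𝔖, ∀ B ∈ 𝔖, FinitelyDecomposes 𝔖 (A ∩ B) ∧ (A ⊆ B → FinitelyDecomposes 𝔖 (B \ A))

/-- The sets that are finite (possibly empty) unions of members of `𝔖`. -/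
def finiteUnions (𝔖 : Set (Set X)) : Set (Set X) :=
  {A | ∃ 𝔈 : Set (Set X), 𝔈 ⊆ 𝔖 ∧ 𝔈.Finite ∧ ⋃₀ 𝔈 = A}

/-- `σ`-additivity of a group valued set function, the sum over a countable disjoint decomposition
being the unconditional (absolute) sum. -/
def IsMeasure {W : Type w} [AddCommGroup W] [TopologicalSpace W] (𝔖 : Set (Set X))
    (μ : 𝔖 → W) : Prop :=
  ∀ (ι : Type) [Countable ι] (A : 𝔖) (E : ι → 𝔖),
    Pairwise (fun i j => Disjoint (E i : Set X) (E j)) → (A : Set X) = ⋃ i, (E i : Set X) →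
      HasSum (fun i => μ (E i)) (μ A)

end Systems

/-! ### Envelopes and integrals -/

section Integrals

variable {X : Type u} {V : Type v} {W : Type w} {Z : Type z}

/-- The step function `∑ j, c j • χ_{E j}`. -/
noncomputable def stepFun [AddCommGroup V] {𝔖 : Set (Set X)} {n : ℕ} (c : Fin n → V)
    (E : Fin n → 𝔖) : X → V :=
  fun x => ∑ j, (E j : Set X).indicator (fun _ => c j) x

/-- The function `f` is approximated by `𝒜`: its graph is contained in `𝒜`. -/
def Approximates (𝒜 : Set (V × X)) (f : X → V) : Prop :=
  ∀ x, (f x, x) ∈ 𝒜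

/-- `𝒜^D`, the intersection of the fibres of `𝒜` over the points of `D`. -/
def fibre (𝒜 : Set (V × X)) (D : Set X) : Set V :=
  {v | ∀ x ∈ D, (v, x) ∈ 𝒜}

/-- `(⋃_{D ∈ 𝔇} 𝒜^D × D) ∪ ({0} × (X \ ⋃ 𝔇))`. -/
def generated [AddCommGroup V] (𝔇 : Set (Set X)) (𝒜 : Set (V × X)) : Set (V × X) :=
  (⋃ D ∈ 𝔇, fibre 𝒜 D ×ˢ D) ∪ ({0} ×ˢ (⋃₀ 𝔇)ᶜ)

/-- Envelopes of sets in `V` with respect to `𝔖`. -/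
def IsEnvelope [AddCommGroup V] (𝔖 : Set (Set X)) (𝒜 : Set (V × X)) : Prop :=
  (∃ (n : ℕ) (c : Fin n → V) (E : Fin n → 𝔖), Approximates 𝒜 (stepFun c E)) ∧
    ∃ 𝔇 : Set (Set X), 𝔇 ⊆ 𝔖 ∧ 𝔇.Countable ∧ 𝒜 = generated 𝔇 𝒜

variable [AddCommGroup V] [AddCommGroup W] [AddCommGroup Z] [TopologicalSpace Z]

/-- The bilinear sum of an envelope: the closure of the set of the pre-integrals of the step
functions contained in it. -/
def bilinearSum (L : V →+ W →+ Z) {𝔖 : Set (Set X)} (μ : 𝔖 → W) (𝒜 : Set (V × X)) : Set Z :=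
  closure {z | ∃ (n : ℕ) (c : Fin n → V) (E : Fin n → 𝔖),
    Approximates 𝒜 (stepFun c E) ∧ z = ∑ j, L (c j) (μ (E j))}

/-- `a` is the (ordinary) Lebesgue–McShane integral of `f`. -/
def HasIntegral (L : V →+ W →+ Z) {𝔖 : Set (Set X)} (μ : 𝔖 → W) (f : X → V) (a : Z) : Prop :=
  ∀ T ∈ 𝓝 (0 : Z), ∃ 𝒜 : Set (V × X),
    IsEnvelope 𝔖 𝒜 ∧ Approximates 𝒜 f ∧ ∀ z ∈ bilinearSum L μ 𝒜, z - a ∈ T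

/-- `a` is the extended Lebesgue–McShane integral of `f`. -/
def HasExtendedIntegral (L : V →+ W →+ Z) {𝔖 : Set (Set X)} (μ : 𝔖 → W) (f : X → V) (a : Z) :
    Prop :=
  ∀ T ∈ 𝓝 (0 : Z), ∃ A ∈ finiteUnions 𝔖, ∀ B ∈ finiteUnions 𝔖, A ⊆ B →
    ∃ ℬ : Set (V × X),
      IsEnvelope 𝔖 ℬ ∧ Approximates ℬ (B.indicator f) ∧ ∀ z ∈ bilinearSum L μ ℬ, z - a ∈ T

/-- Weakly negligible sets: every function supported on `N` has integral zero. -/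
def IsWeaklyNegligible (L : V →+ W →+ Z) {𝔖 : Set (Set X)} (μ : 𝔖 → W) (N : Set X) : Prop :=
  ∀ f : X → V, (∀ x, x ∉ N → f x = 0) → HasIntegral L μ f 0

end Integrals

/-! ### Stone completion -/

section Stone

variable {X : Type u}

/-- The `(∪, ∩, \)`-constructible closure of `𝔖`. -/
inductive Constructible (𝔖 : Set (Set X)) : Set X → Prop
  | basic {A : Set X} : A ∈ 𝔖 → Constructible 𝔖 A
  | union {A B : Set X} : Constructible 𝔖 A → Constructible 𝔖 B → Constructible 𝔖 (A ∪ B)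
  | inter {A B : Set X} : Constructible 𝔖 A → Constructible 𝔖 B → Constructible 𝔖 (A ∩ B)
  | diff {A B : Set X} : Constructible 𝔖 A → Constructible 𝔖 B → Constructible 𝔖 (A \ B)

/-- Filters on a set system `𝔚`: filter bases consisting of members of `𝔚` that are upward closed
within `𝔚`. -/
def IsFilterOn (𝔚 : Set (Set X)) (F : Set (Set X)) : Prop :=
  F ⊆ 𝔚 ∧ F.Nonempty ∧ ∅ ∉ F ∧ (∀ A ∈ F, ∀ B ∈ F, ∃ C ∈ F, C ⊆ A ∩ B) ∧
    ∀ A ∈ F, ∀ B ∈ 𝔚, A ⊆ B → B ∈ F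

/-- The Stone completion: the maximal filters on the constructible closure of `𝔖`. -/
def StoneSpace (𝔖 : Set (Set X)) : Type u :=
  {F : Set (Set X) // Maximal (IsFilterOn {A | Constructible 𝔖 A}) F}

/-- `β A`, the set of the maximal filters containing `A`. -/
def beta (𝔖 : Set (Set X)) (A : Set X) : Set (StoneSpace 𝔖) :=
  {x | A ∈ x.1}

/-- The set system `β𝔖`. -/
def betaSystem (𝔖 : Set (Set X)) : Set (Set (StoneSpace 𝔖)) :=
  beta 𝔖 '' 𝔖

/-- The transported set function `μ ∘ β⁻¹` on `β𝔖`. -/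
noncomputable def betaPush {W : Type w} {𝔖 : Set (Set X)} (μ : 𝔖 → W) : betaSystem 𝔖 → W :=
  fun T => μ ⟨T.2.choose, T.2.choose_spec.1⟩

/-- The topology of `X` is compatible with `𝔖`: every element of the Stone completion converges, as
a filter base, to exactly one point. -/
def IsCompatible [TopologicalSpace X] (𝔖 : Set (Set X)) : Prop :=
  ∀ x : StoneSpace 𝔖, ∃! p : X, ∀ U ∈ 𝓝 p, ∃ A ∈ x.1, A ⊆ U

/-- The limit map from the Stone completion to `X`. -/
noncomputable def limMap [TopologicalSpace X] {𝔖 : Set (Set X)} (h : IsCompatible 𝔖) :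
    StoneSpace 𝔖 → X :=
  fun x => (h x).choose

/-- `a` is the McShane integral of `f`: the extended Lebesgue–McShane integral of `f ∘ lim` with
respect to the transported set function. -/
def HasMcShaneIntegral {V : Type v} {W : Type w} {Z : Type z} [AddCommGroup V] [AddCommGroup W]
    [AddCommGroup Z] [TopologicalSpace Z] [TopologicalSpace X] {𝔖 : Set (Set X)}
    (h : IsCompatible 𝔖) (L : V →+ W →+ Z) (μ : 𝔖 → W) (f : X → V) (a : Z) : Prop :=
  HasExtendedIntegral L (betaPush μ) (f ∘ limMap h) a

/-! #### The map `β` is injective on constructible sets, so that `betaPush` is `μ ∘ β⁻¹` -/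

theorem exists_mem_not_mem {𝔖 : Set (Set X)} {A B : Set X} (hA : Constructible 𝔖 A)
    (hB : Constructible 𝔖 B) (h : (A \ B).Nonempty) : ∃ x : StoneSpace 𝔖, A ∈ x.1 ∧ B ∉ x.1 := by
  set 𝔚 : Set (Set X) := {C | Constructible 𝔖 C} with hW
  have hAB : A \ B ∈ 𝔚 := Constructible.diff hA hB
  have h0 : IsFilterOn 𝔚 {C | C ∈ 𝔚 ∧ A \ B ⊆ C} := by
    refine ⟨fun C hC => hC.1, ⟨A \ B, hAB, subset_rfl⟩, ?_, ?_, ?_⟩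
    · rintro ⟨-, h2⟩
      exact h.not_subset_empty h2
    · rintro C ⟨-, hC⟩ D ⟨-, hD⟩
      exact ⟨A \ B, ⟨hAB, subset_rfl⟩, subset_inter hC hD⟩
    · rintro C ⟨-, hC⟩ D hD hCD
      exact ⟨hD, hC.trans hCD⟩
  obtain ⟨M, hM0, hM⟩ := zorn_subset_nonempty {F | IsFilterOn 𝔚 F} (by
    intro c hc hchain hne
    refine ⟨⋃₀ c, ⟨?_, ?_, ?_, ?_, ?_⟩, fun s hs => subset_sUnion_of_mem hs⟩
    · exact sUnion_subset fun F hF => (hc hF).1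
    · obtain ⟨F, hF⟩ := hne
      obtain ⟨C, hC⟩ := (hc hF).2.1
      exact ⟨C, F, hF, hC⟩
    · rintro ⟨F, hF, h1⟩
      exact (hc hF).2.2.1 h1
    · rintro C ⟨F, hF, hC⟩ D ⟨G, hG, hD⟩
      rcases hchain.total hF hG with hle | hle
      · obtain ⟨K, hK, h1⟩ := (hc hG).2.2.2.1 C (hle hC) D hD
        exact ⟨K, ⟨G, hG, hK⟩, h1⟩
      · obtain ⟨K, hK, h1⟩ := (hc hF).2.2.2.1 C hC D (hle hD)
        exact ⟨K, ⟨F, hF, hK⟩, h1⟩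
    · rintro C ⟨F, hF, hC⟩ D hD hCD
      exact ⟨F, hF, (hc hF).2.2.2.2 C hC D hD hCD⟩) _ h0
  have hmem : A \ B ∈ M := hM0 ⟨hAB, subset_rfl⟩
  refine ⟨⟨M, hM⟩, hM.prop.2.2.2.2 _ hmem A hA sdiff_subset, fun hBM => ?_⟩
  obtain ⟨K, hK, h1⟩ := hM.prop.2.2.2.1 _ hmem _ hBM
  have : K = ∅ := subset_empty_iff.1 (h1.trans (by intro y hy; exact hy.1.2 hy.2))
  exact hM.prop.2.2.1 (this ▸ hK)

theorem beta_injective {𝔖 : Set (Set X)} {A B : Set X} (hA : Constructible 𝔖 A)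
    (hB : Constructible 𝔖 B) (h : beta 𝔖 A = beta 𝔖 B) : A = B := by
  apply subset_antisymm
  · by_contra hn
    obtain ⟨x, h1, h2⟩ := exists_mem_not_mem hA hB (sdiff_nonempty.2 hn)
    exact h2 ((Set.ext_iff.1 h x).1 h1)
  · by_contra hn
    obtain ⟨x, h1, h2⟩ := exists_mem_not_mem hB hA (sdiff_nonempty.2 hn)
    exact h2 ((Set.ext_iff.1 h x).2 h1)

theorem betaPush_beta {W : Type w} {𝔖 : Set (Set X)} (μ : 𝔖 → W) (A : 𝔖) :
    betaPush μ ⟨beta 𝔖 A, mem_image_of_mem _ A.2⟩ = μ A := by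
  have hT : beta 𝔖 (A : Set X) ∈ betaSystem 𝔖 := mem_image_of_mem _ A.2
  have : (⟨hT.choose, hT.choose_spec.1⟩ : 𝔖) = A :=
    Subtype.ext (beta_injective (.basic hT.choose_spec.1) (.basic A.2) hT.choose_spec.2)
  exact congrArg μ this

end Stone

/-! ### The classical case -/

/-- The bounded, possibly degenerate intervals of the real line. -/
def realIntervals : Set (Set ℝ) :=
  {I | I.OrdConnected ∧ Bornology.IsBounded I}

/-- The length of a bounded interval. -/
noncomputable def intervalLength : realIntervals → ℝ :=
  fun I => MeasureTheory.volume.real (I : Set ℝ)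

/-- The classical McShane integral on the real line: limit of the Riemann sums of `δ`-fine free
tagged families of non-overlapping compact intervals. The usual definition uses partitions of
`[-∞, ∞]` with `f (±∞) = 0`; here the pieces tagged by `±∞`, which lie outside `[-R, R]`, are left
out. -/
def HasClassicalMcShaneIntegral (f : ℝ → ℝ) (a : ℝ) : Prop :=
  ∀ ε > 0, ∃ δ : ℝ → ℝ, (∀ t, 0 < δ t) ∧ ∃ R : ℝ,
    ∀ (n : ℕ) (t u v : Fin n → ℝ), (∀ i, u i ≤ v i) →
      Pairwise (fun i j => Disjoint (Ioo (u i) (v i)) (Ioo (u j) (v j))) →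
      (∀ i, Icc (u i) (v i) ⊆ Ioo (t i - δ (t i)) (t i + δ (t i))) →
      Icc (-R) R ⊆ ⋃ i, Icc (u i) (v i) →
        |∑ i, f (t i) * (v i - u i) - a| < ε

end LMInt

/-! Both integrals live on one ring of sets, the finite disjoint unions of members of `𝔖`, with one
finitely additive content. The ring can be seen through the points of `X` or through those of the
Stone completion; `doubleContent` on the disjoint union carries both pictures. An envelope becomes a
set of pairs (value, point) that is locally constant with respect to countably many ring sets
(`IsOpenOver`), and pre-integrals become elementary integrals over the ring.

What the two pictures share is continuity of the content along increasing sequences that exhaust the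
visible points. On `X` this is σ-additivity; on the Stone completion such sequences stabilise by
compactness. Hence a locally constant set has a selection that is simple on each member of an
exhaustion (`exists_selection`), and any admissible step function completes it with vanishing error.
It follows that the values of a sum of two envelopes lie in the closure of the sums of their values,
that a function all of whose restrictions are null has small envelopes containing zero, and that
countably many such envelopes can be added (`exists_covers_sum`).

For `transfer`, only countably many `S ∈ 𝔖` enter an envelope. By (i) and (ii), off countably many
negligible sets a point and a suitable filter converging to it agree on membership in these `S`.
There an envelope of the function in one picture serves in the other; elsewhere the defect is
absorbed by a null envelope. Uniqueness follows from a selection common to two envelopes.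

On the line all exceptional points are endpoints, which are negligible in both pictures. Lebesgue
integrability gives the gauge integral by Vitali–Carathéodory; a gauge gives an envelope whose step
functions have integrals close to Riemann sums; and an envelope with small values is, after
subtraction of one of its step functions, dominated by a function of small integral, which yields
measurability, integrability and the value. -/

namespace LMInt

/-! ### Finite contents on rings of sets -/

/-- A finitely additive set function on a ring of sets. -/
structure RingContent (Ω : Type*) (W : Type*) [AddCommGroup W] where
  sets : Set (Set Ω)
  empty_mem : ∅ ∈ sets
  union_mem : ∀ {A B : Set Ω}, A ∈ sets → B ∈ sets → A ∪ B ∈ sets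
  diff_mem : ∀ {A B : Set Ω}, A ∈ sets → B ∈ sets → A \ B ∈ sets
  val : Set Ω → W
  val_union : ∀ {A B : Set Ω}, A ∈ sets → B ∈ sets → Disjoint A B → val (A ∪ B) = val A + val B

namespace RingContent

variable {Ω W V Z : Type*} [AddCommGroup W] [AddCommGroup V] [AddCommGroup Z]
  (P : RingContent Ω W) {A B : Set Ω}

theorem val_empty : P.val ∅ = 0 := by
  have := P.val_union P.empty_mem P.empty_mem (disjoint_empty _)
  simpa using this

theorem inter_mem (hA : A ∈ P.sets) (hB : B ∈ P.sets) : A ∩ B ∈ P.sets := by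
  rw [← sdiff_sdiff_right_self]
  exact P.diff_mem hA (P.diff_mem hA hB)

theorem val_inter_add_diff (hA : A ∈ P.sets) (hB : B ∈ P.sets) :
    P.val (A ∩ B) + P.val (A \ B) = P.val A := by
  rw [← P.val_union (P.inter_mem hA hB) (P.diff_mem hA hB)
    (disjoint_sdiff_right.mono_left inter_subset_right), inter_union_sdiff]

theorem biUnion_mem {κ : Type*} (t : Finset κ) {E : κ → Set Ω} (h : ∀ k ∈ t, E k ∈ P.sets) :
    (⋃ k ∈ t, E k) ∈ P.sets := by
  classical
  induction t using Finset.induction_on with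
  | empty => simpa using P.empty_mem
  | insert a t ha ih =>
    rw [Finset.set_biUnion_insert]
    exact P.union_mem (h a (by simp)) (ih fun k hk => h k (by simp [hk]))

theorem sUnion_mem {𝔈 : Set (Set Ω)} (hf : 𝔈.Finite) (h : 𝔈 ⊆ P.sets) : ⋃₀ 𝔈 ∈ P.sets := by
  have := P.biUnion_mem hf.toFinset (E := id) (fun k hk => h (by simpa using hk))
  rw [sUnion_eq_biUnion]
  simpa using this

theorem val_biUnion {κ : Type*} (t : Finset κ) {E : κ → Set Ω} (h : ∀ k ∈ t, E k ∈ P.sets)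
    (hd : ∀ k ∈ t, ∀ l ∈ t, k ≠ l → Disjoint (E k) (E l)) :
    P.val (⋃ k ∈ t, E k) = ∑ k ∈ t, P.val (E k) := by
  classical
  induction t using Finset.induction_on with
  | empty => simpa using P.val_empty
  | insert a t ha ih =>
    rw [Finset.set_biUnion_insert, Finset.sum_insert ha, P.val_union (h a (by simp))
      (P.biUnion_mem t fun k hk => h k (by simp [hk])), ih (fun k hk => h k (by simp [hk]))
      (fun k hk l hl => hd k (by simp [hk]) l (by simp [hl]))]
    simp only [disjoint_iUnion_right]
    exact fun k hk => hd a (by simp) k (by simp [hk]) (by rintro rfl; exact ha hk)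

/-! ### The elementary integral of step functions -/

/-- `z` is the elementary integral of a representation of the step function `s`. -/
def Rep (L : V →+ W →+ Z) (s : Ω → V) (z : Z) : Prop :=
  ∃ (κ : Type) (_ : Fintype κ) (c : κ → V) (E : κ → Set Ω), (∀ k, E k ∈ P.sets) ∧
    (s = fun ω => ∑ k, (E k).indicator (fun _ => c k) ω) ∧ z = ∑ k, L (c k) (P.val (E k))

/-- Induction on the number of sets: cutting `A` along `E a` changes the constant `d` into `d - c a`
on `A ∩ E a` and keeps it on `A \ E a`. Additivity alone suffices, without a common refinement of
all the sets. -/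
theorem sum_val_inter_eq (L : V →+ W →+ Z) {κ : Type*} (c : κ → V) {E : κ → Set Ω}
    (hE : ∀ k, E k ∈ P.sets) (t : Finset κ) : ∀ {A : Set Ω}, A ∈ P.sets → ∀ d : V,
      (∀ ω ∈ A, ∑ k ∈ t, (E k).indicator (fun _ => c k) ω = d) →
        ∑ k ∈ t, L (c k) (P.val (E k ∩ A)) = L d (P.val A) := by
  classical
  induction t using Finset.induction_on with
  | empty =>
    intro A hA d h
    rcases A.eq_empty_or_nonempty with rfl | ⟨ω, hω⟩
    · simp [P.val_empty]
    · have := h ω hω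
      simp at this
      simp [← this]
  | insert a t ha ih =>
    intro A hA d h
    simp only [Finset.sum_insert ha] at h ⊢
    have h1 := ih (P.inter_mem hA (hE a)) (d - c a) (fun ω hω => by
      rw [← h ω hω.1, indicator_of_mem hω.2]; abel)
    have h2 := ih (P.diff_mem hA (hE a)) d (fun ω hω => by
      rw [← h ω hω.1, indicator_of_notMem hω.2]; abel)
    have h3 : ∀ k, P.val (E k ∩ A) = P.val (E k ∩ (A ∩ E a)) + P.val (E k ∩ (A \ E a)) := by
      intro k
      rw [← P.val_inter_add_diff (P.inter_mem (hE k) hA) (hE a), inter_assoc, inter_sdiff_assoc]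
    simp only [h3, map_add, Finset.sum_add_distrib]
    rw [h1, h2, ← P.val_inter_add_diff hA (hE a)]
    have h4 : E a ∩ (A ∩ E a) = A ∩ E a := by
      ext; simp only [mem_inter_iff]; tauto
    have h5 : E a ∩ (A \ E a) = ∅ := by
      ext; simp only [mem_inter_iff, Set.mem_sdiff, mem_empty_iff_false]; tauto
    rw [h4, h5, P.val_empty]
    simp only [map_zero, map_sub, AddMonoidHom.sub_apply, map_add]
    abel

variable {P} {L : V →+ W →+ Z} {s t : Ω → V} {z z' : Z}

theorem Rep.add (h : P.Rep L s z) (h' : P.Rep L t z') : P.Rep L (s + t) (z + z') := by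
  obtain ⟨κ, _, c, E, hE, rfl, rfl⟩ := h
  obtain ⟨κ', _, c', E', hE', rfl, rfl⟩ := h'
  refine ⟨κ ⊕ κ', inferInstance, Sum.elim c c', Sum.elim E E', ?_, ?_, ?_⟩
  · rintro (k | k)
    exacts [hE k, hE' k]
  · funext ω; simp
  · simp

theorem Rep.neg (h : P.Rep L s z) : P.Rep L (-s) (-z) := by
  obtain ⟨κ, _, c, E, hE, rfl, rfl⟩ := h
  refine ⟨κ, inferInstance, -c, E, hE, ?_, ?_⟩
  · funext ω
    simp only [Pi.neg_apply, ← Finset.sum_neg_distrib]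
    refine Finset.sum_congr rfl fun k _ => ?_
    by_cases hω : ω ∈ E k <;> simp [hω]
  · simp

/-- On the union of all the sets the sum is constantly zero, so `sum_val_inter_eq` applies. This
makes the elementary integral independent of the representation. -/
theorem Rep.eq_zero (h : P.Rep L 0 z) : z = 0 := by
  obtain ⟨κ, _, c, E, hE, h0, rfl⟩ := h
  have h1 := P.sum_val_inter_eq L c hE Finset.univ (A := ⋃ k ∈ (Finset.univ : Finset κ), E k)
    (P.biUnion_mem _ fun k _ => hE k) 0 (fun ω _ => (congrFun h0 ω).symm)
  simp only [map_zero, AddMonoidHom.zero_apply] at h1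
  rw [← h1]
  refine Finset.sum_congr rfl fun k _ => ?_
  rw [inter_eq_left.2]
  simpa using subset_iUnion E k

theorem Rep.unique (h : P.Rep L s z) (h' : P.Rep L s z') : z = z' := by
  have := (h.add h'.neg)
  rw [add_neg_cancel] at this
  exact sub_eq_zero.1 (by rw [sub_eq_add_neg]; exact this.eq_zero)

theorem Rep.indicator (hA : A ∈ P.sets) (h : P.Rep L s z) : ∃ z', P.Rep L (A.indicator s) z' := by
  obtain ⟨κ, _, c, E, hE, rfl, rfl⟩ := h
  refine ⟨_, κ, inferInstance, c, fun k => A ∩ E k, fun k => P.inter_mem hA (hE k), ?_, rfl⟩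
  funext ω
  by_cases hω : ω ∈ A
  · simp only [indicator_of_mem hω]
    exact Finset.sum_congr rfl fun k _ => by
      by_cases h : ω ∈ E k
      · rw [indicator_of_mem h, indicator_of_mem (show ω ∈ A ∩ E k from ⟨hω, h⟩)]
      · rw [indicator_of_notMem h, indicator_of_notMem fun h' => h h'.2]
  · simp [hω]

variable (P L)

/-- Step functions over a ring of sets. -/
def IsStep (s : Ω → V) : Prop :=
  ∃ (κ : Type) (_ : Fintype κ) (c : κ → V) (E : κ → Set Ω), (∀ k, E k ∈ P.sets) ∧
    s = fun ω => ∑ k, (E k).indicator (fun _ => c k) ω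

open Classical in
/-- The elementary integral. -/
noncomputable def integral (s : Ω → V) : Z :=
  if h : ∃ z, P.Rep L s z then h.choose else 0

variable {P L}

theorem IsStep.exists_rep (L : V →+ W →+ Z) (h : P.IsStep s) : ∃ z, P.Rep L s z := by
  obtain ⟨κ, i, c, E, hE, hs⟩ := h
  exact ⟨_, κ, i, c, E, hE, hs, rfl⟩

theorem Rep.isStep (h : P.Rep L s z) : P.IsStep s := by
  obtain ⟨κ, i, c, E, hE, hs, -⟩ := h
  exact ⟨κ, i, c, E, hE, hs⟩

theorem Rep.integral_eq (h : P.Rep L s z) : P.integral L s = z := by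
  have h1 : ∃ z, P.Rep L s z := ⟨z, h⟩
  rw [RingContent.integral, dif_pos h1]
  exact h1.choose_spec.unique h

theorem IsStep.rep (L : V →+ W →+ Z) (h : P.IsStep s) : P.Rep L s (P.integral L s) := by
  obtain ⟨z, hz⟩ := h.exists_rep L
  rwa [hz.integral_eq]

theorem isStep_zero : P.IsStep (0 : Ω → V) :=
  ⟨Empty, inferInstance, Empty.elim, Empty.elim, fun k => k.elim, by funext; simp⟩

theorem IsStep.neg (hs : P.IsStep s) : P.IsStep (-s) :=
  (hs.rep (0 : V →+ W →+ W)).neg.isStep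

theorem IsStep.add (hs : P.IsStep s) (ht : P.IsStep t) : P.IsStep (s + t) :=
  ((hs.rep (0 : V →+ W →+ W)).add (ht.rep _)).isStep

theorem IsStep.sub (hs : P.IsStep s) (ht : P.IsStep t) : P.IsStep (s - t) := by
  rw [sub_eq_add_neg]
  exact hs.add ht.neg

theorem IsStep.indicator (hA : A ∈ P.sets) (hs : P.IsStep s) : P.IsStep (A.indicator s) := by
  obtain ⟨z, hz⟩ := (hs.rep (0 : V →+ W →+ W)).indicator hA
  exact hz.isStep

theorem isStep_const (hA : A ∈ P.sets) (c : V) : P.IsStep (A.indicator fun _ => c) :=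
  ⟨Unit, inferInstance, fun _ => c, fun _ => A, fun _ => hA, by simp⟩

theorem isStep_sum {κ : Type*} (T : Finset κ) {f : κ → Ω → V} (h : ∀ k ∈ T, P.IsStep (f k)) :
    P.IsStep (∑ k ∈ T, f k) := by
  classical
  induction T using Finset.induction_on with
  | empty => simpa using isStep_zero
  | insert a T ha ih =>
    rw [Finset.sum_insert ha]
    exact (h a (by simp)).add (ih fun k hk => h k (by simp [hk]))

theorem integral_zero : P.integral L (0 : Ω → V) = 0 :=
  (isStep_zero.rep L).eq_zero

theorem integral_add (hs : P.IsStep s) (ht : P.IsStep t) :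
    P.integral L (s + t) = P.integral L s + P.integral L t :=
  ((hs.rep L).add (ht.rep L)).integral_eq

theorem integral_sub (hs : P.IsStep s) (ht : P.IsStep t) :
    P.integral L (s - t) = P.integral L s - P.integral L t := by
  rw [sub_eq_add_neg, sub_eq_add_neg]
  exact ((hs.rep L).add (ht.rep L).neg).integral_eq

theorem integral_indicator_add_diff (hA : A ∈ P.sets) (hB : B ∈ P.sets) (hBA : B ⊆ A)
    (hs : P.IsStep s) :
    P.integral L (B.indicator s) + P.integral L ((A \ B).indicator s) =
      P.integral L (A.indicator s) := by
  rw [← integral_add (hs.indicator hB) (hs.indicator (P.diff_mem hA hB)),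
    ← union_sdiff_cancel hBA, indicator_union_of_disjoint disjoint_sdiff_right,
    union_sdiff_cancel hBA]
  rfl

/-- A step function is constant on the members of a finite cover. -/
theorem IsStep.exists_finite_cover (hs : P.IsStep s) {U : Set Ω} (hU : U ∈ P.sets) :
    ∃ 𝔇 : Set (Set Ω), 𝔇 ⊆ P.sets ∧ 𝔇.Finite ∧
      ∀ ω ∈ U, ∃ D ∈ 𝔇, ω ∈ D ∧ ∀ ω' ∈ D, s ω' = s ω := by
  classical
  obtain ⟨κ, _, c, E, hE, rfl⟩ := hs
  generalize (Finset.univ : Finset κ) = T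
  induction T using Finset.induction_on with
  | empty =>
    exact ⟨{U}, by simpa using hU, finite_singleton _, fun ω hω => ⟨U, rfl, hω, fun _ _ => by simp⟩⟩
  | insert a T ha ih =>
    obtain ⟨𝔇, h1, h2, h3⟩ := ih
    refine ⟨(· ∩ E a) '' 𝔇 ∪ (· \ E a) '' 𝔇, ?_, (h2.image _).union (h2.image _), ?_⟩
    · rintro _ (⟨D, hD, rfl⟩ | ⟨D, hD, rfl⟩)
      exacts [P.inter_mem (h1 hD) (hE a), P.diff_mem (h1 hD) (hE a)]
    · intro ω hω
      obtain ⟨D, hD, hωD, h⟩ := h3 ω hω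
      beta_reduce at h
      simp only [Finset.sum_insert ha]
      by_cases ha : ω ∈ E a
      · exact ⟨D ∩ E a, .inl ⟨D, hD, rfl⟩, ⟨hωD, ha⟩, fun ω' hω' => by
          rw [h ω' hω'.1, indicator_of_mem hω'.2, indicator_of_mem ha]⟩
      · exact ⟨D \ E a, .inr ⟨D, hD, rfl⟩, ⟨hωD, ha⟩, fun ω' hω' => by
          rw [h ω' hω'.1, indicator_of_notMem hω'.2, indicator_of_notMem ha]⟩

/-- `Q` may be arbitrary, because a step function is constant on the pieces of a finite cover. -/
theorem IsStep.inter_preimage_mem (hs : P.IsStep s) {U : Set Ω} (hU : U ∈ P.sets) (Q : Set V) :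
    U ∩ s ⁻¹' Q ∈ P.sets := by
  obtain ⟨𝔇, h1, h2, h3⟩ := hs.exists_finite_cover hU
  have : U ∩ s ⁻¹' Q = U ∩ ⋃₀ {D ∈ 𝔇 | ∀ ω ∈ D, s ω ∈ Q} := by
    ext ω
    simp only [mem_inter_iff, mem_preimage, mem_sUnion, mem_ofPred_eq, and_congr_right_iff]
    intro hω
    constructor
    · intro h
      obtain ⟨D, hD, hωD, h'⟩ := h3 ω hω
      exact ⟨D, ⟨hD, fun ω' hω' => by rwa [h' ω' hω']⟩, hωD⟩
    · rintro ⟨D, ⟨-, h⟩, hωD⟩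
      exact h ω hωD
  rw [this]
  exact P.inter_mem hU (P.sUnion_mem (h2.subset (sep_subset _ _)) ((sep_subset _ _).trans h1))

theorem IsStep.exists_support_subset (hs : P.IsStep s) : ∃ U ∈ P.sets, ∀ ω ∉ U, s ω = 0 := by
  classical
  obtain ⟨κ, _, c, E, hE, rfl⟩ := hs
  refine ⟨_, P.biUnion_mem Finset.univ fun k _ => hE k, fun ω hω => ?_⟩
  simp only [Finset.mem_univ, iUnion_true, mem_iUnion, not_exists] at hω
  exact Finset.sum_eq_zero fun k _ => indicator_of_notMem (hω k) _

/-- `ρ` takes finitely many values on `A`, each on a member of the ring. -/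
def SimpleOn (P : RingContent Ω W) {α : Type*} (ρ : Ω → α) (A : Set Ω) : Prop :=
  (ρ '' A).Finite ∧ ∀ v, A ∩ ρ ⁻¹' {v} ∈ P.sets

theorem SimpleOn.isStep {ρ : Ω → V} (h : P.SimpleOn ρ A) : P.IsStep (A.indicator ρ) := by
  classical
  have : A.indicator ρ = ∑ v ∈ h.1.toFinset, (A ∩ ρ ⁻¹' {v}).indicator fun _ => v := by
    funext ω
    rw [Finset.sum_apply]
    by_cases hω : ω ∈ A
    · rw [Finset.sum_eq_single (ρ ω)]
      · simp [hω, indicator]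
      · intro v _ hv
        refine indicator_of_notMem (fun h => hv ?_) _
        exact h.2.symm
      · intro h'
        simp at h'
        exact absurd rfl (h' ω hω)
    · rw [indicator_of_notMem hω, Finset.sum_eq_zero]
      exact fun v _ => indicator_of_notMem (fun h => hω h.1) _
  rw [this]
  exact isStep_sum _ fun v _ => isStep_const (h.2 v) v

end RingContent


namespace RingContent

/-! ### Exhaustions and locally constant selections -/

variable {Ω X W V Z α : Type*} [AddCommGroup W] [AddCommGroup V] [AddCommGroup Z]
  {P : RingContent Ω W} {j : X → Ω} {A B U : Set Ω}

/-- `G` is an increasing sequence in the ring, starting with `∅`, that exhausts the part of `A`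
seen by `j`. -/
structure Exhausts (P : RingContent Ω W) (j : X → Ω) (G : ℕ → Set Ω) (A : Set Ω) : Prop where
  mem : ∀ n, G n ∈ P.sets
  zero : G 0 = ∅
  mono : Monotone G
  subset : ∀ n, G n ⊆ A
  cover : ∀ x, j x ∈ A → ∃ n, j x ∈ G n

theorem Exhausts.inter {G : ℕ → Set Ω} (h : Exhausts P j G A) (hB : B ∈ P.sets) :
    Exhausts P j (fun n => G n ∩ B) (A ∩ B) where
  mem n := P.inter_mem (h.mem n) hB
  zero := by simp [h.zero]
  mono _ _ hmn := inter_subset_inter_left _ (h.mono hmn)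
  subset n := inter_subset_inter_left _ (h.subset n)
  cover x hx := by
    obtain ⟨n, hn⟩ := h.cover x hx.1
    exact ⟨n, hn, hx.2⟩

theorem Exhausts.union {G G' : ℕ → Set Ω} (h : Exhausts P j G A) (h' : Exhausts P j G' B) :
    Exhausts P j (fun n => G n ∪ G' n) (A ∪ B) where
  mem n := P.union_mem (h.mem n) (h'.mem n)
  zero := by simp [h.zero, h'.zero]
  mono _ _ hmn := union_subset_union (h.mono hmn) (h'.mono hmn)
  subset n := union_subset_union (h.subset n) (h'.subset n)
  cover x hx := by
    rcases hx with hx | hx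
    · obtain ⟨n, hn⟩ := h.cover x hx
      exact ⟨n, .inl hn⟩
    · obtain ⟨n, hn⟩ := h'.cover x hx
      exact ⟨n, .inr hn⟩

/-- The content is continuous along the sequences that `j` sees as exhaustions. -/
def IsContinuousAlong [TopologicalSpace W] (P : RingContent Ω W) (j : X → Ω) : Prop :=
  ∀ ⦃A : Set Ω⦄, A ∈ P.sets → ∀ G : ℕ → Set Ω, Exhausts P j G A →
    Tendsto (fun n => P.val (G n)) atTop (𝓝 (P.val A))

theorem IsContinuousAlong.tendsto_integral [TopologicalSpace W] [TopologicalSpace Z]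
    [IsTopologicalAddGroup Z] (hP : P.IsContinuousAlong j) {L : V →+ W →+ Z}
    (hL : ∀ c, Continuous (L c)) (hA : A ∈ P.sets) {G : ℕ → Set Ω} (hG : Exhausts P j G A)
    {s : Ω → V} (hs : P.IsStep s) :
    Tendsto (fun n => P.integral L ((G n).indicator s)) atTop
      (𝓝 (P.integral L (A.indicator s))) := by
  obtain ⟨κ, _, c, E, hE, rfl⟩ := hs
  have key : ∀ B ∈ P.sets, P.integral L (B.indicator fun ω =>
      ∑ k, (E k).indicator (fun _ => c k) ω) = ∑ k, L (c k) (P.val (B ∩ E k)) := by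
    intro B hB
    refine Rep.integral_eq ⟨κ, inferInstance, c, fun k => B ∩ E k, fun k => P.inter_mem hB (hE k),
      ?_, rfl⟩
    funext ω
    by_cases hω : ω ∈ B
    · simp only [indicator_of_mem hω]
      refine Finset.sum_congr rfl fun k _ => ?_
      by_cases h : ω ∈ E k
      · rw [indicator_of_mem h, indicator_of_mem (show ω ∈ B ∩ E k from ⟨hω, h⟩)]
      · rw [indicator_of_notMem h, indicator_of_notMem fun h' => h h'.2]
    · simp [hω]
  rw [key A hA]
  simp only [fun n => key (G n) (hG.mem n)]
  exact tendsto_finsetSum _ fun k _ =>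
    ((hL (c k)).tendsto _).comp (hP (P.inter_mem hA (hE k)) _ (hG.inter (hE k)))

/-- Countably many members of the ring witness that `𝒜` is locally constant over `U`. -/
def IsOpenOver (P : RingContent Ω W) (U : Set Ω) (𝒜 : Set (α × Ω)) : Prop :=
  ∃ 𝔇 : Set (Set Ω), 𝔇 ⊆ P.sets ∧ 𝔇.Countable ∧
    ∀ v ω, ω ∈ U → (v, ω) ∈ 𝒜 → ∃ D ∈ 𝔇, ω ∈ D ∧ ∀ ω' ∈ D, (v, ω') ∈ 𝒜

theorem IsOpenOver.mono {𝒜 : Set (α × Ω)} (h : P.IsOpenOver U 𝒜) (hB : B ⊆ U) :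
    P.IsOpenOver B 𝒜 := by
  obtain ⟨𝔇, h1, h2, h3⟩ := h
  exact ⟨𝔇, h1, h2, fun v ω hω => h3 v ω (hB hω)⟩

theorem IsOpenOver.inter {𝒜 ℬ : Set (α × Ω)} (h : P.IsOpenOver U 𝒜) (h' : P.IsOpenOver U ℬ) :
    P.IsOpenOver U (𝒜 ∩ ℬ) := by
  obtain ⟨𝔇, h1, h2, h3⟩ := h
  obtain ⟨𝔇', h1', h2', h3'⟩ := h'
  refine ⟨image2 (· ∩ ·) 𝔇 𝔇', ?_, h2.image2 h2' _, ?_⟩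
  · rintro _ ⟨D, hD, D', hD', rfl⟩
    exact P.inter_mem (h1 hD) (h1' hD')
  · rintro v ω hω ⟨hv, hv'⟩
    obtain ⟨D, hD, hωD, h⟩ := h3 v ω hω hv
    obtain ⟨D', hD', hωD', h'⟩ := h3' v ω hω hv'
    exact ⟨D ∩ D', ⟨D, hD, D', hD', rfl⟩, ⟨hωD, hωD'⟩, fun ω' hω' => ⟨h ω' hω'.1, h' ω' hω'.2⟩⟩

theorem IsOpenOver.iUnion {κ : Type*} [Countable κ] {𝒜 : κ → Set (α × Ω)}
    (h : ∀ k, P.IsOpenOver U (𝒜 k)) : P.IsOpenOver U (⋃ k, 𝒜 k) := by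
  choose 𝔇 h1 h2 h3 using h
  refine ⟨⋃ k, 𝔇 k, iUnion_subset h1, countable_iUnion h2, fun v ω hω hv => ?_⟩
  obtain ⟨k, hk⟩ := mem_iUnion.1 hv
  obtain ⟨D, hD, hωD, h⟩ := h3 k v ω hω hk
  exact ⟨D, mem_iUnion.2 ⟨k, hD⟩, hωD, fun ω' hω' => mem_iUnion.2 ⟨k, h ω' hω'⟩⟩

theorem IsOpenOver.union {𝒜 ℬ : Set (α × Ω)} (h : P.IsOpenOver U 𝒜) (h' : P.IsOpenOver U ℬ) :
    P.IsOpenOver U (𝒜 ∪ ℬ) := by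
  rw [union_eq_iUnion]
  exact .iUnion fun b => by cases b <;> assumption

theorem isOpenOver_snd_preimage (hU : U ∈ P.sets) (T : Set α) :
    P.IsOpenOver U (T ×ˢ univ : Set (α × Ω)) :=
  ⟨{U}, by simpa using hU, countable_singleton _, fun _ _ hω hv =>
    ⟨U, rfl, hω, fun _ _ => ⟨hv.1, mem_univ _⟩⟩⟩

/-- The pointwise sum of two subsets of `V × Ω`. -/
def pointwiseSum (𝒜 ℬ : Set (V × Ω)) : Set (V × Ω) :=
  {p | ∃ v w, (v, p.2) ∈ 𝒜 ∧ (w, p.2) ∈ ℬ ∧ v + w = p.1}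

theorem IsOpenOver.pointwiseSum {𝒜 ℬ : Set (V × Ω)} (h : P.IsOpenOver U 𝒜)
    (h' : P.IsOpenOver U ℬ) : P.IsOpenOver U (pointwiseSum 𝒜 ℬ) := by
  obtain ⟨𝔇, h1, h2, h3⟩ := h
  obtain ⟨𝔇', h1', h2', h3'⟩ := h'
  refine ⟨image2 (· ∩ ·) 𝔇 𝔇', ?_, h2.image2 h2' _, ?_⟩
  · rintro _ ⟨D, hD, D', hD', rfl⟩
    exact P.inter_mem (h1 hD) (h1' hD')
  · rintro _ ω hω ⟨v, w, hv, hw, rfl⟩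
    obtain ⟨D, hD, hωD, h⟩ := h3 v ω hω hv
    obtain ⟨D', hD', hωD', h'⟩ := h3' w ω hω hw
    exact ⟨D ∩ D', ⟨D, hD, D', hD', rfl⟩, ⟨hωD, hωD'⟩,
      fun ω' hω' => ⟨v, w, h ω' hω'.1, h' ω' hω'.2, rfl⟩⟩

/-- Composing the values with a map that depends on those of a step function. -/
theorem IsOpenOver.comp_step {β : Type*} {𝒜 : Set (β × Ω)} (h : P.IsOpenOver U 𝒜)
    (hU : U ∈ P.sets) {s : Ω → V} (hs : P.IsStep s) (φ : V → α → β) :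
    P.IsOpenOver U {p : α × Ω | (φ (s p.2) p.1, p.2) ∈ 𝒜} := by
  obtain ⟨𝔇, h1, h2, h3⟩ := h
  obtain ⟨𝔇', h1', h2', h3'⟩ := hs.exists_finite_cover hU
  refine ⟨image2 (· ∩ ·) 𝔇 𝔇', ?_, h2.image2 h2'.countable _, ?_⟩
  · rintro _ ⟨D, hD, D', hD', rfl⟩
    exact P.inter_mem (h1 hD) (h1' hD')
  · intro v ω hω hv
    obtain ⟨D, hD, hωD, h⟩ := h3 _ ω hω hv
    obtain ⟨D', hD', hωD', h'⟩ := h3' ω hω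
    refine ⟨D ∩ D', ⟨D, hD, D', hD', rfl⟩, ⟨hωD, hωD'⟩, fun ω' hω' => ?_⟩
    have := h ω' hω'.1
    rw [mem_ofPred_eq, h' ω' hω'.2]
    exact this

theorem isOpenOver_graph (hU : U ∈ P.sets) {s : Ω → V} (hs : P.IsStep s) :
    P.IsOpenOver U {p : V × Ω | p.1 = s p.2} := by
  have := (isOpenOver_snd_preimage (P := P) hU {p : V × V | p.1 = p.2}).comp_step hU hs
    (fun v w => (w, v))
  refine cast (congrArg _ ?_) this
  ext p
  simp

/-- Enumerate the witnessing sets on which some constant lies in `𝒜` and let `ρ` take the constant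
of the first one containing the point. The first `n` sets form `G n`, so `ρ` has finitely many
values there. Only points `j x` have to be reached, which is why exhaustion is relative to `j`. -/
theorem IsOpenOver.exists_selection [Nonempty α] {𝒜 : Set (α × Ω)} (hA : A ∈ P.sets)
    (h : P.IsOpenOver A 𝒜) (hne : ∀ x, j x ∈ A → ∃ v, (v, j x) ∈ 𝒜) :
    ∃ (G : ℕ → Set Ω) (ρ : Ω → α), Exhausts P j G A ∧
      ∀ n, P.SimpleOn ρ (G n) ∧ ∀ ω ∈ G n, (ρ ω, ω) ∈ 𝒜 := by
  classical
  obtain ⟨𝔇, h1, h2, h3⟩ := h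
  -- The empty set is adjoined so that the family is nonempty and can be indexed by `ℕ`.
  obtain ⟨D, hD⟩ := Set.Countable.exists_eq_range
    (s := {D ∈ 𝔇 | ∃ v, ∀ ω ∈ D, (v, ω) ∈ 𝒜} ∪ {∅})
    ((h2.mono (sep_subset _ _)).union (countable_singleton _)) ⟨∅, .inr rfl⟩
  have hDr : ∀ k, D k ∈ {D ∈ 𝔇 | ∃ v, ∀ ω ∈ D, (v, ω) ∈ 𝒜} ∪ {∅} := fun k => hD ▸ mem_range_self k
  have hDs : ∀ k, D k ∈ P.sets := fun k => by
    rcases hDr k with h | h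
    · exact h1 h.1
    · rw [h]; exact P.empty_mem
  have hDv : ∀ k, ∃ v, ∀ ω ∈ D k, (v, ω) ∈ 𝒜 := fun k => by
    rcases hDr k with h | h
    · exact h.2
    · exact ⟨Classical.arbitrary α, fun ω hω => by rw [h] at hω; exact hω.elim⟩
  choose v hv using hDv
  let ρ : Ω → α := fun ω => if h : ∃ k, ω ∈ D k then v (Nat.find h) else Classical.arbitrary α
  let G : ℕ → Set Ω := fun n => ⋃ k ∈ Finset.range n, D k ∩ A
  have hmem : ∀ n ω, ω ∈ G n ↔ ∃ k < n, ω ∈ D k ∧ ω ∈ A := fun n ω => by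
    simp [G, and_left_comm]
  have hρ : ∀ n, ∀ ω ∈ G n, ∃ k < n, ω ∈ D k ∧ ρ ω = v k ∧ ∀ l < k, ω ∉ D l := by
    intro n ω hω
    obtain ⟨k, hk, hωk, -⟩ := (hmem n ω).1 hω
    have h : ∃ k, ω ∈ D k := ⟨k, hωk⟩
    exact ⟨Nat.find h, (Nat.find_min' h hωk).trans_lt hk, Nat.find_spec h, dif_pos h,
      fun l hl => Nat.find_min h hl⟩
  refine ⟨G, ρ, ⟨?_, ?_, ?_, ?_, ?_⟩, fun n => ⟨⟨?_, fun w => ?_⟩, ?_⟩⟩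
  · exact fun n => P.biUnion_mem _ fun k _ => P.inter_mem (hDs k) hA
  · simp [G]
  · intro m n hmn ω
    rw [hmem, hmem]
    rintro ⟨k, hk, h⟩
    exact ⟨k, hk.trans_le hmn, h⟩
  · intro n ω
    rw [hmem]
    rintro ⟨k, hk, h⟩
    exact h.2
  · intro x hx
    obtain ⟨w, hw⟩ := hne x hx
    obtain ⟨E, hE, hxE, h⟩ := h3 w _ hx hw
    have : E ∈ range D := hD ▸ .inl ⟨hE, w, h⟩
    obtain ⟨k, rfl⟩ := this
    exact ⟨k + 1, (hmem _ _).2 ⟨k, k.lt_succ_self, hxE, hx⟩⟩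
  · refine ((Finset.range n).image v).finite_toSet.subset ?_
    rintro _ ⟨ω, hω, rfl⟩
    obtain ⟨k, hk, -, h, -⟩ := hρ n ω hω
    simp only [Finset.coe_image, Finset.coe_range]
    exact ⟨k, hk, h.symm⟩
  -- A level set consists of the regions where `k` is the first index hit, for those `k` with `v k =
  -- w`.
  · have : G n ∩ ρ ⁻¹' {w} = ⋃ k ∈ (Finset.range n).filter fun k => v k = w,
        (D k ∩ A) \ ⋃ l ∈ Finset.range k, D l := by
      ext ω
      simp only [mem_inter_iff, mem_preimage, mem_singleton_iff, mem_iUnion, Finset.mem_filter,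
        Finset.mem_range, Set.mem_sdiff, exists_prop, not_exists, not_and]
      constructor
      · rintro ⟨hω, h⟩
        obtain ⟨k, hk, hωk, h', hl⟩ := hρ n ω hω
        obtain ⟨-, -, -, hωA⟩ := (hmem n ω).1 hω
        exact ⟨k, ⟨hk, h'.symm.trans h⟩, ⟨hωk, hωA⟩, hl⟩
      · rintro ⟨k, ⟨hk, rfl⟩, ⟨hωk, hωA⟩, hl⟩
        have hω : ω ∈ G n := (hmem n ω).2 ⟨k, hk, hωk, hωA⟩
        refine ⟨hω, ?_⟩
        obtain ⟨k', -, hωk', h', hl'⟩ := hρ n ω hω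
        have : k' = k := le_antisymm (not_lt.1 fun h => hl' _ h hωk) (not_lt.1 fun h => hl _ h hωk')
        rw [h', this]
    rw [this]
    exact P.biUnion_mem _ fun k _ => P.diff_mem (P.inter_mem (hDs k) hA)
      (P.biUnion_mem _ fun l _ => hDs l)
  · intro ω hω
    obtain ⟨k, -, hωk, h, -⟩ := hρ n ω hω
    rw [h]
    exact hv k ω hωk

end RingContent


/-- Continuity of the four-term combination at the origin. The pattern `a - b + c - d` is the one by
which patched step functions are compared; closedness allows passage to limits of pre-integrals. -/
theorem exists_closed_nhds_combination {Z : Type*} [AddCommGroup Z] [TopologicalSpace Z]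
    [IsTopologicalAddGroup Z] {T : Set Z} (hT : T ∈ 𝓝 (0 : Z)) :
    ∃ T₁ ∈ 𝓝 (0 : Z), IsClosed T₁ ∧ T₁ ⊆ T ∧
      ∀ a ∈ T₁, ∀ b ∈ T₁, ∀ c ∈ T₁, ∀ d ∈ T₁, a - b + c - d ∈ T := by
  have h : Tendsto (fun p : (Z × Z) × Z × Z => p.1.1 - p.1.2 + p.2.1 - p.2.2) (𝓝 ((0, 0), 0, 0))
      (𝓝 0) := by
    have : Continuous fun p : (Z × Z) × Z × Z => p.1.1 - p.1.2 + p.2.1 - p.2.2 := by fun_prop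
    simpa using this.tendsto ((0, 0), 0, 0)
  have h1 := h hT
  simp only [nhds_prod_eq] at h1
  rw [Filter.mem_map, (((𝓝 (0 : Z)).basis_sets.prod_self).prod_self).mem_iff] at h1
  obtain ⟨T₀, hT₀, h2⟩ := h1
  obtain ⟨T₁, ⟨hT₁, hc⟩, h3⟩ := (closed_nhds_basis (0 : Z)).mem_iff.1 (inter_mem hT₀ hT)
  refine ⟨T₁, hT₁, hc, fun x hx => (h3 hx).2, fun a ha b hb c hc d hd => ?_⟩
  exact h2 (show ((a, b), c, d) ∈ (T₀ ×ˢ T₀) ×ˢ T₀ ×ˢ T₀ from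
    ⟨⟨(h3 ha).1, (h3 hb).1⟩, (h3 hc).1, (h3 hd).1⟩)

theorem exists_closed_nhds_add {Z : Type*} [AddCommGroup Z] [TopologicalSpace Z]
    [IsTopologicalAddGroup Z] {T : Set Z} (hT : T ∈ 𝓝 (0 : Z)) :
    ∃ T₁ ∈ 𝓝 (0 : Z), IsClosed T₁ ∧ T₁ ⊆ T ∧ ∀ a ∈ T₁, ∀ b ∈ T₁, a + b ∈ T := by
  obtain ⟨T₁, h1, h2, h3, h4⟩ := exists_closed_nhds_combination hT
  refine ⟨T₁, h1, h2, h3, fun a ha b hb => ?_⟩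
  have h0 := mem_of_mem_nhds h1
  simpa using h4 a ha 0 h0 b hb 0 h0

/-! ### Values of locally constant sets, null functions and their countable sums. -/

namespace RingContent

variable {Ω X W V Z : Type*} [AddCommGroup W] [AddCommGroup V] [AddCommGroup Z]
  {P : RingContent Ω W} {j : X → Ω} {A B U : Set Ω} {L : V →+ W →+ Z}

/-- The elementary integrals of the step functions contained in `𝒜` over `U` and vanishing
outside. -/
def values (P : RingContent Ω W) (L : V →+ W →+ Z) (U : Set Ω) (𝒜 : Set (V × Ω)) : Set Z :=
  {z | ∃ s, P.IsStep s ∧ (∀ ω ∈ U, (s ω, ω) ∈ 𝒜) ∧ (∀ ω ∉ U, s ω = 0) ∧ z = P.integral L s}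

/-- `𝒜` is locally constant, contains a step function, and approximates `f` over `U`. -/
structure Covers (P : RingContent Ω W) (j : X → Ω) (U : Set Ω) (𝒜 : Set (V × Ω)) (f : X → V) :
    Prop where
  isOpenOver : P.IsOpenOver U 𝒜
  exists_step : ∃ r, P.IsStep r ∧ ∀ ω ∈ U, (r ω, ω) ∈ 𝒜
  approx : ∀ x, j x ∈ U → (f x, j x) ∈ 𝒜

/-- A selection is available only on `G`; the step function `r` completes it on the rest of `U`.
Along an exhaustion the second summand tends to zero. -/
theorem patch_mem_values {𝒜 : Set (V × Ω)} {G : Set Ω} (hU : U ∈ P.sets) (hG : G ∈ P.sets)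
    (hGU : G ⊆ U) {a r : Ω → V} (ha : P.IsStep (G.indicator a)) (ha' : ∀ ω ∈ G, (a ω, ω) ∈ 𝒜)
    (hr : P.IsStep r) (hr' : ∀ ω ∈ U, (r ω, ω) ∈ 𝒜) :
    P.integral L (G.indicator a) + P.integral L ((U \ G).indicator r) ∈ P.values L U 𝒜 := by
  have hr2 := hr.indicator (P.diff_mem hU hG)
  refine ⟨_, ha.add hr2, fun ω hω => ?_, fun ω hω => ?_, (integral_add ha hr2).symm⟩
  · by_cases h : ω ∈ G
    · simpa [h] using ha' ω h
    · simpa [h, hω] using hr' ω hω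
  · have h : ω ∉ G := fun h => hω (hGU h)
    simp [h, hω]

variable [TopologicalSpace W] [TopologicalSpace Z] [IsTopologicalAddGroup Z]

theorem IsContinuousAlong.tendsto_integral_diff (hP : P.IsContinuousAlong j)
    (hL : ∀ c, Continuous (L c)) (hA : A ∈ P.sets) {G : ℕ → Set Ω} (hG : Exhausts P j G A)
    {s : Ω → V} (hs : P.IsStep s) :
    Tendsto (fun n => P.integral L ((A \ G n).indicator s)) atTop (𝓝 0) := by
  have h := (tendsto_const_nhds (x := P.integral L (A.indicator s))).sub
    (hP.tendsto_integral hL hA hG hs)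
  rw [sub_self] at h
  refine h.congr fun n => ?_
  rw [← integral_indicator_add_diff hA (hG.mem n) (hG.subset n) hs, add_sub_cancel_left]

/-- A step function that is contained in `𝒜` as far as `j` sees it has its integral in the closure
of `values`. -/
theorem IsContinuousAlong.integral_mem_closure (hP : P.IsContinuousAlong j)
    (hL : ∀ c, Continuous (L c)) {𝒜 : Set (V × Ω)} (hU : U ∈ P.sets) (h𝒜 : P.IsOpenOver U 𝒜)
    {r : Ω → V} (hr : P.IsStep r) (hr' : ∀ ω ∈ U, (r ω, ω) ∈ 𝒜) {s : Ω → V} (hs : P.IsStep s)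
    (hs' : ∀ x, j x ∈ U → (s (j x), j x) ∈ 𝒜) (hsU : ∀ ω ∉ U, s ω = 0) :
    P.integral L s ∈ closure (P.values L U 𝒜) := by
  -- Intersecting with the graph of `s` forces the selection to be `s`, so `s` itself lies in `𝒜` on
  -- each `G n`, also at points not of the form `j x`.
  obtain ⟨G, ρ, hG, h⟩ := (h𝒜.inter (isOpenOver_graph hU hs)).exists_selection (j := j) hU
    fun x hx => ⟨s (j x), hs' x hx, rfl⟩
  have h1 := hP.tendsto_integral hL hU hG hs
  have h2 := h1.add (hP.tendsto_integral_diff hL hU hG hr)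
  have hUs : U.indicator s = s := indicator_eq_self.2 fun ω hω => by
    by_contra h
    exact hω (hsU ω h)
  rw [hUs, add_zero] at h2
  refine mem_closure_of_tendsto h2 (Eventually.of_forall fun n => ?_)
  refine patch_mem_values hU (hG.mem n) (hG.subset n) (hs.indicator (hG.mem n)) (fun ω hω => ?_)
    hr hr'
  have := (h n).2 ω hω
  exact this.2 ▸ this.1

/-- A step function of the sum splits locally: on an exhaustion select `ρ` in `𝒜` with `s - ρ` in
`ℬ`, then complete `ρ` by `r` and `s - ρ` by zero. The two values add up to the integral of `s` up
to tails, whence the closure. -/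
theorem IsContinuousAlong.values_pointwiseSum_subset (hP : P.IsContinuousAlong j)
    (hL : ∀ c, Continuous (L c)) {𝒜 ℬ : Set (V × Ω)} (hU : U ∈ P.sets) (h𝒜 : P.IsOpenOver U 𝒜)
    (hℬ : P.IsOpenOver U ℬ) {r : Ω → V} (hr : P.IsStep r) (hr' : ∀ ω ∈ U, (r ω, ω) ∈ 𝒜)
    (h0 : ∀ ω ∈ U, ((0 : V), ω) ∈ ℬ) :
    P.values L U (pointwiseSum 𝒜 ℬ) ⊆
      closure {z | ∃ a ∈ P.values L U 𝒜, ∃ b ∈ P.values L U ℬ, z = a + b} := by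
  rintro _ ⟨s, hs, hs', hsU, rfl⟩
  obtain ⟨G, ρ, hG, h⟩ := (h𝒜.inter (hℬ.comp_step hU hs fun v w => v - w)).exists_selection
    (j := j) hU fun x hx => by
      obtain ⟨v, w, hv, hw, hvw⟩ := hs' _ hx
      refine ⟨v, hv, ?_⟩
      have hvw' : v + w = s (j x) := hvw
      rw [mem_ofPred_eq, ← hvw', add_sub_cancel_left]
      exact hw
  have h1 := hP.tendsto_integral hL hU hG hs
  have h2 := h1.add (hP.tendsto_integral_diff hL hU hG hr)
  have hUs : U.indicator s = s := indicator_eq_self.2 fun ω hω => by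
    by_contra h
    exact hω (hsU ω h)
  rw [hUs, add_zero] at h2
  refine mem_closure_of_tendsto h2 (Eventually.of_forall fun n => ?_)
  have hρ := (h n).1.isStep
  have hsn := hs.indicator (hG.mem n)
  have hsub : (G n).indicator (s - ρ) = (G n).indicator s - (G n).indicator ρ := indicator_sub' _ _ _
  have hb := patch_mem_values (L := L) (𝒜 := ℬ) hU (hG.mem n) (hG.subset n) (a := s - ρ)
    (by rw [hsub]; exact hsn.sub hρ) (fun ω hω => ((h n).2 ω hω).2) isStep_zero h0
  refine ⟨_, patch_mem_values hU (hG.mem n) (hG.subset n) hρ (fun ω hω => ((h n).2 ω hω).1) hr hr',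
    _, hb, ?_⟩
  rw [hsub, integral_sub hsn hρ, indicator_zero', integral_zero]
  abel

/-- `h` has integral zero, and the witnesses can be chosen over arbitrarily large domains. -/
def IsNull (P : RingContent Ω W) (L : V →+ W →+ Z) (j : X → Ω) (h : X → V) : Prop :=
  ∀ T ∈ 𝓝 (0 : Z), ∀ U₀ ∈ P.sets, ∃ U ∈ P.sets, U₀ ⊆ U ∧ ∃ 𝒜, Covers P j U 𝒜 h ∧
    P.values L U 𝒜 ⊆ T

/-- If all restrictions of `h` have integral zero, then the witnesses can be chosen so as to contain
the zero function. -/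
theorem IsContinuousAlong.exists_covers_zero (hP : P.IsContinuousAlong j)
    (hL : ∀ c, Continuous (L c)) {h : X → V}
    (hh : ∀ A ∈ P.sets, P.IsNull L j ((j ⁻¹' A).indicator h)) (hU : U ∈ P.sets) {T : Set Z}
    (hT : T ∈ 𝓝 (0 : Z)) :
    ∃ 𝒜, Covers P j U 𝒜 h ∧ (∀ ω ∈ U, ((0 : V), ω) ∈ 𝒜) ∧ P.values L U 𝒜 ⊆ T := by
  obtain ⟨T', hT', hcl, hTT, -⟩ := exists_closed_nhds_combination hT
  obtain ⟨T₁, hT₁, -, -, hcomb⟩ := exists_closed_nhds_combination hT'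
  obtain ⟨U₁, hU₁, hUU₁, 𝒜, h𝒜, hv⟩ := hh U hU T₁ hT₁ U hU
  obtain ⟨r, hr, hr'⟩ := h𝒜.exists_step
  have h0 : P.IsOpenOver U ({0} ×ˢ univ : Set (V × Ω)) := isOpenOver_snd_preimage hU _
  have hzero : ∀ ω ∈ U, ((0 : V), ω) ∈ 𝒜 ∪ {0} ×ˢ univ := fun ω _ => .inr ⟨rfl, mem_univ _⟩
  refine ⟨𝒜 ∪ {0} ×ˢ univ, ⟨(h𝒜.isOpenOver.mono hUU₁).union h0, ⟨0, isStep_zero, hzero⟩,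
    fun x hx => .inl ?_⟩, hzero, ?_⟩
  · have := h𝒜.approx x (hUU₁ hx)
    rwa [indicator_of_mem (show x ∈ j ⁻¹' U from hx)] at this
  rintro _ ⟨s, hs, hs', hsU, rfl⟩
  refine hTT ?_
  -- With zero adjoined, `s` may switch between `𝒜` and zero along an arbitrary ring set `Q`. This
  -- is why nullity of the restrictions of `h` is needed, and not only of `h`.
  set Q := U ∩ s ⁻¹' {0}ᶜ with hQ
  have hQm : Q ∈ P.sets := hs.inter_preimage_mem hU _
  have hQs : Q.indicator s = s := indicator_eq_self.2 fun ω hω => by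
    refine ⟨?_, hω⟩
    by_contra h
    exact hω (hsU ω h)
  have hQU : Q ⊆ U := inter_subset_left
  have hsQ : ∀ ω ∈ Q, (s ω, ω) ∈ 𝒜 := fun ω hω => by
    rcases hs' ω (hQU hω) with h | h
    · exact h
    · exact absurd h.1 hω.2
  -- compare with an envelope of the restriction of `h` to `Q`
  obtain ⟨U₂, hU₂, hQU₂, ℬ, hℬ, hvℬ⟩ := hh Q hQm T₁ hT₁ Q hQm
  obtain ⟨r₂, hr₂, hr₂'⟩ := hℬ.exists_step
  obtain ⟨G, ρ, hG, hρ⟩ := ((h𝒜.isOpenOver.mono (hQU.trans hUU₁)).inter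
    (hℬ.isOpenOver.mono hQU₂)).exists_selection (j := j) hQm fun x hx => by
      refine ⟨h x, ?_, ?_⟩
      · have := h𝒜.approx x (hUU₁ (hQU hx))
        rwa [indicator_of_mem (show x ∈ j ⁻¹' U from hQU hx)] at this
      · have := hℬ.approx x (hQU₂ hx)
        rwa [indicator_of_mem (show x ∈ j ⁻¹' Q from hx)] at this
  have hC : U₂ \ Q ∈ P.sets := P.diff_mem hU₂ hQm
  -- Off `Q` the restricted function is zero, so zero is an admissible value for `ℬ` there; this
  -- extends the selection on `Q` to an exhaustion of `U₂`.
  obtain ⟨G', ρ', hG', hρ'⟩ := ((hℬ.isOpenOver.mono (sdiff_subset (t := Q))).inter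
    (isOpenOver_graph hC isStep_zero)).exists_selection (j := j) hC fun x hx => by
      refine ⟨0, ?_, rfl⟩
      have := hℬ.approx x hx.1
      rwa [indicator_of_notMem (show x ∉ j ⁻¹' Q from hx.2)] at this
  have hGG := hG.union hG'
  rw [union_sdiff_cancel hQU₂] at hGG
  have hlim := hP.tendsto_integral hL hQm hG hs
  rw [hQs] at hlim
  refine hcl.mem_of_tendsto hlim ?_
  filter_upwards [(hP.tendsto_integral_diff hL hU₂ hGG hr₂) hT₁] with n hn
  have hGU₁ : G n ⊆ U₁ := ((hG.subset n).trans hQU).trans hUU₁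
  have ha := hv (patch_mem_values (L := L) hU₁ (hG.mem n) hGU₁ (hs.indicator (hG.mem n))
    (fun ω hω => hsQ ω (hG.subset n hω)) hr hr')
  have hb := hv (patch_mem_values (L := L) hU₁ (hG.mem n) hGU₁ (hρ n).1.isStep
    (fun ω hω => ((hρ n).2 ω hω).1) hr hr')
  have hind : (G n ∪ G' n).indicator ((G n).indicator ρ) = (G n).indicator ρ := by
    rw [indicator_indicator, inter_eq_right.2 subset_union_left]
  have hc := hvℬ (patch_mem_values (L := L) (a := (G n).indicator ρ) hU₂ (hGG.mem n) (hGG.subset n)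
    (by rw [hind]; exact (hρ n).1.isStep) (fun ω hω => by
      by_cases hωG : ω ∈ G n
      · rw [indicator_of_mem hωG]
        exact ((hρ n).2 ω hωG).2
      · rw [indicator_of_notMem hωG]
        have := (hρ' n).2 ω (hω.resolve_left hωG)
        have h2 : ρ' ω = 0 := this.2
        rw [← h2]
        exact this.1) hr₂ hr₂')
  rw [hind] at hc
  -- The tails with `r` cancel between the first two terms, those with `r₂` between the last two,
  -- and the integrals of `ρ` between the middle two. The integral of `s` over `G n` remains.
  have := hcomb _ ha _ hb _ hc _ hn
  convert this using 1
  abel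

/-- Select the index locally constantly. On each member of the exhaustion only finitely many indices
occur, so by monotonicity `s` lies there in a single `ℬ M`; zero fills the rest. -/
theorem IsContinuousAlong.values_iUnion_subset (hP : P.IsContinuousAlong j)
    (hL : ∀ c, Continuous (L c)) {ℬ : ℕ → Set (V × Ω)} (hU : U ∈ P.sets)
    (hℬ : ∀ n, P.IsOpenOver U (ℬ n)) (h0 : ∀ n, ∀ ω ∈ U, ((0 : V), ω) ∈ ℬ n)
    (hmono : ∀ m n, m ≤ n → ∀ v, ∀ ω ∈ U, (v, ω) ∈ ℬ m → (v, ω) ∈ ℬ n) :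
    P.values L U (⋃ n, ℬ n) ⊆ closure (⋃ n, P.values L U (ℬ n)) := by
  rintro _ ⟨s, hs, hs', hsU, rfl⟩
  have hopen : P.IsOpenOver U {p : ℕ × Ω | (s p.2, p.2) ∈ ℬ p.1} := by
    have : P.IsOpenOver U (⋃ n, ({n} ×ˢ univ : Set (ℕ × Ω)) ∩
        {p : ℕ × Ω | (s p.2, p.2) ∈ ℬ n}) :=
      .iUnion fun n => (isOpenOver_snd_preimage hU _).inter ((hℬ n).comp_step hU hs fun v _ => v)
    refine cast (congrArg _ ?_) this
    ext ⟨m, ω⟩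
    simp
  obtain ⟨G, ρ, hG, h⟩ := hopen.exists_selection (j := j) hU fun x hx => by
    obtain ⟨n, hn⟩ := mem_iUnion.1 (hs' _ hx)
    exact ⟨n, hn⟩
  have h1 := hP.tendsto_integral hL hU hG hs
  have hUs : U.indicator s = s := indicator_eq_self.2 fun ω hω => by
    by_contra h
    exact hω (hsU ω h)
  rw [hUs] at h1
  refine mem_closure_of_tendsto h1 (Eventually.of_forall fun n => mem_iUnion.2 ?_)
  obtain ⟨M, hM⟩ := (h n).1.1.bddAbove
  refine ⟨M, ?_⟩
  have := patch_mem_values (L := L) (𝒜 := ℬ M) hU (hG.mem n) (hG.subset n)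
    (hs.indicator (hG.mem n)) (fun ω hω => hmono _ _ (hM ⟨ω, hω, rfl⟩) _ _ (hG.subset n hω)
      ((h n).2 ω hω)) isStep_zero (h0 M)
  simpa [integral_zero] using this

/-- Countable sums of null functions with disjoint supports. -/
theorem IsContinuousAlong.exists_covers_sum (hP : P.IsContinuousAlong j)
    (hL : ∀ c, Continuous (L c)) {h : ℕ → X → V} {g : X → V}
    (hh : ∀ n, ∀ A ∈ P.sets, P.IsNull L j ((j ⁻¹' A).indicator (h n)))
    (hg : ∀ x, g x = 0 ∨ ∃ n, g x = h n x) (hU : U ∈ P.sets) {T : Set Z} (hT : T ∈ 𝓝 (0 : Z)) :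
    ∃ 𝒜, Covers P j U 𝒜 g ∧ (∀ ω ∈ U, ((0 : V), ω) ∈ 𝒜) ∧ P.values L U 𝒜 ⊆ T := by
  obtain ⟨T₀, hT₀, hcl₀, hTT₀, -⟩ := exists_closed_nhds_add hT
  have hstep : ∀ S : {S : Set Z // S ∈ 𝓝 (0 : Z) ∧ IsClosed S},
      ∃ S' : {S : Set Z // S ∈ 𝓝 (0 : Z) ∧ IsClosed S},
        ∀ a ∈ S'.1, ∀ b ∈ S'.1, a + b ∈ S.1 := fun S => by
    obtain ⟨S', h1, h2, -, h4⟩ := exists_closed_nhds_add S.2.1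
    exact ⟨⟨S', h1, h2⟩, h4⟩
  choose next hnext using hstep
  -- Neighbourhoods with `S (n + 1) + S (n + 1) ⊆ S n`; the values of the `n`-th null envelope are
  -- confined to `S (n + 1)`.
  let S : ℕ → {S : Set Z // S ∈ 𝓝 (0 : Z) ∧ IsClosed S} :=
    fun n => Nat.rec ⟨T₀, hT₀, hcl₀⟩ (fun _ => next) n
  have hS : ∀ n, ∀ a ∈ (S (n + 1)).1, ∀ b ∈ (S (n + 1)).1, a + b ∈ (S n).1 :=
    fun n => hnext (S n)
  choose 𝒜 h𝒜 h𝒜0 h𝒜v using fun n => hP.exists_covers_zero hL (hh n) hU (S (n + 1)).2.1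
  let ℬ : ℕ → Set (V × Ω) := fun n => Nat.rec ({0} ×ˢ univ) (fun n ℬ => pointwiseSum ℬ (𝒜 n)) n
  have hℬs : ∀ n, ℬ (n + 1) = pointwiseSum (ℬ n) (𝒜 n) := fun n => rfl
  have hℬ0 : ∀ n, ∀ ω ∈ U, ((0 : V), ω) ∈ ℬ n := by
    intro n
    induction n with
    | zero => exact fun ω _ => ⟨rfl, mem_univ _⟩
    | succ n ih => exact fun ω hω => ⟨0, 0, ih ω hω, h𝒜0 n ω hω, add_zero 0⟩
  have hℬo : ∀ n, P.IsOpenOver U (ℬ n) := by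
    intro n
    induction n with
    | zero => exact isOpenOver_snd_preimage hU _
    | succ n ih => exact ih.pointwiseSum (h𝒜 n).isOpenOver
  have hmono : ∀ m n, m ≤ n → ∀ v, ∀ ω ∈ U, (v, ω) ∈ ℬ m → (v, ω) ∈ ℬ n := by
    intro m n hmn v ω hω hv
    induction n, hmn using Nat.le_induction with
    | base => exact hv
    | succ n _ ih => exact ⟨v, 0, ih, h𝒜0 n ω hω, add_zero v⟩
  -- The invariant: after `n` summands there is still room in `T₀` for any element of `S n`.
  have hvals : ∀ n, ∀ b ∈ P.values L U (ℬ n), ∀ t ∈ (S n).1, b + t ∈ T₀ := by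
    intro n
    induction n with
    | zero =>
      rintro _ ⟨s, hs, hs', hsU, rfl⟩ t ht
      have : s = 0 := by
        funext ω
        by_cases hω : ω ∈ U
        · exact (hs' ω hω).1
        · exact hsU ω hω
      rw [this, integral_zero, zero_add]
      exact ht
    | succ n ih =>
      intro b hb t ht
      have h1 := hP.values_pointwiseSum_subset hL hU (hℬo n) (h𝒜 n).isOpenOver isStep_zero
        (hℬ0 n) (h𝒜0 n) hb
      have hcl : IsClosed {z : Z | z + t ∈ T₀} := hcl₀.preimage (continuous_add_const t)
      refine closure_minimal ?_ hcl h1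
      rintro _ ⟨a, ha, c, hc, rfl⟩
      rw [mem_ofPred_eq, add_assoc]
      exact ih a ha _ (hS n _ (h𝒜v n hc) _ ht)
  refine ⟨⋃ n, ℬ n, ⟨.iUnion hℬo, ⟨0, isStep_zero, fun ω hω => mem_iUnion.2 ⟨0, hℬ0 0 ω hω⟩⟩, ?_⟩,
    fun ω hω => mem_iUnion.2 ⟨0, hℬ0 0 ω hω⟩, ?_⟩
  · intro x hx
    rcases hg x with hx0 | ⟨n, hn⟩
    · rw [hx0]
      exact mem_iUnion.2 ⟨0, hℬ0 0 _ hx⟩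
    · rw [hn]
      exact mem_iUnion.2 ⟨n + 1, 0, h n x, hℬ0 n _ hx, (h𝒜 n).approx x hx, zero_add _⟩
  · refine (hP.values_iUnion_subset hL hU hℬo hℬ0 hmono).trans ?_
    refine (closure_minimal (iUnion_subset fun n b hb => ?_) hcl₀).trans hTT₀
    simpa using hvals n b hb 0 (mem_of_mem_nhds (S n).2.1)

end RingContent


namespace RingContent

/-! ### Envelopes over a set system represented by a ring content -/

variable {Ω X W V Z : Type*} [AddCommGroup W] [AddCommGroup V] [AddCommGroup Z]

/-- The set system `𝔖` with the set function `μ` consists of preimages under `j` of members of the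
ring, and no information is lost. -/
structure Represents [TopologicalSpace W] (P : RingContent Ω W) (j : X → Ω) {𝔖 : Set (Set X)}
    (μ : 𝔖 → W) : Prop where
  exists_mem : ∀ E : 𝔖, ∃ D ∈ P.sets, j ⁻¹' D = E ∧ P.val D = μ E
  decomposes : ∀ D ∈ P.sets, FinitelyDecomposes 𝔖 (j ⁻¹' D)
  eq_empty : ∀ D ∈ P.sets, j ⁻¹' D = ∅ → D = ∅
  isContinuousAlong : P.IsContinuousAlong j

theorem exists_stepFun_of_fintype {𝔖 : Set (Set X)} {κ : Type*} [Fintype κ] (c : κ → V)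
    (E : κ → 𝔖) : ∃ (n : ℕ) (c' : Fin n → V) (E' : Fin n → 𝔖),
      ∀ x, stepFun c' E' x = ∑ k, (E k : Set X).indicator (fun _ => c k) x := by
  let e := (Fintype.equivFin κ).symm
  exact ⟨_, c ∘ e, E ∘ e, fun x => e.sum_comp fun k => (E k : Set X).indicator (fun _ => c k) x⟩

variable [TopologicalSpace W] {P : RingContent Ω W} {j : X → Ω} {A B U : Set Ω} {L : V →+ W →+ Z}
  {𝔖 : Set (Set X)} {μ : 𝔖 → W}

theorem Represents.preimage_mem (h : P.Represents j μ) (hA : A ∈ P.sets) :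
    j ⁻¹' A ∈ finiteUnions 𝔖 := by
  obtain ⟨𝔈, h1, h2, -, h4⟩ := h.decomposes A hA
  exact ⟨𝔈, h1, h2, h4⟩

theorem Represents.exists_preimage (h : P.Represents j μ) {C : Set X} (hC : C ∈ finiteUnions 𝔖) :
    ∃ D ∈ P.sets, j ⁻¹' D = C := by
  obtain ⟨𝔈, h1, h2, rfl⟩ := hC
  choose! D hD hjD using fun E (hE : E ∈ 𝔖) => h.exists_mem ⟨E, hE⟩
  refine ⟨_, P.sUnion_mem (h2.image D) (image_subset_iff.2 fun E hE => hD E (h1 hE)), ?_⟩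
  rw [sUnion_image, preimage_iUnion₂, sUnion_eq_biUnion]
  exact iUnion₂_congr fun E hE => (hjD E (h1 hE)).1

theorem Represents.subset_of_preimage_subset (h : P.Represents j μ) (hA : A ∈ P.sets)
    (hB : B ∈ P.sets) (hAB : j ⁻¹' A ⊆ j ⁻¹' B) : A ⊆ B := by
  rw [← sdiff_eq_empty]
  refine h.eq_empty _ (P.diff_mem hA hB) ?_
  rw [preimage_sdiff, sdiff_eq_empty]
  exact hAB

theorem Represents.step_eq_zero (h : P.Represents j μ) {s : Ω → V} (hs : P.IsStep s)
    (hU : U ∈ P.sets) (h0 : ∀ x, j x ∈ U → s (j x) = 0) : ∀ ω ∈ U, s ω = 0 := by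
  have h1 := h.eq_empty _ (hs.inter_preimage_mem hU {0}ᶜ) (by
    rw [eq_empty_iff_forall_notMem]
    exact fun x hx => hx.2 (h0 x hx.1))
  intro ω hω
  by_contra hne
  exact h1.subset ⟨hω, hne⟩

/-- The points `j x` meet every nonempty ring set, in particular the support of a difference of step
functions. Thus pre-integrals over `𝔖` depend only on the step function over the ring. -/
theorem Represents.step_ext (h : P.Represents j μ) {s t : Ω → V} (hs : P.IsStep s)
    (ht : P.IsStep t) (hst : ∀ x, s (j x) = t (j x)) : s = t := by
  have hd := hs.sub ht
  obtain ⟨U, hU, h0⟩ := hd.exists_support_subset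
  have h1 := h.step_eq_zero hd hU fun x _ => by simp [hst x]
  funext ω
  rw [← sub_eq_zero, ← Pi.sub_apply]
  by_cases hω : ω ∈ U
  · exact h1 ω hω
  · exact h0 ω hω

theorem Represents.exists_step (h : P.Represents j μ) (L : V →+ W →+ Z) {n : ℕ} (c : Fin n → V)
    (E : Fin n → 𝔖) : ∃ s, P.IsStep s ∧ (∀ x, s (j x) = stepFun c E x) ∧
      P.integral L s = ∑ k, L (c k) (μ (E k)) := by
  choose D hD hjD hv using h.exists_mem
  have hr : P.Rep L (fun ω => ∑ k, (D (E k)).indicator (fun _ => c k) ω)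
      (∑ k, L (c k) (P.val (D (E k)))) :=
    ⟨Fin n, inferInstance, c, fun k => D (E k), fun k => hD _, rfl, rfl⟩
  refine ⟨_, hr.isStep, fun x => ?_, ?_⟩
  · refine Finset.sum_congr rfl fun k _ => ?_
    rw [← hjD (E k)]
    rfl
  · rw [hr.integral_eq]
    simp only [hv]

theorem Represents.exists_stepFun (h : P.Represents j μ) {s : Ω → V} (hs : P.IsStep s) :
    ∃ (n : ℕ) (c : Fin n → V) (E : Fin n → 𝔖), ∀ x, stepFun c E x = s (j x) := by
  classical
  obtain ⟨κ, _, c, D, hD, rfl⟩ := hs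
  choose 𝔈 h1 h2 h3 h4 using fun k => h.decomposes (D k) (hD k)
  have : ∀ k, Fintype (𝔈 k) := fun k => (h2 k).fintype
  obtain ⟨n, c', E', hE'⟩ := exists_stepFun_of_fintype (κ := Σ k, 𝔈 k) (fun p => c p.1)
    (fun p => ⟨p.2, h1 _ p.2.2⟩ : (Σ k, 𝔈 k) → 𝔖)
  refine ⟨n, c', E', fun x => ?_⟩
  rw [hE', Fintype.sum_sigma]
  refine Finset.sum_congr rfl fun k _ => ?_
  by_cases hx : j x ∈ D k
  · rw [indicator_of_mem hx]
    have hx' : x ∈ ⋃₀ 𝔈 k := (h4 k).symm ▸ hx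
    obtain ⟨E, hE, hxE⟩ := hx'
    rw [Finset.sum_eq_single ⟨E, hE⟩]
    · exact indicator_of_mem hxE _
    · rintro ⟨F, hF⟩ - hne
      refine indicator_of_notMem (fun hxF => ?_) _
      exact (h3 k hF hE (fun h => hne (Subtype.ext h))).le_bot ⟨hxF, hxE⟩
    · simp
  · rw [indicator_of_notMem hx]
    refine Finset.sum_eq_zero fun F _ => indicator_of_notMem (fun hxF => hx ?_) _
    exact (h4 k).subset ⟨F, F.2, hxF⟩

variable [TopologicalSpace Z]

/-- A value that an envelope contains over a whole member of `𝔖` is kept over the corresponding ring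
set. Every sufficiently large `U` is allowed so that different envelopes can be compared over one
domain. -/
theorem Represents.exists_covers (h : P.Represents j μ) {𝒜 : Set (V × X)} (h𝒜 : IsEnvelope 𝔖 𝒜)
    {f : X → V} (hf : Approximates 𝒜 f) (hB : B ∈ P.sets) (hfB : ∀ x, j x ∉ B → f x = 0) :
    ∃ U₀ ∈ P.sets, B ⊆ U₀ ∧ ∀ U ∈ P.sets, U₀ ⊆ U → ∃ 𝒜', Covers P j U 𝒜' f ∧
      P.values L U 𝒜' ⊆ bilinearSum L μ 𝒜 := by
  obtain ⟨⟨n, c, E, hr'⟩, 𝔇, h𝔇, h𝔇c, hgen⟩ := h𝒜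
  obtain ⟨r, hr, hrj, -⟩ := h.exists_step L c E
  obtain ⟨U₁, hU₁, hrU₁⟩ := hr.exists_support_subset
  refine ⟨B ∪ U₁, P.union_mem hB hU₁, subset_union_left, fun U hU hUU => ?_⟩
  choose! D hD hjD using fun E (hE : E ∈ 𝔖) => h.exists_mem ⟨E, hE⟩
  obtain ⟨𝔉, h𝔉, h𝔉f, h𝔉r⟩ := hr.exists_finite_cover hU
  let 𝒜' : Set (V × Ω) := {p | ∃ F ∈ D '' 𝔇 ∪ 𝔉, p.2 ∈ F ∧ ∀ x, j x ∈ F → (p.1, x) ∈ 𝒜}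
  have hcov : ∀ ω ∈ U, (r ω, ω) ∈ 𝒜' := fun ω hω => by
    obtain ⟨F, hF, hωF, hc⟩ := h𝔉r ω hω
    refine ⟨F, .inr hF, hωF, fun x hx => ?_⟩
    rw [← hc _ hx, hrj]
    exact hr' x
  refine ⟨𝒜', ⟨⟨D '' 𝔇 ∪ 𝔉, ?_, (h𝔇c.image D).union h𝔉f.countable, ?_⟩, ⟨r, hr, hcov⟩, ?_⟩, ?_⟩
  · exact union_subset (image_subset_iff.2 fun F hF => hD F (h𝔇 hF)) h𝔉
  · rintro v ω - ⟨F, hF, hωF, hv⟩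
    exact ⟨F, hF, hωF, fun ω' hω' => ⟨F, hF, hω', hv⟩⟩
  · intro x hx
    have h1 := hf x
    rw [hgen] at h1
    rcases h1 with h1 | h1
    · simp only [mem_iUnion] at h1
      obtain ⟨F, hF, hv, hxF⟩ := h1
      have hjF := (hjD F (h𝔇 hF)).1
      exact ⟨D F, .inl ⟨F, hF, rfl⟩, hjF.symm.subset hxF, fun x' hx' => hv x' (hjF.subset hx')⟩
    -- Off `⋃₀ 𝔇` the envelope contains only zero, so `f` and `r` both vanish there, and the sets of
    -- constancy of `r` serve as witnesses.
    · have h2 := hr' x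
      rw [hgen] at h2
      have h3 : r (j x) = 0 := by
        rw [hrj]
        rcases h2 with h2 | h2
        · simp only [mem_iUnion] at h2
          obtain ⟨F, hF, -, hxF⟩ := h2
          exact absurd ⟨F, hF, hxF⟩ h1.2
        · exact h2.1
      have h4 : f x = 0 := h1.1
      rw [h4, ← h3]
      exact hcov _ hx
  · rintro _ ⟨s, hs, hs', hsU, rfl⟩
    obtain ⟨m, d, F, hF⟩ := h.exists_stepFun hs
    obtain ⟨s', hs₁, hs₂, hs₃⟩ := h.exists_step L d F
    have : s' = s := h.step_ext hs₁ hs fun x => by rw [hs₂, hF]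
    rw [← this, hs₃]
    refine subset_closure ⟨m, d, F, fun x => ?_, rfl⟩
    rw [hF]
    by_cases hx : j x ∈ U
    · obtain ⟨F, -, hxF, hv⟩ := hs' _ hx
      exact hv x hxF
    · rw [hsU _ hx, ← hfB x fun hxB => hx (hUU (.inl hxB))]
      exact hf x

theorem Represents.isNull (h : P.Represents j μ) {f : X → V} (hf : HasIntegral L μ f 0)
    (hB : B ∈ P.sets) (hfB : ∀ x, j x ∉ B → f x = 0) : P.IsNull L j f := by
  intro T hT U₀ hU₀
  obtain ⟨𝒜, h1, h2, h3⟩ := hf T hT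
  obtain ⟨U₁, hU₁, -, hU⟩ := h.exists_covers (L := L) h1 h2 hB hfB
  obtain ⟨𝒜', h𝒜', hv⟩ := hU _ (P.union_mem hU₀ hU₁) subset_union_right
  exact ⟨_, P.union_mem hU₀ hU₁, subset_union_left, 𝒜', h𝒜', fun z hz => by
    simpa using h3 z (hv hz)⟩

variable [IsTopologicalAddGroup Z]

/-- The pulled-back envelope controls a step function only at the points `j x`. By
`integral_mem_closure` its integral is still a limit of values of `𝒜`, hence the closure. -/
theorem Represents.exists_envelope (h : P.Represents j μ) (hL : ∀ c, Continuous (L c))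
    (hU : U ∈ P.sets) {𝒜 : Set (V × Ω)} {f : X → V} (h𝒜 : Covers P j U 𝒜 f)
    (hfU : ∀ x, j x ∉ U → f x = 0) :
    ∃ 𝒜' : Set (V × X), IsEnvelope 𝔖 𝒜' ∧ Approximates 𝒜' f ∧
      bilinearSum L μ 𝒜' ⊆ closure (P.values L U 𝒜) := by
  obtain ⟨𝔇, h𝔇, h𝔇c, hloc⟩ := h𝒜.isOpenOver
  obtain ⟨r, hr, hr'⟩ := h𝒜.exists_step
  choose! 𝔈 h1 h2 h3 h4 using fun D (hD : D ∈ 𝔇) => h.decomposes (D ∩ U) (P.inter_mem (h𝔇 hD) hU)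
  let 𝒜' : Set (V × X) := {p | (j p.2 ∈ U ∧ (p.1, j p.2) ∈ 𝒜) ∨ (j p.2 ∉ U ∧ p.1 = 0)}
  have hsub : ∀ E ∈ ⋃ D ∈ 𝔇, 𝔈 D, ∀ x ∈ E, j x ∈ U := by
    intro E hE x hx
    simp only [mem_iUnion] at hE
    obtain ⟨D, hD, hE⟩ := hE
    have : x ∈ j ⁻¹' (D ∩ U) := (h4 D hD).subset ⟨E, hE, hx⟩
    exact this.2
  have hcov : ∀ v x, j x ∈ U → (v, j x) ∈ 𝒜 → ∃ E ∈ ⋃ D ∈ 𝔇, 𝔈 D, x ∈ E ∧ v ∈ fibre 𝒜' E := by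
    intro v x hx hv
    obtain ⟨D, hD, hxD, hc⟩ := hloc v _ hx hv
    have hx' : x ∈ ⋃₀ 𝔈 D := (h4 D hD).symm.subset ⟨hxD, hx⟩
    obtain ⟨E, hE, hxE⟩ := hx'
    refine ⟨E, mem_biUnion hD hE, hxE, fun x' hx' => ?_⟩
    have : x' ∈ j ⁻¹' (D ∩ U) := (h4 D hD).subset ⟨E, hE, hx'⟩
    exact .inl ⟨this.2, hc _ this.1⟩
  refine ⟨𝒜', ⟨?_, ⋃ D ∈ 𝔇, 𝔈 D, iUnion₂_subset h1,
    h𝔇c.biUnion fun D hD => (h2 D hD).countable, ?_⟩, ?_, ?_⟩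
  · obtain ⟨n, c, E, hE⟩ := h.exists_stepFun (hr.indicator hU)
    refine ⟨n, c, E, fun x => ?_⟩
    rw [hE]
    by_cases hx : j x ∈ U
    · rw [indicator_of_mem hx]
      exact .inl ⟨hx, hr' _ hx⟩
    · rw [indicator_of_notMem hx]
      exact .inr ⟨hx, rfl⟩
  · ext ⟨v, x⟩
    constructor
    · rintro (⟨hx, hv⟩ | ⟨hx, hv⟩)
      · obtain ⟨E, hE, hxE, hc⟩ := hcov v x hx hv
        exact .inl (mem_biUnion hE ⟨hc, hxE⟩)
      · exact .inr ⟨hv, fun ⟨E, hE, hxE⟩ => hx (hsub E hE x hxE)⟩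
    · rintro (hv | ⟨hv, hx⟩)
      · simp only [mem_iUnion] at hv
        obtain ⟨E, -, hv, hx⟩ := hv
        exact hv x hx
      · refine .inr ⟨fun hxU => hx ?_, hv⟩
        obtain ⟨E, hE, hxE, -⟩ := hcov _ x hxU (hr' _ hxU)
        exact ⟨E, hE, hxE⟩
  · intro x
    by_cases hx : j x ∈ U
    · exact .inl ⟨hx, h𝒜.approx x hx⟩
    · exact .inr ⟨hx, hfU x hx⟩
  · refine closure_minimal ?_ isClosed_closure
    rintro _ ⟨n, c, E, hE, rfl⟩
    obtain ⟨s, hs, hs₁, hs₂⟩ := h.exists_step L c E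
    rw [← hs₂]
    have hs0 : ∀ x, j x ∉ U → s (j x) = 0 := fun x hx => by
      rw [hs₁]
      rcases hE x with h' | h'
      · exact absurd h'.1 hx
      · exact h'.2
    refine h.isContinuousAlong.integral_mem_closure hL hU h𝒜.isOpenOver hr hr' hs (fun x hx => ?_) ?_
    · rw [hs₁]
      rcases hE x with h' | h'
      · exact h'.2
      · exact absurd hx h'.1
    · obtain ⟨U', hU', hsU'⟩ := hs.exists_support_subset
      intro ω hω
      by_cases hω' : ω ∈ U'
      · exact h.step_eq_zero hs (P.diff_mem hU' hU) (fun x hx => hs0 x hx.2) ω ⟨hω', hω⟩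
      · exact hsU' ω hω'

/-- The extended integral is unique. -/
theorem Represents.extendedIntegral_unique [T2Space Z] (h : P.Represents j μ)
    (hL : ∀ c, Continuous (L c)) {f : X → V} {a b : Z} (ha : HasExtendedIntegral L μ f a)
    (hb : HasExtendedIntegral L μ f b) : a = b := by
  rw [← sub_eq_zero]
  by_contra hne
  obtain ⟨T, hT, hT'⟩ : ∃ T ∈ 𝓝 (0 : Z), a - b ∉ T :=
    ⟨{a - b}ᶜ, isOpen_compl_singleton.mem_nhds (Ne.symm hne), by simp⟩
  apply hT'
  obtain ⟨T₁, hT₁, -, -, hcomb⟩ := exists_closed_nhds_combination hT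
  obtain ⟨A₁, hA₁, h₁⟩ := ha T₁ hT₁
  obtain ⟨A₂, hA₂, h₂⟩ := hb T₁ hT₁
  obtain ⟨D₁, hD₁, rfl⟩ := h.exists_preimage hA₁
  obtain ⟨D₂, hD₂, rfl⟩ := h.exists_preimage hA₂
  have hB := P.union_mem hD₁ hD₂
  obtain ⟨𝒜, h𝒜, hf𝒜, hv𝒜⟩ := h₁ _ (h.preimage_mem hB) (preimage_mono subset_union_left)
  obtain ⟨ℬ, hℬ, hfℬ, hvℬ⟩ := h₂ _ (h.preimage_mem hB) (preimage_mono subset_union_right)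
  have hsupp : ∀ x, j x ∉ D₁ ∪ D₂ → (j ⁻¹' (D₁ ∪ D₂)).indicator f x = 0 :=
    fun x hx => indicator_of_notMem (show x ∉ j ⁻¹' (D₁ ∪ D₂) from hx) _
  obtain ⟨U₁, hU₁, -, hc₁⟩ := h.exists_covers (L := L) h𝒜 hf𝒜 hB hsupp
  obtain ⟨U₂, hU₂, -, hc₂⟩ := h.exists_covers (L := L) hℬ hfℬ hB hsupp
  have hU := P.union_mem hU₁ hU₂
  obtain ⟨𝒜', hc𝒜, hw𝒜⟩ := hc₁ _ hU subset_union_left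
  obtain ⟨ℬ', hcℬ, hwℬ⟩ := hc₂ _ hU subset_union_right
  obtain ⟨r₁, hr₁, hr₁'⟩ := hc𝒜.exists_step
  obtain ⟨r₂, hr₂, hr₂'⟩ := hcℬ.exists_step
  -- Both envelopes approximate the same function, so one selection serves both; the patched step
  -- functions then differ only in the tails of `r₁` and `r₂`.
  obtain ⟨G, ρ, hG, hρ⟩ := (hc𝒜.isOpenOver.inter hcℬ.isOpenOver).exists_selection (j := j) hU
    fun x hx => ⟨_, hc𝒜.approx x hx, hcℬ.approx x hx⟩
  have hP := h.isContinuousAlong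
  obtain ⟨n, hn₁, hn₂⟩ := (((hP.tendsto_integral_diff hL hU hG hr₁).eventually_mem hT₁).and
    ((hP.tendsto_integral_diff hL hU hG hr₂).eventually_mem hT₁)).exists
  have e₁ := hv𝒜 _ (hw𝒜 (patch_mem_values (L := L) hU (hG.mem n) (hG.subset n) (hρ n).1.isStep
    (fun ω hω => ((hρ n).2 ω hω).1) hr₁ hr₁'))
  have e₂ := hvℬ _ (hwℬ (patch_mem_values (L := L) hU (hG.mem n) (hG.subset n) (hρ n).1.isStep
    (fun ω hω => ((hρ n).2 ω hω).2) hr₂ hr₂'))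
  have := hcomb _ e₂ _ e₁ _ hn₁ _ hn₂
  convert this using 1
  abel

/-- Transfer of the extended integral between two systems represented by the same content. -/
theorem Represents.transfer {Y : Type*} {j' : Y → Ω} {𝔗 : Set (Set Y)} {ν : 𝔗 → W}
    (h : P.Represents j μ) (h' : P.Represents j' ν) (hL : ∀ c, Continuous (L c)) {f : X → V}
    {g : Y → V}
    (hfg : ∀ 𝔇 ⊆ P.sets, 𝔇.Countable → ∀ B ∈ P.sets, ∀ U ∈ P.sets, B ⊆ U → ∃ N : ℕ → Set Y,
      (∀ n, IsWeaklyNegligible L ν (N n)) ∧ ∀ y, j' y ∈ U → (∀ n, y ∉ N n) →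
        ∃ x, j x ∈ U ∧ f x = g y ∧ (j x ∈ B ↔ j' y ∈ B) ∧ ∀ D ∈ 𝔇, j x ∈ D → j' y ∈ D)
    {a : Z} (ha : HasExtendedIntegral L μ f a) : HasExtendedIntegral L ν g a := by
  classical
  intro T hT
  obtain ⟨T₀, hT₀, hcl, hTT, -⟩ := exists_closed_nhds_add hT
  obtain ⟨T₁, hT₁, -, -, hadd⟩ := exists_closed_nhds_add hT₀
  obtain ⟨A, hA, hAB⟩ := ha T₁ hT₁
  obtain ⟨D, hD, rfl⟩ := h.exists_preimage hA
  refine ⟨j' ⁻¹' D, h'.preimage_mem hD, fun B' hB' hDB => ?_⟩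
  obtain ⟨B, hB, rfl⟩ := h'.exists_preimage hB'
  have hDB' := h'.subset_of_preimage_subset hD hB hDB
  obtain ⟨𝒜₀, h𝒜₀, hf₀, hv₀⟩ := hAB _ (h.preimage_mem hB) (preimage_mono hDB')
  obtain ⟨U, hU, hBU, hcov⟩ := h.exists_covers (L := L) h𝒜₀ hf₀ hB
    fun x hx => indicator_of_notMem (show x ∉ j ⁻¹' B from hx) _
  obtain ⟨𝒜, h𝒜, hv⟩ := hcov U hU subset_rfl
  obtain ⟨𝔇, h𝔇, h𝔇c, hloc⟩ := h𝒜.isOpenOver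
  obtain ⟨r, hr, hr'⟩ := h𝒜.exists_step
  obtain ⟨N, hN, hNy⟩ := hfg 𝔇 h𝔇 h𝔇c B hB U hU hBU
  let gB := (j' ⁻¹' B).indicator g
  -- Off the exceptional sets `y` has a partner `x` with the same function value, and every
  -- witnessing set containing `j x` contains `j' y`; local constancy carries membership in `𝒜`
  -- over.
  have hgood : ∀ y, j' y ∈ U → (∀ n, y ∉ N n) → (gB y, j' y) ∈ 𝒜 := fun y hy hyN => by
    obtain ⟨x, hxU, hfg, hxB, hxD⟩ := hNy y hy hyN
    have h1 := h𝒜.approx x hxU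
    have h2 : (j ⁻¹' B).indicator f x = (j' ⁻¹' B).indicator g y := by
      by_cases hb : j x ∈ B
      · rw [indicator_of_mem (show x ∈ j ⁻¹' B from hb),
          indicator_of_mem (show y ∈ j' ⁻¹' B from hxB.1 hb), hfg]
      · rw [indicator_of_notMem (show x ∉ j ⁻¹' B from hb),
          indicator_of_notMem (show y ∉ j' ⁻¹' B from fun h => hb (hxB.2 h))]
    rw [h2] at h1
    obtain ⟨E, hE, hxE, hc⟩ := hloc _ _ hxU h1
    exact hc _ (hxD E hE hxE)
  -- On the exceptional sets `𝒜` still contains `r`. The defect is supported on countably many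
  -- negligible sets, and a null set `ℬ` added to `𝒜` absorbs it. The sets `N n` need not be
  -- disjoint.
  let q : Y → V := fun y => gB y - r (j' y)
  obtain ⟨ℬ, hℬ, hℬ0, hℬv⟩ := h'.isContinuousAlong.exists_covers_sum hL
    (h := fun n => (N n).indicator q) (g := (⋃ n, N n).indicator q) (fun n C hC => by
      refine h'.isNull (hN n _ fun y hy => ?_) hC
        fun y hy => indicator_of_notMem (show y ∉ j' ⁻¹' C from hy) _
      rw [indicator_indicator]
      exact indicator_of_notMem (fun h => hy h.2) _)
    (fun y => by
      by_cases hy : y ∈ ⋃ n, N n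
      · obtain ⟨n, hn⟩ := mem_iUnion.1 hy
        exact .inr ⟨n, by rw [indicator_of_mem hy, indicator_of_mem hn]⟩
      · exact .inl (indicator_of_notMem hy _)) hU hT₁
  have hsum : Covers P j' U (pointwiseSum 𝒜 ℬ) gB := by
    refine ⟨h𝒜.isOpenOver.pointwiseSum hℬ.isOpenOver,
      ⟨r, hr, fun ω hω => ⟨r ω, 0, hr' ω hω, hℬ0 ω hω, add_zero _⟩⟩, fun y hy => ?_⟩
    by_cases hyN : y ∈ ⋃ n, N n
    · have := hℬ.approx y hy
      rw [indicator_of_mem hyN] at this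
      exact ⟨_, _, hr' _ hy, this, add_sub_cancel _ _⟩
    · exact ⟨_, 0, hgood y hy fun n hn => hyN (mem_iUnion.2 ⟨n, hn⟩), hℬ0 _ hy, add_zero _⟩
  obtain ⟨𝒞, h𝒞, hg𝒞, hv𝒞⟩ := h'.exists_envelope hL hU hsum
    fun y hy => indicator_of_notMem (show y ∉ j' ⁻¹' B from fun h => hy (hBU h)) _
  refine ⟨𝒞, h𝒞, hg𝒞, fun z hz => hTT ?_⟩
  have hcl' : IsClosed {z : Z | z - a ∈ T₀} := hcl.preimage (continuous_id.sub continuous_const)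
  refine closure_minimal ?_ hcl' (hv𝒞 hz)
  refine (h'.isContinuousAlong.values_pointwiseSum_subset hL hU h𝒜.isOpenOver hℬ.isOpenOver hr hr'
    hℬ0).trans (closure_minimal ?_ hcl')
  rintro _ ⟨u, hu, w, hw, rfl⟩
  rw [mem_ofPred_eq, add_sub_right_comm]
  exact hadd _ (hv₀ u (hv hu)) _ (hℬv hw)

end RingContent


/-! ### The ring generated by a locally finite system -/

section Ring

variable {X W : Type*} {𝔖 : Set (Set X)} {A B E F : Set X}

/-- Indexed form of `FinitelyDecomposes`. -/
theorem finitelyDecomposes_iff_exists_fintype :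
    FinitelyDecomposes 𝔖 A ↔ ∃ (κ : Type) (_ : Fintype κ) (E : κ → 𝔖),
      Pairwise (fun k l => Disjoint (E k : Set X) (E l)) ∧ A = ⋃ k, (E k : Set X) := by
  constructor
  · rintro ⟨𝔈, h1, h2, h3, rfl⟩
    have := h2.fintype
    let e := (Fintype.equivFin 𝔈).symm
    refine ⟨Fin (Fintype.card 𝔈), inferInstance, fun k => ⟨e k, h1 (e k).2⟩, fun k l hkl => ?_, ?_⟩
    · exact h3 (e k).2 (e l).2 fun h => hkl (e.injective (Subtype.ext h))
    · rw [sUnion_eq_iUnion]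
      exact (e.surjective.iUnion_comp fun F : 𝔈 => (F : Set X)).symm
  · rintro ⟨κ, _, E, h1, rfl⟩
    refine ⟨range fun k => (E k : Set X), ?_, finite_range _, ?_, sUnion_range _⟩
    · rintro _ ⟨k, rfl⟩
      exact (E k).2
    · rintro _ ⟨k, rfl⟩ _ ⟨l, rfl⟩ hkl
      exact h1 fun h => hkl (by rw [h])

theorem finitelyDecomposes_empty : FinitelyDecomposes 𝔖 ∅ :=
  ⟨∅, empty_subset _, finite_empty, pairwiseDisjoint_empty, sUnion_empty⟩

theorem finitelyDecomposes_of_mem (h : E ∈ 𝔖) : FinitelyDecomposes 𝔖 E :=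
  ⟨{E}, by simpa using h, finite_singleton _, pairwiseDisjoint_singleton _ _, sUnion_singleton _⟩

theorem FinitelyDecomposes.iUnion {κ : Type*} [Finite κ] {A : κ → Set X}
    (h : ∀ k, FinitelyDecomposes 𝔖 (A k)) (hd : Pairwise fun k l => Disjoint (A k) (A l)) :
    FinitelyDecomposes 𝔖 (⋃ k, A k) := by
  choose 𝔈 h1 h2 h3 h4 using h
  refine ⟨⋃ k, 𝔈 k, iUnion_subset h1, finite_iUnion h2, ?_, ?_⟩
  · intro E hE F hF hEF
    obtain ⟨k, hk⟩ := mem_iUnion.1 hE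
    obtain ⟨l, hl⟩ := mem_iUnion.1 hF
    by_cases hkl : k = l
    · subst hkl
      exact h3 k hk hl hEF
    · refine (hd hkl).mono ?_ ?_
      · exact h4 k ▸ subset_sUnion_of_mem hk
      · exact h4 l ▸ subset_sUnion_of_mem hl
  · rw [sUnion_iUnion]
    exact iUnion_congr h4

theorem FinitelyDecomposes.union (hA : FinitelyDecomposes 𝔖 A) (hB : FinitelyDecomposes 𝔖 B)
    (hd : Disjoint A B) : FinitelyDecomposes 𝔖 (A ∪ B) := by
  rw [union_eq_iUnion]
  refine .iUnion (fun b => by cases b <;> assumption) ?_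
  rintro (_ | _) (_ | _) hkl
  exacts [absurd rfl hkl, hd.symm, hd, absurd rfl hkl]

variable (h𝔖 : IsLocallyFinite 𝔖)
include h𝔖

theorem FinitelyDecomposes.inter (hA : FinitelyDecomposes 𝔖 A) (hB : FinitelyDecomposes 𝔖 B) :
    FinitelyDecomposes 𝔖 (A ∩ B) := by
  obtain ⟨κ, _, E, hE, rfl⟩ := finitelyDecomposes_iff_exists_fintype.1 hA
  obtain ⟨κ', _, F, hF, rfl⟩ := finitelyDecomposes_iff_exists_fintype.1 hB
  have : (⋃ k, (E k : Set X)) ∩ ⋃ k, (F k : Set X) = ⋃ p : κ × κ', (E p.1 : Set X) ∩ F p.2 := by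
    rw [iUnion_inter_iUnion, iUnion_prod']
  rw [this]
  refine .iUnion (fun p => (h𝔖 _ (E p.1).2 _ (F p.2).2).1) fun p q hpq => ?_
  by_cases h : p.1 = q.1
  · exact (hF fun h' => hpq (Prod.ext h h')).mono inter_subset_right inter_subset_right
  · exact (hE h).mono inter_subset_left inter_subset_left

theorem FinitelyDecomposes.diff_biUnion (hA : FinitelyDecomposes 𝔖 A) {κ : Type*} (t : Finset κ)
    {F : κ → Set X} (h : ∀ k ∈ t, FinitelyDecomposes 𝔖 (A \ F k)) :
    FinitelyDecomposes 𝔖 (A \ ⋃ k ∈ t, F k) := by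
  classical
  induction t using Finset.induction_on with
  | empty => simpa using hA
  | insert a t _ ih =>
    rw [Finset.set_biUnion_insert, ← sdiff_inter_sdiff]
    exact (h a (by simp)).inter h𝔖 (ih fun k hk => h k (by simp [hk]))

/-- Local finiteness speaks only of nested differences. `E \ F` is `E` minus the finitely many
pieces of `E ∩ F`, each contained in `E`, so it is a finite intersection of nested differences. -/
theorem FinitelyDecomposes.diff (hA : FinitelyDecomposes 𝔖 A) (hB : FinitelyDecomposes 𝔖 B) :
    FinitelyDecomposes 𝔖 (A \ B) := by
  have h1 : ∀ E ∈ 𝔖, ∀ F ∈ 𝔖, FinitelyDecomposes 𝔖 (E \ F) := by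
    intro E hE F hF
    obtain ⟨κ, _, C, -, hC⟩ := finitelyDecomposes_iff_exists_fintype.1 (h𝔖 E hE F hF).1
    have h2 : E \ F = E \ ⋃ k ∈ (Finset.univ : Finset κ), (C k : Set X) := by
      rw [← sdiff_self_inter, hC]
      simp
    rw [h2]
    refine (finitelyDecomposes_of_mem hE).diff_biUnion h𝔖 _ fun k _ => (h𝔖 _ (C k).2 _ hE).2 ?_
    exact (subset_iUnion (fun k => (C k : Set X)) k).trans (hC ▸ inter_subset_left)
  obtain ⟨κ, _, E, hE, rfl⟩ := finitelyDecomposes_iff_exists_fintype.1 hA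
  obtain ⟨κ', _, F, -, rfl⟩ := finitelyDecomposes_iff_exists_fintype.1 hB
  rw [iUnion_sdiff]
  refine .iUnion (fun k => ?_) fun k l hkl => (hE hkl).mono sdiff_subset sdiff_subset
  have := (finitelyDecomposes_of_mem (E k).2).diff_biUnion h𝔖 Finset.univ (F := fun k => (F k : Set X))
    fun l _ => h1 _ (E k).2 _ (F l).2
  simpa using this

theorem FinitelyDecomposes.sup (hA : FinitelyDecomposes 𝔖 A) (hB : FinitelyDecomposes 𝔖 B) :
    FinitelyDecomposes 𝔖 (A ∪ B) := by
  rw [← union_sdiff_self]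
  exact hA.union (hB.diff h𝔖 hA) disjoint_sdiff_right

theorem finitelyDecomposes_of_mem_finiteUnions (hA : A ∈ finiteUnions 𝔖) :
    FinitelyDecomposes 𝔖 A := by
  obtain ⟨𝔈, h1, h2, rfl⟩ := hA
  induction 𝔈, h2 using Set.Finite.induction_on with
  | empty => simpa using finitelyDecomposes_empty
  | insert _ _ ih =>
    rw [sUnion_insert]
    exact (finitelyDecomposes_of_mem (h1 (mem_insert _ _))).sup h𝔖
      (ih ((subset_insert _ _).trans h1))

end Ring

/-! ### The extension of a measure to the ring -/

section Extension

variable {X W : Type*} [AddCommGroup W] {𝔖 : Set (Set X)} {A B : Set X}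

/-- `w` is the sum of the values of `μ` over a finite disjoint decomposition of `A`. -/
def IsDecompositionSum (μ : 𝔖 → W) (A : Set X) (w : W) : Prop :=
  ∃ (κ : Type) (_ : Fintype κ) (E : κ → 𝔖), Pairwise (fun k l => Disjoint (E k : Set X) (E l)) ∧
    A = ⋃ k, (E k : Set X) ∧ w = ∑ k, μ (E k)

open Classical in
/-- The additive extension of `μ` to the finite unions of members of `𝔖`. -/
noncomputable def extendMeasure (μ : 𝔖 → W) (A : Set X) : W :=
  if h : ∃ w, IsDecompositionSum μ A w then h.choose else 0

variable {μ : 𝔖 → W}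

theorem FinitelyDecomposes.exists_sum (μ : 𝔖 → W) (h : FinitelyDecomposes 𝔖 A) :
    ∃ w, IsDecompositionSum μ A w := by
  obtain ⟨κ, i, E, h1, h2⟩ := finitelyDecomposes_iff_exists_fintype.1 h
  exact ⟨_, κ, i, E, h1, h2, rfl⟩

theorem IsDecompositionSum.union {w w' : W} (h : IsDecompositionSum μ A w)
    (h' : IsDecompositionSum μ B w') (hd : Disjoint A B) :
    IsDecompositionSum μ (A ∪ B) (w + w') := by
  obtain ⟨κ, _, E, hE, rfl, rfl⟩ := h
  obtain ⟨κ', _, E', hE', rfl, rfl⟩ := h'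
  refine ⟨κ ⊕ κ', inferInstance, Sum.elim E E', ?_, ?_, ?_⟩
  · simp only [disjoint_iUnion_left, disjoint_iUnion_right] at hd
    rintro (k | k) (l | l) hkl
    · exact hE fun h => hkl (by rw [h])
    · exact hd l k
    · exact (hd k l).symm
    · exact hE' fun h => hkl (by rw [h])
  · ext; simp
  · simp

variable [TopologicalSpace W] [T2Space W] (h𝔖 : IsLocallyFinite 𝔖) (hμ : IsMeasure 𝔖 μ)
include h𝔖 hμ

/-- The pieces of all `E k ∩ F l` refine both decompositions, and the two sums become one double sum
summed in either order. -/
theorem IsDecompositionSum.unique {w w' : W} (h : IsDecompositionSum μ A w)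
    (h' : IsDecompositionSum μ A w') : w = w' := by
  obtain ⟨κ, _, E, hE, hA, rfl⟩ := h
  obtain ⟨κ', _, F, hF, hA', rfl⟩ := h'
  choose ι hι C hC hCE using fun (k : κ) (l : κ') =>
    finitelyDecomposes_iff_exists_fintype.1 (h𝔖 _ (E k).2 _ (F l).2).1
  have hsub : ∀ k l i, (C k l i : Set X) ⊆ E k ∩ F l := fun k l i =>
    (hCE k l).symm ▸ subset_iUnion (fun i => (C k l i : Set X)) i
  have h1 : ∀ k, μ (E k) = ∑ l, ∑ i, μ (C k l i) := by
    intro k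
    rw [← Fintype.sum_sigma' fun l i => μ (C k l i)]
    refine (hμ (Σ l, ι k l) (E k) (fun p => C k p.1 p.2) ?_ ?_).unique (hasSum_fintype _)
    · rintro ⟨l, i⟩ ⟨l', i'⟩ hne
      by_cases hl : l = l'
      · subst hl
        exact hC k l fun h => hne (by obtain rfl : i = i' := h; rfl)
      · exact (hF hl).mono ((hsub _ _ _).trans inter_subset_right)
          ((hsub _ _ _).trans inter_subset_right)
    · rw [iUnion_sigma]
      simp only [← hCE]
      rw [← inter_iUnion, ← hA', hA, eq_comm, inter_eq_left]
      exact subset_iUnion (fun k => (E k : Set X)) k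
  have h2 : ∀ l, μ (F l) = ∑ k, ∑ i, μ (C k l i) := by
    intro l
    rw [← Fintype.sum_sigma' fun k i => μ (C k l i)]
    refine (hμ (Σ k, ι k l) (F l) (fun p => C p.1 l p.2) ?_ ?_).unique (hasSum_fintype _)
    · rintro ⟨k, i⟩ ⟨k', i'⟩ hne
      by_cases hk : k = k'
      · subst hk
        exact hC k l fun h => hne (by obtain rfl : i = i' := h; rfl)
      · exact (hE hk).mono ((hsub _ _ _).trans inter_subset_left)
          ((hsub _ _ _).trans inter_subset_left)
    · rw [iUnion_sigma]
      simp only [← hCE]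
      rw [← iUnion_inter, ← hA, hA', eq_comm, inter_eq_right]
      exact subset_iUnion (fun k => (F k : Set X)) l
  simp only [h1, h2]
  exact Finset.sum_comm

theorem IsDecompositionSum.eq {w : W} (h : IsDecompositionSum μ A w) : extendMeasure μ A = w := by
  have h1 : ∃ w, IsDecompositionSum μ A w := ⟨w, h⟩
  rw [extendMeasure, dif_pos h1]
  exact h1.choose_spec.unique h𝔖 hμ h

theorem FinitelyDecomposes.isDecompositionSum (h : FinitelyDecomposes 𝔖 A) :
    IsDecompositionSum μ A (extendMeasure μ A) := by
  obtain ⟨w, hw⟩ := h.exists_sum μ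
  rwa [hw.eq h𝔖 hμ]

theorem extendMeasure_coe (E : 𝔖) : extendMeasure μ E = μ E :=
  IsDecompositionSum.eq h𝔖 hμ ⟨Unit, inferInstance, fun _ => E, fun _ _ h => absurd rfl h,
    (iUnion_const _).symm, by simp⟩

/-- The ring content given by a measure on a locally finite system. -/
noncomputable def ringContent : RingContent X W where
  sets := {A | FinitelyDecomposes 𝔖 A}
  empty_mem := finitelyDecomposes_empty
  union_mem hA hB := hA.sup h𝔖 hB
  diff_mem hA hB := hA.diff h𝔖 hB
  val := extendMeasure μ
  val_union hA hB hd := ((hA.isDecompositionSum h𝔖 hμ).union (hB.isDecompositionSum h𝔖 hμ) hd).eq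
    h𝔖 hμ

/-- The successive differences of an exhaustion split into finitely many members each. Together they
decompose the limit set countably, so σ-additivity applies; a general ring set is first cut along
its own pieces. -/
theorem ringContent_isContinuousAlong [RegularSpace W] [ContinuousAdd W] :
    (ringContent h𝔖 hμ).IsContinuousAlong (id : X → X) := by
  set P := ringContent h𝔖 hμ with hP
  -- the case of a member of the system
  have key : ∀ (E : 𝔖) (G : ℕ → Set X), P.Exhausts id G E →
      Tendsto (fun n => P.val (G n)) atTop (𝓝 (P.val E)) := by
    intro E G hG
    have hH : ∀ n, G (n + 1) \ G n ∈ P.sets := fun n => P.diff_mem (hG.mem _) (hG.mem _)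
    choose κ hκ C hC hCE hCv using fun n => (hH n : FinitelyDecomposes 𝔖 _).isDecompositionSum h𝔖 hμ
    have hsub : ∀ n k, (C n k : Set X) ⊆ G (n + 1) \ G n := fun n k =>
      (hCE n).symm ▸ subset_iUnion (fun k => (C n k : Set X)) k
    have hdis : ∀ m n, m < n → Disjoint (G (m + 1) \ G m) (G (n + 1) \ G n) := fun m n hmn =>
      disjoint_sdiff_right.mono_left (sdiff_subset.trans (hG.mono hmn))
    have h1 := hμ (Σ n, κ n) E (fun p => C p.1 p.2) (by
      rintro ⟨m, i⟩ ⟨n, l⟩ hne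
      rcases lt_trichotomy m n with hmn | rfl | hmn
      · exact (hdis m n hmn).mono (hsub _ _) (hsub _ _)
      · exact hC m fun h => hne (by obtain rfl : i = l := h; rfl)
      · exact (hdis n m hmn).symm.mono (hsub _ _) (hsub _ _)) (by
      rw [iUnion_sigma]
      simp only [← hCE]
      refine Subset.antisymm (fun x hx => ?_)
        (iUnion_subset fun n => sdiff_subset.trans (hG.subset _))
      have hex := hG.cover x hx
      classical
      -- The normalisation `G 0 = ∅` makes the first index a successor, so the point lies in a
      -- successive difference.
      obtain ⟨n, hn⟩ : ∃ n, Nat.find hex = n + 1 := Nat.exists_eq_succ_of_ne_zero fun h0 => by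
        have := Nat.find_spec hex
        rw [h0, hG.zero] at this
        exact this
      refine mem_iUnion.2 ⟨n, hn ▸ Nat.find_spec hex, Nat.find_min hex (by omega)⟩)
    have h2 := (h1.sigma fun n => hasSum_fintype _).tendsto_sum_nat
    rw [← extendMeasure_coe h𝔖 hμ] at h2
    refine h2.congr fun n => ?_
    simp only [← hCv]
    induction n with
    | zero => rw [hG.zero, P.val_empty, Finset.sum_range_zero]
    | succ n ih =>
      rw [Finset.sum_range_succ, ih, ← union_sdiff_cancel (hG.mono n.le_succ)]
      rw [P.val_union (hG.mem n) (hH n) disjoint_sdiff_right, union_sdiff_cancel (hG.mono n.le_succ)]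
      rfl
  intro A hA G hG
  obtain ⟨κ, _, E, hE, hAE⟩ := finitelyDecomposes_iff_exists_fintype.1 hA
  have hEm : ∀ k, (E k : Set X) ∈ P.sets := fun k => finitelyDecomposes_of_mem (E k).2
  have hval : ∀ B ∈ P.sets, B ⊆ A → P.val B = ∑ k, P.val (B ∩ E k) := by
    intro B hB hBA
    rw [← P.val_biUnion Finset.univ (fun k _ => P.inter_mem hB (hEm k))
      fun k _ l _ hkl => (hE hkl).mono inter_subset_right inter_subset_right]
    congr 1
    simp only [Finset.mem_univ, iUnion_true, ← inter_iUnion, ← hAE]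
    exact (inter_eq_left.2 hBA).symm
  rw [hval A hA subset_rfl]
  simp only [fun n => hval (G n) (hG.mem n) (hG.subset n)]
  refine tendsto_finsetSum _ fun k _ => ?_
  have hAk : A ∩ E k = E k := inter_eq_right.2 (hAE ▸ subset_iUnion (fun k => (E k : Set X)) k)
  have := hG.inter (hEm k)
  rw [hAk] at this
  rw [hAk]
  exact key (E k) _ this

end Extension


/-! ### The Stone completion -/

section Stone

variable {X : Type*} {𝔖 : Set (Set X)} {A B C : Set X}

theorem exists_stoneSpace_of_isFilterOn {F : Set (Set X)}
    (hF : IsFilterOn {A | Constructible 𝔖 A} F) : ∃ y : StoneSpace 𝔖, F ⊆ y.1 := by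
  obtain ⟨M, hM0, hM⟩ := zorn_subset_nonempty {F | IsFilterOn {A | Constructible 𝔖 A} F} (by
    intro c hc hchain hne
    refine ⟨⋃₀ c, ⟨?_, ?_, ?_, ?_, ?_⟩, fun s hs => subset_sUnion_of_mem hs⟩
    · exact sUnion_subset fun F hF => (hc hF).1
    · obtain ⟨F, hF⟩ := hne
      obtain ⟨C, hC⟩ := (hc hF).2.1
      exact ⟨C, F, hF, hC⟩
    · rintro ⟨F, hF, h1⟩
      exact (hc hF).2.2.1 h1
    · rintro C ⟨F, hF, hC⟩ D ⟨G, hG, hD⟩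
      rcases hchain.total hF hG with hle | hle
      · obtain ⟨K, hK, h1⟩ := (hc hG).2.2.2.1 C (hle hC) D hD
        exact ⟨K, ⟨G, hG, hK⟩, h1⟩
      · obtain ⟨K, hK, h1⟩ := (hc hF).2.2.2.1 C hC D (hle hD)
        exact ⟨K, ⟨F, hF, hK⟩, h1⟩
    · rintro C ⟨F, hF, hC⟩ D hD hCD
      exact ⟨F, hF, (hc hF).2.2.2.2 C hC D hD hCD⟩) _ hF
  exact ⟨⟨M, hM⟩, hM0⟩

namespace StoneSpace

variable (y : StoneSpace 𝔖)

theorem constructible (hA : A ∈ y.1) : Constructible 𝔖 A :=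
  y.2.prop.1 hA

theorem empty_notMem : ∅ ∉ y.1 :=
  y.2.prop.2.2.1

theorem mem_of_subset (hA : A ∈ y.1) (hB : Constructible 𝔖 B) (h : A ⊆ B) : B ∈ y.1 :=
  y.2.prop.2.2.2.2 A hA B hB h

theorem inter_mem (hA : A ∈ y.1) (hB : B ∈ y.1) : A ∩ B ∈ y.1 := by
  obtain ⟨C, hC, h⟩ := y.2.prop.2.2.2.1 A hA B hB
  exact y.mem_of_subset hC ((y.constructible hA).inter (y.constructible hB)) h

theorem nonempty_of_mem (hA : A ∈ y.1) : A.Nonempty := by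
  rw [nonempty_iff_ne_empty]
  rintro rfl
  exact y.empty_notMem hA

theorem constructible_empty (y : StoneSpace 𝔖) : Constructible 𝔖 (∅ : Set X) := by
  obtain ⟨A, hA⟩ := y.2.prop.2.1
  rw [← Set.sdiff_self (s := A)]
  exact (y.constructible hA).diff (y.constructible hA)

/-- The constructible sets containing some `C ∩ A` with `A ∈ y` form a filter above `y`; by
maximality it is `y`. -/
theorem mem_of_forall_nonempty (hC : Constructible 𝔖 C) (h : ∀ A ∈ y.1, (C ∩ A).Nonempty) :
    C ∈ y.1 := by
  have hF : IsFilterOn {A | Constructible 𝔖 A} {D | Constructible 𝔖 D ∧ ∃ A ∈ y.1, C ∩ A ⊆ D} := by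
    refine ⟨fun D hD => hD.1, ?_, ?_, ?_, ?_⟩
    · obtain ⟨A, hA⟩ := y.2.prop.2.1
      exact ⟨C, hC, A, hA, inter_subset_left⟩
    · rintro ⟨-, A, hA, h'⟩
      exact (h A hA).not_subset_empty h'
    · rintro D ⟨hD, A, hA, h1⟩ E ⟨hE, B, hB, h2⟩
      refine ⟨D ∩ E, ⟨hD.inter hE, A ∩ B, y.inter_mem hA hB, ?_⟩, subset_rfl⟩
      exact subset_inter ((inter_subset_inter_right _ inter_subset_left).trans h1)
        ((inter_subset_inter_right _ inter_subset_right).trans h2)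
    · rintro D ⟨-, A, hA, h1⟩ E hE hDE
      exact ⟨hE, A, hA, h1.trans hDE⟩
  have hle : y.1 ⊆ {D | Constructible 𝔖 D ∧ ∃ A ∈ y.1, C ∩ A ⊆ D} :=
    fun A hA => ⟨y.constructible hA, A, hA, inter_subset_right⟩
  obtain ⟨A, hA⟩ := y.2.prop.2.1
  exact y.2.le_of_ge hF hle ⟨hC, A, hA, inter_subset_left⟩

theorem union_mem_iff (hA : Constructible 𝔖 A) (hB : Constructible 𝔖 B) :
    A ∪ B ∈ y.1 ↔ A ∈ y.1 ∨ B ∈ y.1 := by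
  constructor
  · intro h
    by_contra! hn
    have hA' : ∃ D ∈ y.1, ¬ (A ∩ D).Nonempty := by
      by_contra! h'
      exact hn.1 (y.mem_of_forall_nonempty hA h')
    obtain ⟨D, hD, hAD⟩ := hA'
    refine hn.2 (y.mem_of_subset (y.inter_mem h hD) hB ?_)
    rintro x ⟨hx | hx, hxD⟩
    · exact absurd ⟨x, hx, hxD⟩ hAD
    · exact hx
  · rintro (h | h)
    · exact y.mem_of_subset h (hA.union hB) subset_union_left
    · exact y.mem_of_subset h (hA.union hB) subset_union_right

theorem diff_mem_iff (hA : Constructible 𝔖 A) (hB : Constructible 𝔖 B) :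
    A \ B ∈ y.1 ↔ A ∈ y.1 ∧ B ∉ y.1 := by
  constructor
  · refine fun h => ⟨y.mem_of_subset h hA sdiff_subset, fun hB' => ?_⟩
    have := y.inter_mem h hB'
    rw [sdiff_inter_self] at this
    exact y.empty_notMem this
  · rintro ⟨h1, h2⟩
    have h3 : A \ B ∪ B ∈ y.1 :=
      y.mem_of_subset h1 ((hA.diff hB).union hB) (by rw [sdiff_union_self]; exact subset_union_left)
    exact ((y.union_mem_iff (hA.diff hB) hB).1 h3).resolve_right h2

theorem sUnion_mem_iff {𝔈 : Set (Set X)} (hf : 𝔈.Finite) (h : 𝔈 ⊆ 𝔖) :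
    Constructible 𝔖 (⋃₀ 𝔈) ∧ (⋃₀ 𝔈 ∈ y.1 ↔ ∃ E ∈ 𝔈, E ∈ y.1) := by
  induction 𝔈, hf using Set.Finite.induction_on with
  | empty => simpa using ⟨y.constructible_empty, y.empty_notMem⟩
  | insert _ _ ih =>
    obtain ⟨h1, h2⟩ := ih ((subset_insert _ _).trans h)
    have h3 := Constructible.basic (h (mem_insert _ _))
    rw [sUnion_insert]
    refine ⟨h3.union h1, ?_⟩
    rw [y.union_mem_iff h3 h1, h2, exists_mem_insert]

theorem constructible_of_finitelyDecomposes (y : StoneSpace 𝔖) (h : FinitelyDecomposes 𝔖 A) :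
    Constructible 𝔖 A := by
  obtain ⟨𝔈, h1, h2, -, rfl⟩ := h
  exact (y.sUnion_mem_iff h2 h1).1

end StoneSpace

/-- If `𝔖` is empty then nothing is constructible, not even `∅`; a point of `A` provides a member of
`𝔖`. -/
theorem constructible_of_finitelyDecomposes (h : FinitelyDecomposes 𝔖 A) (hne : A.Nonempty) :
    Constructible 𝔖 A ∧ Constructible 𝔖 (∅ : Set X) := by
  obtain ⟨x, hx⟩ := hne
  have h' := h
  obtain ⟨𝔈, h1, -, -, rfl⟩ := h
  obtain ⟨E, hE, hxE⟩ := hx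
  have hE' := Constructible.basic (h1 hE)
  have h0 : Constructible 𝔖 (∅ : Set X) := by
    rw [← Set.sdiff_self (s := E)]
    exact hE'.diff hE'
  obtain ⟨y, -⟩ := exists_mem_not_mem hE' h0 (by simpa using ⟨x, hxE⟩)
  exact ⟨y.constructible_of_finitelyDecomposes h', h0⟩

theorem beta_eq_empty (h : FinitelyDecomposes 𝔖 A) (h0 : beta 𝔖 A = ∅) : A = ∅ := by
  by_contra hne
  obtain ⟨h1, h2⟩ := constructible_of_finitelyDecomposes h (nonempty_iff_ne_empty.2 hne)
  obtain ⟨y, hy, -⟩ := exists_mem_not_mem h1 h2 (by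
    rw [sdiff_empty]; exact nonempty_iff_ne_empty.2 hne)
  exact h0.subset hy

/-- Compactness of the sets `β A`. -/
theorem exists_subset_of_beta_subset {G : ℕ → Set X} (hG : ∀ n, FinitelyDecomposes 𝔖 (G n))
    (hmono : Monotone G) (hA : FinitelyDecomposes 𝔖 A)
    (h : ∀ y ∈ beta 𝔖 A, ∃ n, y ∈ beta 𝔖 (G n)) : ∃ n, A ⊆ G n := by
  by_contra! hn
  have hne : ∀ n, (A \ G n).Nonempty := fun n => sdiff_nonempty.2 (hn n)
  obtain ⟨hAc, h0⟩ := constructible_of_finitelyDecomposes hA ((hne 0).mono sdiff_subset)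
  have hGc : ∀ n, Constructible 𝔖 (G n) := fun n => by
    rcases (G n).eq_empty_or_nonempty with h' | h'
    · rw [h']; exact h0
    · exact (constructible_of_finitelyDecomposes (hG n) h').1
  -- If no `G n` contains `A`, the decreasing nonempty sets `A \ G n` generate a filter; a maximal
  -- filter above it lies in `β A` but in no `β (G n)`.
  obtain ⟨y, hy⟩ := exists_stoneSpace_of_isFilterOn (𝔖 := 𝔖)
    (F := {C | Constructible 𝔖 C ∧ ∃ n, A \ G n ⊆ C}) ⟨fun C hC => hC.1, ⟨A, hAc, 0, sdiff_subset⟩,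
      fun ⟨_, n, h'⟩ => (hne n).not_subset_empty h', by
        rintro C ⟨hC, m, hm⟩ D ⟨hD, n, hn⟩
        exact ⟨C ∩ D, ⟨hC.inter hD, max m n, subset_inter
          ((sdiff_subset_sdiff_right (hmono (le_max_left m n))).trans hm)
          ((sdiff_subset_sdiff_right (hmono (le_max_right m n))).trans hn)⟩, subset_rfl⟩,
      fun C hC D hD hCD => ⟨hD, hC.2.imp fun n h' => h'.trans hCD⟩⟩
  obtain ⟨n, hn⟩ := h y (hy ⟨hAc, 0, sdiff_subset⟩)
  have h1 : A \ G n ∈ y.1 := hy ⟨hAc.diff (hGc n), n, subset_rfl⟩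
  exact ((y.diff_mem_iff hAc (hGc n)).1 h1).2 hn

/-- A set together with its Stone completion, as a subset of the disjoint union. -/
def double (𝔖 : Set (Set X)) (A : Set X) : Set (X ⊕ StoneSpace 𝔖) :=
  {p | Sum.elim (fun x => x ∈ A) (fun y => A ∈ y.1) p}

theorem double_union (hA : FinitelyDecomposes 𝔖 A) (hB : FinitelyDecomposes 𝔖 B) :
    double 𝔖 (A ∪ B) = double 𝔖 A ∪ double 𝔖 B := by
  ext (x | y)
  · exact Iff.rfl
  · exact y.union_mem_iff (y.constructible_of_finitelyDecomposes hA)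
      (y.constructible_of_finitelyDecomposes hB)

theorem double_diff (hA : FinitelyDecomposes 𝔖 A) (hB : FinitelyDecomposes 𝔖 B) :
    double 𝔖 (A \ B) = double 𝔖 A \ double 𝔖 B := by
  ext (x | y)
  · exact Iff.rfl
  · exact y.diff_mem_iff (y.constructible_of_finitelyDecomposes hA)
      (y.constructible_of_finitelyDecomposes hB)

theorem double_empty : double 𝔖 ∅ = ∅ := by
  ext (x | y)
  · exact Iff.rfl
  · exact iff_of_false y.empty_notMem (notMem_empty _)

end Stone

/-! ### One content for a system and its Stone completion. -/

section Content

variable {X W : Type*} [AddCommGroup W] [TopologicalSpace W] [T2Space W] {𝔖 : Set (Set X)}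
  {μ : 𝔖 → W} (h𝔖 : IsLocallyFinite 𝔖) (hμ : IsMeasure 𝔖 μ)

/-- The content of the ring generated by `𝔖`, on the disjoint union of the underlying space and its
Stone completion. -/
noncomputable def doubleContent : RingContent (X ⊕ StoneSpace 𝔖) W where
  sets := double 𝔖 '' {A | FinitelyDecomposes 𝔖 A}
  empty_mem := ⟨∅, finitelyDecomposes_empty, double_empty⟩
  union_mem := by
    rintro _ _ ⟨A, hA, rfl⟩ ⟨B, hB, rfl⟩
    exact ⟨A ∪ B, hA.sup h𝔖 hB, double_union hA hB⟩
  diff_mem := by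
    rintro _ _ ⟨A, hA, rfl⟩ ⟨B, hB, rfl⟩
    exact ⟨A \ B, hA.diff h𝔖 hB, double_diff hA hB⟩
  val D := (ringContent h𝔖 hμ).val (Sum.inl ⁻¹' D)
  val_union := by
    rintro _ _ ⟨A, hA, rfl⟩ ⟨B, hB, rfl⟩ hd
    exact (ringContent h𝔖 hμ).val_union hA hB (hd.preimage Sum.inl)

theorem doubleContent_represents_inl [RegularSpace W] [ContinuousAdd W] :
    (doubleContent h𝔖 hμ).Represents Sum.inl μ where
  exists_mem E := ⟨double 𝔖 E, ⟨E, finitelyDecomposes_of_mem E.2, rfl⟩, rfl,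
    extendMeasure_coe h𝔖 hμ E⟩
  decomposes := by
    rintro _ ⟨A, hA, rfl⟩
    exact hA
  eq_empty := by
    rintro _ ⟨A, hA, rfl⟩ h
    have : A = ∅ := h
    rw [this, double_empty]
  isContinuousAlong := by
    intro D hD G hG
    refine ringContent_isContinuousAlong h𝔖 hμ (A := Sum.inl ⁻¹' D) ?_ (fun n => Sum.inl ⁻¹' G n)
      ⟨fun n => ?_, by rw [hG.zero]; rfl, fun m n hmn => preimage_mono (hG.mono hmn),
        fun n => preimage_mono (hG.subset n), hG.cover⟩
    · obtain ⟨A, hA, rfl⟩ := hD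
      exact hA
    · obtain ⟨A, hA, h⟩ := hG.mem n
      rw [← h]
      exact hA

/-- An exhaustion seen by the Stone completion reaches its limit set after finitely many steps, by
compactness, so continuity costs nothing beyond finite additivity. -/
theorem doubleContent_represents_inr :
    (doubleContent h𝔖 hμ).Represents Sum.inr (betaPush μ) where
  exists_mem := by
    rintro ⟨_, A, hA, rfl⟩
    refine ⟨double 𝔖 A, ⟨A, finitelyDecomposes_of_mem hA, rfl⟩, rfl, ?_⟩
    exact (extendMeasure_coe h𝔖 hμ ⟨A, hA⟩).trans (betaPush_beta μ ⟨A, hA⟩).symm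
  decomposes := by
    rintro _ ⟨A, ⟨𝔈, h1, h2, h3, rfl⟩, rfl⟩
    refine ⟨beta 𝔖 '' 𝔈, image_mono h1, h2.image _, ?_, ?_⟩
    · rintro _ ⟨E, hE, rfl⟩ _ ⟨F, hF, rfl⟩ hEF
      have hd : Disjoint E F := h3 hE hF fun h => hEF (by rw [h])
      refine disjoint_left.2 fun y hyE hyF => ?_
      have := y.inter_mem hyE hyF
      rw [disjoint_iff_inter_eq_empty.1 hd] at this
      exact y.empty_notMem this
    · ext y
      rw [sUnion_image]
      simp only [mem_iUnion, exists_prop]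
      exact (y.sUnion_mem_iff h2 h1).2.symm
  eq_empty := by
    rintro _ ⟨A, hA, rfl⟩ h
    rw [beta_eq_empty hA h, double_empty]
  isContinuousAlong := by
    rintro _ ⟨A, hA, rfl⟩ G hG
    choose G' hG' hGG using hG.mem
    have hGG' : ∀ n, G' n = Sum.inl ⁻¹' G n := fun n => by rw [← hGG]; rfl
    have hmono : Monotone G' := fun m n hmn => by
      rw [hGG', hGG']
      exact preimage_mono (hG.mono hmn)
    obtain ⟨N, hN⟩ := exists_subset_of_beta_subset hG' hmono hA fun y hy => by
      obtain ⟨n, hn⟩ := hG.cover y hy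
      rw [← hGG] at hn
      exact ⟨n, hn⟩
    refine tendsto_const_nhds.congr' ?_
    filter_upwards [eventually_ge_atTop N] with n hn
    have hsub : G' n ⊆ A := by
      rw [hGG']
      exact preimage_mono (hG.subset n)
    rw [← hGG n, Subset.antisymm hsub (hN.trans (hmono hn))]

end Content

/-! ### Comparison of the extended integral and the McShane integral -/

section Comparison

open RingContent

theorem RingContent.Represents.isWeaklyNegligible_empty {Ω X W V Z : Type*} [AddCommGroup W]
    [AddCommGroup V] [AddCommGroup Z] [TopologicalSpace W] [TopologicalSpace Z]
    [IsTopologicalAddGroup Z] {P : RingContent Ω W} {j : X → Ω} {𝔖 : Set (Set X)} {μ : 𝔖 → W}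
    (h : P.Represents j μ) {L : V →+ W →+ Z} (hL : ∀ c, Continuous (L c)) :
    IsWeaklyNegligible L μ ∅ := by
  intro f hf T hT
  obtain ⟨T₁, hT₁, hcl, hTT, -⟩ := exists_closed_nhds_add hT
  obtain ⟨𝒜, h1, h2, h3⟩ := h.exists_envelope hL P.empty_mem (𝒜 := univ) (f := f)
    ⟨⟨∅, empty_subset _, countable_empty, fun _ _ h => h.elim⟩,
      ⟨0, isStep_zero, fun _ h => h.elim⟩, fun _ h => h.elim⟩ fun x _ => hf x (notMem_empty x)
  refine ⟨𝒜, h1, h2, fun z hz => hTT ?_⟩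
  rw [sub_zero]
  refine closure_minimal ?_ hcl (h3 hz)
  rintro _ ⟨s, hs, -, hs0, rfl⟩
  have : s = 0 := funext fun ω => hs0 ω (notMem_empty ω)
  rw [this, integral_zero]
  exact mem_of_mem_nhds hT₁

variable {X V W Z : Type*} [TopologicalSpace X] [AddCommGroup V] [AddCommGroup W]
  [TopologicalSpace W] [IsTopologicalAddGroup W] [T2Space W] [AddCommGroup Z] [TopologicalSpace Z]
  [IsTopologicalAddGroup Z] {𝔖 : Set (Set X)} {μ : 𝔖 → W} {L : V →+ W →+ Z}
  (h𝔖 : IsLocallyFinite 𝔖) (hX : IsCompatible 𝔖) (hμ : IsMeasure 𝔖 μ)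
  (hL : ∀ c, Continuous (L c))
include h𝔖 hμ hL

/-- The partner of a filter `y` is `lim y`. For the countably many pieces `S` of `𝔇`, `B` and `U`,
and off the sets of hypothesis (ii), `lim y ∈ S` exactly when `S ∈ y`; a piece `T ∈ y` of `U` plays
the role of the bounding set. -/
theorem hasMcShaneIntegral_of_hasExtendedIntegral
    (h2 : ∀ S ∈ 𝔖, ∀ B ∈ 𝔖, IsWeaklyNegligible L (betaPush μ)
      ((beta 𝔖 S \ limMap hX ⁻¹' S) ∪ ((beta 𝔖 B ∩ limMap hX ⁻¹' S) \ beta 𝔖 S)))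
    {f : X → V} {a : Z} (ha : HasExtendedIntegral L μ f a) : HasMcShaneIntegral hX L μ f a := by
  have hl := doubleContent_represents_inl h𝔖 hμ
  have hr := doubleContent_represents_inr h𝔖 hμ
  refine hl.transfer hr hL ?_ ha
  intro 𝔇 h𝔇 h𝔇c B hB U hU hBU
  have hD : ∀ D ∈ (doubleContent h𝔖 hμ).sets, ∃ 𝔈 : Set (Set X), 𝔈 ⊆ 𝔖 ∧ 𝔈.Finite ∧
      D = double 𝔖 (⋃₀ 𝔈) := by
    rintro _ ⟨A, ⟨𝔈, h1, h2, -, rfl⟩, rfl⟩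
    exact ⟨𝔈, h1, h2, rfl⟩
  choose! 𝔈 h𝔈 h𝔈f hdec using hD
  let 𝔠 : Set (Set X) := ⋃ D ∈ 𝔇 ∪ {B, U}, 𝔈 D
  have hsub : ∀ D ∈ 𝔇 ∪ {B, U}, D ∈ (doubleContent h𝔖 hμ).sets := by
    rintro D (hD | rfl | rfl)
    exacts [h𝔇 hD, hB, hU]
  have h𝔠 : 𝔠 ⊆ 𝔖 := iUnion₂_subset fun D hD => h𝔈 D (hsub D hD)
  have h𝔠c : 𝔠.Countable := (h𝔇c.union (by simp)).biUnion fun D hD => (h𝔈f D (hsub D hD)).countable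
  let bad : Set X → Set X → Set (StoneSpace 𝔖) := fun S T =>
    (beta 𝔖 S \ limMap hX ⁻¹' S) ∪ ((beta 𝔖 T ∩ limMap hX ⁻¹' S) \ beta 𝔖 S)
  obtain ⟨N, hN⟩ := Set.Countable.exists_eq_range (s := image2 bad 𝔠 𝔠 ∪ {∅})
    ((h𝔠c.image2 h𝔠c _).union (countable_singleton _)) ⟨∅, .inr rfl⟩
  refine ⟨N, fun n => ?_, fun y hy hyN => ⟨limMap hX y, ?_⟩⟩
  · have : N n ∈ image2 bad 𝔠 𝔠 ∪ {∅} := hN ▸ mem_range_self n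
    rcases this with ⟨S, hS, T, hT, h⟩ | h
    · rw [← h]
      exact h2 S (h𝔠 hS) T (h𝔠 hT)
    · rw [h]
      exact hr.isWeaklyNegligible_empty hL
  have hmem : ∀ D ∈ 𝔇 ∪ {B, U}, (Sum.inr y ∈ D ↔ ∃ E ∈ 𝔈 D, E ∈ y.1) := fun D hD => by
    conv_lhs => rw [hdec D (hsub D hD)]
    exact (y.sUnion_mem_iff (h𝔈f D (hsub D hD)) (h𝔈 D (hsub D hD))).2
  have hmem' : ∀ D ∈ 𝔇 ∪ {B, U}, ∀ x : X, (Sum.inl x ∈ D ↔ ∃ E ∈ 𝔈 D, x ∈ E) := fun D hD x => by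
    conv_lhs => rw [hdec D (hsub D hD)]
    exact Iff.rfl
  have hB' : B ∈ 𝔇 ∪ {B, U} := .inr (.inl rfl)
  have hU' : U ∈ 𝔇 ∪ {B, U} := .inr (.inr rfl)
  obtain ⟨T, hT, hyT⟩ := (hmem U hU').1 hy
  have key : ∀ S ∈ 𝔠, (limMap hX y ∈ S ↔ S ∈ y.1) := by
    intro S hS
    have hnot : y ∉ bad S T := by
      have : bad S T ∈ range N := hN ▸ .inl ⟨S, hS, T, mem_biUnion hU' hT, rfl⟩
      obtain ⟨n, hn⟩ := this
      rw [← hn]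
      exact hyN n
    constructor
    · intro h
      by_contra h'
      exact hnot (.inr ⟨⟨hyT, h⟩, h'⟩)
    · intro h
      by_contra h'
      exact hnot (.inl ⟨h, h'⟩)
  have hall : ∀ D ∈ 𝔇 ∪ {B, U}, (Sum.inl (limMap hX y) ∈ D ↔ Sum.inr y ∈ D) := fun D hD => by
    rw [hmem D hD, hmem' D hD]
    exact exists_congr fun E => and_congr_right fun hE => key E (mem_biUnion hD hE)
  exact ⟨(hall U hU').2 hy, rfl, hall B hB', fun D hD => (hall D (.inl hD)).1⟩

/-- Points are lifted to filters. Off the sets of hypothesis (i), `x ∈ S` exactly when some `y ∈ β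
S` converges to `x`. The lift is taken in a piece of `B` if `x ∈ B` and in a piece of `U` otherwise;
any of the ring sets containing a lift contains `x`. -/
theorem hasExtendedIntegral_of_hasMcShaneIntegral
    (h1 : ∀ S ∈ 𝔖, ∀ B ∈ 𝔖, IsWeaklyNegligible L μ
      (((B ∩ limMap hX '' beta 𝔖 S) \ S) ∪ (S \ limMap hX '' beta 𝔖 S)))
    {f : X → V} {a : Z} (ha : HasMcShaneIntegral hX L μ f a) : HasExtendedIntegral L μ f a := by
  have hl := doubleContent_represents_inl h𝔖 hμ
  have hr := doubleContent_represents_inr h𝔖 hμ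
  refine hr.transfer hl hL ?_ ha
  intro 𝔇 h𝔇 h𝔇c B hB U hU hBU
  have hD : ∀ D ∈ (doubleContent h𝔖 hμ).sets, ∃ 𝔈 : Set (Set X), 𝔈 ⊆ 𝔖 ∧ 𝔈.Finite ∧
      D = double 𝔖 (⋃₀ 𝔈) := by
    rintro _ ⟨A, ⟨𝔈, h1, h2, -, rfl⟩, rfl⟩
    exact ⟨𝔈, h1, h2, rfl⟩
  choose! 𝔈 h𝔈 h𝔈f hdec using hD
  let 𝔠 : Set (Set X) := ⋃ D ∈ 𝔇 ∪ {B, U}, 𝔈 D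
  have hsub : ∀ D ∈ 𝔇 ∪ {B, U}, D ∈ (doubleContent h𝔖 hμ).sets := by
    rintro D (hD | rfl | rfl)
    exacts [h𝔇 hD, hB, hU]
  have h𝔠 : 𝔠 ⊆ 𝔖 := iUnion₂_subset fun D hD => h𝔈 D (hsub D hD)
  have h𝔠c : 𝔠.Countable := (h𝔇c.union (by simp)).biUnion fun D hD => (h𝔈f D (hsub D hD)).countable
  let bad : Set X → Set X → Set X := fun S T =>
    ((T ∩ limMap hX '' beta 𝔖 S) \ S) ∪ (S \ limMap hX '' beta 𝔖 S)
  obtain ⟨N, hN⟩ := Set.Countable.exists_eq_range (s := image2 bad 𝔠 𝔠 ∪ {∅})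
    ((h𝔠c.image2 h𝔠c _).union (countable_singleton _)) ⟨∅, .inr rfl⟩
  refine ⟨N, fun n => ?_, fun x hx hxN => ?_⟩
  · have : N n ∈ image2 bad 𝔠 𝔠 ∪ {∅} := hN ▸ mem_range_self n
    rcases this with ⟨S, hS, T, hT, h⟩ | h
    · rw [← h]
      exact h1 S (h𝔠 hS) T (h𝔠 hT)
    · rw [h]
      exact hl.isWeaklyNegligible_empty hL
  have hmem : ∀ D ∈ 𝔇 ∪ {B, U}, ∀ y : StoneSpace 𝔖, (Sum.inr y ∈ D ↔ ∃ E ∈ 𝔈 D, E ∈ y.1) :=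
    fun D hD y => by
      conv_lhs => rw [hdec D (hsub D hD)]
      exact (y.sUnion_mem_iff (h𝔈f D (hsub D hD)) (h𝔈 D (hsub D hD))).2
  have hmem' : ∀ D ∈ 𝔇 ∪ {B, U}, (Sum.inl x ∈ D ↔ ∃ E ∈ 𝔈 D, x ∈ E) := fun D hD => by
    conv_lhs => rw [hdec D (hsub D hD)]
    exact Iff.rfl
  have hB' : B ∈ 𝔇 ∪ {B, U} := .inr (.inl rfl)
  have hU' : U ∈ 𝔇 ∪ {B, U} := .inr (.inr rfl)
  obtain ⟨T, hT, hxT⟩ := (hmem' U hU').1 hx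
  have key : ∀ S ∈ 𝔠, (x ∈ S ↔ x ∈ limMap hX '' beta 𝔖 S) := by
    intro S hS
    have hnot : x ∉ bad S T := by
      have : bad S T ∈ range N := hN ▸ .inl ⟨S, hS, T, mem_biUnion hU' hT, rfl⟩
      obtain ⟨n, hn⟩ := this
      rw [← hn]
      exact hxN n
    constructor
    · intro h
      by_contra h'
      exact hnot (.inr ⟨h, h'⟩)
    · intro h
      by_contra h'
      exact hnot (.inl ⟨⟨hxT, h⟩, h'⟩)
  have hback : ∀ D ∈ 𝔇 ∪ {B, U}, ∀ y : StoneSpace 𝔖, limMap hX y = x → Sum.inr y ∈ D →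
      Sum.inl x ∈ D := fun D hD y hyx hy => by
    obtain ⟨E, hE, hyE⟩ := (hmem D hD y).1 hy
    exact (hmem' D hD).2 ⟨E, hE, (key E (mem_biUnion hD hE)).2 ⟨y, hyE, hyx⟩⟩
  by_cases hxB : Sum.inl x ∈ B
  · obtain ⟨S, hS, hxS⟩ := (hmem' B hB').1 hxB
    obtain ⟨y, hyS, hyx⟩ := (key S (mem_biUnion hB' hS)).1 hxS
    have hyB : Sum.inr y ∈ B := (hmem B hB' y).2 ⟨S, hS, hyS⟩
    exact ⟨y, hBU hyB, congrArg f hyx, iff_of_true hyB hxB, fun D hD => hback D (.inl hD) y hyx⟩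
  · obtain ⟨y, hyT, hyx⟩ := (key T (mem_biUnion hU' hT)).1 hxT
    exact ⟨y, (hmem U hU' y).2 ⟨T, hT, hyT⟩, congrArg f hyx,
      iff_of_false (fun h => hxB (hback B hB' y hyx h)) hxB, fun D hD => hback D (.inl hD) y hyx⟩

omit [TopologicalSpace X] in
theorem hasExtendedIntegral_unique [T2Space Z] {f : X → V} {a b : Z}
    (ha : HasExtendedIntegral L μ f a) (hb : HasExtendedIntegral L μ f b) : a = b :=
  (doubleContent_represents_inl h𝔖 hμ).extendedIntegral_unique hL ha hb

end Comparison


/-! ### Bounded intervals of the real line -/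

section RealIntervals

open MeasureTheory

theorem realIntervals_inter {I J : Set ℝ} (hI : I ∈ realIntervals) (hJ : J ∈ realIntervals) :
    I ∩ J ∈ realIntervals :=
  ⟨hI.1.inter hJ.1, hI.2.subset inter_subset_left⟩

theorem Icc_mem_realIntervals (a b : ℝ) : Icc a b ∈ realIntervals :=
  ⟨ordConnected_Icc, Metric.isBounded_Icc a b⟩

theorem Ioo_mem_realIntervals (a b : ℝ) : Ioo a b ∈ realIntervals :=
  ⟨ordConnected_Ioo, Metric.isBounded_Ioo a b⟩

/-- Removing a nonempty subinterval leaves the parts to its left and to its right; either may be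
empty, and `∅` counts as an interval. -/
theorem realIntervals_isLocallyFinite : IsLocallyFinite realIntervals := by
  intro I hI J hJ
  refine ⟨finitelyDecomposes_of_mem (realIntervals_inter hI hJ), fun hIJ => ?_⟩
  rcases I.eq_empty_or_nonempty with rfl | ⟨z, hz⟩
  · rw [sdiff_empty]
    exact finitelyDecomposes_of_mem hJ
  have hEq : J \ I = {x ∈ J | ∀ y ∈ I, x < y} ∪ {x ∈ J | ∀ y ∈ I, y < x} := by
    ext x
    constructor
    · rintro ⟨hxJ, hxI⟩
      rcases lt_trichotomy x z with h | rfl | h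
      · exact .inl ⟨hxJ, fun y hy => not_le.1 fun h' => hxI (hI.1.out hy hz ⟨h', h.le⟩)⟩
      · exact absurd hz hxI
      · exact .inr ⟨hxJ, fun y hy => not_le.1 fun h' => hxI (hI.1.out hz hy ⟨h.le, h'⟩)⟩
    · rintro (⟨hxJ, h⟩ | ⟨hxJ, h⟩)
      · exact ⟨hxJ, fun hx => lt_irrefl _ (h x hx)⟩
      · exact ⟨hxJ, fun hx => lt_irrefl _ (h x hx)⟩
  rw [hEq]
  have h1 : {x ∈ J | ∀ y ∈ I, x < y} ∈ realIntervals :=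
    ⟨⟨fun x hx y hy w hw => ⟨hJ.1.out hx.1 hy.1 hw, fun u hu => hw.2.trans_lt (hy.2 u hu)⟩⟩,
      hJ.2.subset (sep_subset _ _)⟩
  have h2 : {x ∈ J | ∀ y ∈ I, y < x} ∈ realIntervals :=
    ⟨⟨fun x hx y hy w hw => ⟨hJ.1.out hx.1 hy.1 hw, fun u hu => (hx.2 u hu).trans_le hw.1⟩⟩,
      hJ.2.subset (sep_subset _ _)⟩
  exact (finitelyDecomposes_of_mem h1).union (finitelyDecomposes_of_mem h2)
    (disjoint_left.2 fun x a b => lt_asymm (a.2 z hz) (b.2 z hz))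

theorem volume_ne_top {I : Set ℝ} (hI : I ∈ realIntervals) : volume I ≠ ⊤ :=
  hI.2.measure_lt_top.ne

theorem intervalLength_isMeasure : IsMeasure realIntervals intervalLength := by
  intro ι _ A E hE hA
  have h1 : volume (A : Set ℝ) = ∑' i, volume (E i : Set ℝ) := by
    rw [hA, measure_iUnion hE fun i => (E i).2.1.measurableSet]
  have h2 := ENNReal.hasSum_toReal (f := fun i => volume (E i : Set ℝ)) (by
    rw [← h1]; exact volume_ne_top A.2)
  have h3 : intervalLength A = ∑' i, (volume (E i : Set ℝ)).toReal := by
    rw [intervalLength, measureReal_def, h1, ENNReal.tsum_toReal_eq fun i => volume_ne_top (E i).2]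
  rw [h3]
  exact h2

theorem integrable_stepFun {n : ℕ} (c : Fin n → ℝ) (E : Fin n → realIntervals) :
    Integrable (stepFun c E) ∧ ∫ x, stepFun c E x = ∑ k, c k * intervalLength (E k) := by
  have h1 : ∀ k, Integrable ((E k : Set ℝ).indicator fun _ => c k) := fun k =>
    (integrable_indicator_iff (E k).2.1.measurableSet).2
      (integrableOn_const (volume_ne_top (E k).2))
  refine ⟨integrable_finsetSum _ fun k _ => h1 k, ?_⟩
  unfold stepFun
  rw [integral_finsetSum _ fun k _ => h1 k]
  refine Finset.sum_congr rfl fun k _ => ?_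
  rw [integral_indicator_const _ (E k).2.1.measurableSet, smul_eq_mul, mul_comm]
  rfl

/-- Turns elementary integrals into Lebesgue integrals. With `doubleContent` and `Sum.inl` it
applies even to step functions that come from envelopes on the Stone completion. -/
theorem RingContent.Represents.integrable {Ω : Type*} {P : RingContent Ω ℝ} {j : ℝ → Ω}
    (h : P.Represents j intervalLength) {s : Ω → ℝ} (hs : P.IsStep s) :
    Integrable (fun x => s (j x)) ∧ P.integral AddMonoidHom.mul s = ∫ x, s (j x) := by
  obtain ⟨n, c, E, hE⟩ := h.exists_stepFun hs
  obtain ⟨t, ht, htj, hint⟩ := h.exists_step AddMonoidHom.mul c E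
  have hts : t = s := h.step_ext ht hs fun x => by rw [htj, hE]
  have hfun : stepFun c E = fun x => s (j x) := funext hE
  obtain ⟨h1, h2⟩ := integrable_stepFun c E
  rw [hfun] at h1 h2
  refine ⟨h1, ?_⟩
  rw [h2, ← hts, hint]
  rfl

theorem continuous_mul_apply (c : ℝ) : Continuous (AddMonoidHom.mul c : ℝ →+ ℝ) :=
  continuous_const_mul c

/-! #### Compatibility with the usual topology -/

theorem isBounded_of_constructible {A : Set ℝ} (h : Constructible realIntervals A) :
    Bornology.IsBounded A := by
  induction h with
  | basic h => exact h.2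
  | union _ _ h1 h2 => exact h1.union h2
  | inter _ _ h1 _ => exact h1.subset inter_subset_left
  | diff _ _ h1 _ => exact h1.subset sdiff_subset

/-- The members of a maximal filter are bounded, so their closures have a common point; by
maximality the filter contains every open interval around it. Uniqueness is the Hausdorff property.
-/
theorem realIntervals_isCompatible : IsCompatible realIntervals := by
  intro y
  obtain ⟨A₀, hA₀⟩ := y.2.prop.2.1
  have hne : Nonempty y.1 := ⟨⟨A₀, hA₀⟩⟩
  obtain ⟨p, hp⟩ := IsCompact.nonempty_iInter_of_directed_nonempty_isCompact_isClosed
    (fun A : y.1 => closure (A : Set ℝ)) (fun A B => ⟨⟨A ∩ B, y.inter_mem A.2 B.2⟩,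
      closure_mono inter_subset_left, closure_mono inter_subset_right⟩)
    (fun A => (y.nonempty_of_mem A.2).closure)
    (fun A => (isBounded_of_constructible (y.constructible A.2)).isCompact_closure)
    (fun A => isClosed_closure)
  rw [mem_iInter] at hp
  refine ⟨p, fun U hU => ?_, fun q hq => ?_⟩
  · obtain ⟨ε, hε, hεU⟩ := Metric.mem_nhds_iff.1 hU
    rw [Real.ball_eq_Ioo] at hεU
    refine ⟨Ioo (p - ε) (p + ε), ?_, hεU⟩
    refine y.mem_of_forall_nonempty (.basic (Ioo_mem_realIntervals _ _)) fun A hA => ?_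
    exact mem_closure_iff_nhds.1 (hp ⟨A, hA⟩) _ (Ioo_mem_nhds (by linarith) (by linarith))
  · by_contra hqp
    obtain ⟨U, V, hU, hV, hqU, hpV, hUV⟩ := t2_separation hqp
    obtain ⟨A, hA, hAU⟩ := hq U (hU.mem_nhds hqU)
    obtain ⟨x, hxV, hxA⟩ := mem_closure_iff_nhds.1 (hp ⟨A, hA⟩) V (hV.mem_nhds hpV)
    exact disjoint_left.1 hUV (hAU hxA) hxV

theorem limMap_spec {X : Type*} [TopologicalSpace X] {𝔖 : Set (Set X)} (h : IsCompatible 𝔖)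
    (y : StoneSpace 𝔖) {U : Set X} (hU : U ∈ 𝓝 (limMap h y)) : ∃ A ∈ y.1, A ⊆ U :=
  (h y).choose_spec.1 U hU

theorem limMap_mem_closure {X : Type*} [TopologicalSpace X] {𝔖 : Set (Set X)} (h : IsCompatible 𝔖)
    {y : StoneSpace 𝔖} {S : Set X} (hS : S ∈ y.1) : limMap h y ∈ closure S := by
  refine mem_closure_iff_nhds.2 fun U hU => ?_
  obtain ⟨A, hA, hAU⟩ := limMap_spec h y hU
  exact (y.nonempty_of_mem (y.inter_mem hA hS)).mono (inter_subset_inter_left _ hAU)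

theorem Ioo_mem_of_limMap {h : IsCompatible realIntervals} {y : StoneSpace realIntervals} {a b : ℝ}
    (hy : limMap h y ∈ Ioo a b) : Ioo a b ∈ y.1 := by
  obtain ⟨A, hA, hAU⟩ := limMap_spec h y (isOpen_Ioo.mem_nhds hy)
  exact y.mem_of_subset hA (.basic (Ioo_mem_realIntervals a b)) hAU

/-- The principal filters are maximal. -/
theorem exists_principal {X : Type*} {𝔖 : Set (Set X)} {S : Set X} (hS : S ∈ 𝔖) {x : X}
    (hx : x ∈ S) : ∃ y : StoneSpace 𝔖, ∀ A, A ∈ y.1 ↔ Constructible 𝔖 A ∧ x ∈ A := by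
  refine ⟨⟨{A | Constructible 𝔖 A ∧ x ∈ A}, ⟨fun A hA => hA.1, ⟨S, .basic hS, hx⟩, fun h => h.2,
    fun A hA B hB => ⟨A ∩ B, ⟨hA.1.inter hB.1, hA.2, hB.2⟩, subset_rfl⟩,
    fun A hA B hB hAB => ⟨hB, hAB hA.2⟩⟩, ?_⟩, fun A => Iff.rfl⟩
  intro F hF hle A hA
  refine ⟨hF.1 hA, ?_⟩
  by_contra hxA
  obtain ⟨C, hC, hCs⟩ := hF.2.2.2.1 A hA (S \ A)
    (hle ⟨(Constructible.basic hS).diff (hF.1 hA), hx, hxA⟩)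
  have : C = ∅ := subset_empty_iff.1 fun z hz => (hCs hz).2.2 (hCs hz).1
  exact hF.2.2.1 (this ▸ hC)

theorem mem_limMap_image (h : IsCompatible realIntervals) {S : Set ℝ} (hS : S ∈ realIntervals)
    {x : ℝ} (hx : x ∈ S) : x ∈ limMap h '' beta realIntervals S := by
  obtain ⟨y, hy⟩ := exists_principal hS hx
  refine ⟨y, (hy S).2 ⟨.basic hS, hx⟩, ?_⟩
  by_contra hne
  have hSx : ({x} : Set ℝ) ∈ y.1 :=
    (hy _).2 ⟨.basic ⟨ordConnected_singleton, Bornology.isBounded_singleton⟩, rfl⟩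
  have := limMap_mem_closure h hSx
  rw [closure_singleton] at this
  exact hne this

/-- The endpoints of an interval. -/
theorem closure_diff_subset_endpoints {S : Set ℝ} (hS : S ∈ realIntervals) {x : ℝ}
    (hx : x ∈ closure S) (hx' : x ∉ interior S) : x ∈ ({sInf S, sSup S} : Set ℝ) := by
  by_contra hn
  simp only [mem_insert_iff, mem_singleton_iff, not_or] at hn
  have hne : S.Nonempty := closure_nonempty_iff.1 ⟨x, hx⟩
  have h1 : sInf S ≤ x := by
    have : closure S ⊆ Ici (sInf S) :=
      closure_minimal (fun z hz => csInf_le hS.2.bddBelow hz) isClosed_Ici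
    exact this hx
  have h2 : x ≤ sSup S := by
    have : closure S ⊆ Iic (sSup S) :=
      closure_minimal (fun z hz => le_csSup hS.2.bddAbove hz) isClosed_Iic
    exact this hx
  obtain ⟨s, hs, hsx⟩ := exists_lt_of_csInf_lt hne (h1.lt_of_ne' hn.1)
  obtain ⟨t, ht, hxt⟩ := exists_lt_of_lt_csSup hne (h2.lt_of_ne hn.2)
  exact hx' (mem_interior.2 ⟨Ioo s t, Ioo_subset_Icc_self.trans (hS.1.out hs ht), isOpen_Ioo,
    hsx, hxt⟩)

/-! #### Negligible sets -/

/-- The ring content of the bounded intervals. -/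
noncomputable def intervalContent : RingContent ℝ ℝ :=
  ringContent realIntervals_isLocallyFinite intervalLength_isMeasure

theorem intervalContent_represents : intervalContent.Represents (id : ℝ → ℝ) intervalLength where
  exists_mem E := ⟨E, finitelyDecomposes_of_mem E.2, rfl,
    extendMeasure_coe realIntervals_isLocallyFinite intervalLength_isMeasure E⟩
  decomposes _ hD := hD
  eq_empty _ _ h := h
  isContinuousAlong :=
    ringContent_isContinuousAlong realIntervals_isLocallyFinite intervalLength_isMeasure

theorem mem_intervalContent_sets {I : Set ℝ} (hI : I ∈ realIntervals) :
    I ∈ intervalContent.sets :=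
  finitelyDecomposes_of_mem hI

theorem measurableSet_of_mem_sets {A : Set ℝ} (hA : A ∈ intervalContent.sets) :
    MeasurableSet A := by
  obtain ⟨𝔈, h1, h2, -, rfl⟩ := hA
  exact .sUnion h2.countable fun E hE => (h1 hE).1.measurableSet

theorem isBounded_of_mem_sets {A : Set ℝ} (hA : A ∈ intervalContent.sets) :
    Bornology.IsBounded A := by
  obtain ⟨𝔈, h1, h2, -, rfl⟩ := hA
  exact (Bornology.isBounded_sUnion h2).2 fun E hE => (h1 hE).2

/-- All values may be admitted over the two points, since step functions living there vanish almost
everywhere. -/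
theorem isWeaklyNegligible_subset_pair {N : Set ℝ} (p q : ℝ) (hN : N ⊆ {p, q}) :
    IsWeaklyNegligible AddMonoidHom.mul intervalLength N := by
  intro f hf T hT
  have hsing : ∀ r : ℝ, ({r} : Set ℝ) ∈ intervalContent.sets := fun r =>
    mem_intervalContent_sets ⟨ordConnected_singleton, Bornology.isBounded_singleton⟩
  have hU : ({p, q} : Set ℝ) ∈ intervalContent.sets :=
    intervalContent.union_mem (hsing p) (hsing q)
  obtain ⟨𝒜, h1, h2, h3⟩ := intervalContent_represents.exists_envelope (L := AddMonoidHom.mul)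
    continuous_mul_apply hU (𝒜 := univ) (f := f)
    ⟨⟨{{p, q}}, by simpa using hU, countable_singleton _,
      fun _ _ hω _ => ⟨_, rfl, hω, fun _ _ => mem_univ _⟩⟩,
      ⟨0, RingContent.isStep_zero, fun _ _ => mem_univ _⟩, fun _ _ => mem_univ _⟩
    fun x hx => hf x fun h => hx (hN h)
  obtain ⟨T₁, hT₁, hcl, hTT, -⟩ := exists_closed_nhds_add hT
  refine ⟨𝒜, h1, h2, fun z hz => hTT ?_⟩
  rw [sub_zero]
  refine closure_minimal ?_ hcl (h3 hz)
  rintro _ ⟨s, hs, -, hs0, rfl⟩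
  rw [(intervalContent_represents.integrable hs).2, integral_eq_zero_of_ae]
  · exact mem_of_mem_nhds hT₁
  · have : ∀ᵐ x : ℝ, x ∉ ({p, q} : Set ℝ) := measure_eq_zero_iff_ae_notMem.1
      ((toFinite ({p, q} : Set ℝ)).measure_zero volume)
    filter_upwards [this] with x hx
    exact hs0 x hx

/-- A filter converging to `p` need not contain `{p}`, but it contains every open interval around
`p`. Values of size at most `n` are admitted on an interval so short that `n` times its length is
summable to less than `ε`; no bound on `f` is needed. -/
theorem isWeaklyNegligible_limMap_preimage (h : IsCompatible realIntervals)
    {N : Set (StoneSpace realIntervals)} (p q : ℝ) (hN : N ⊆ limMap h ⁻¹' {p, q}) :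
    IsWeaklyNegligible AddMonoidHom.mul (betaPush intervalLength) N := by
  intro f hf T hT
  set P := doubleContent realIntervals_isLocallyFinite intervalLength_isMeasure
  have hl : P.Represents Sum.inl intervalLength :=
    doubleContent_represents_inl realIntervals_isLocallyFinite intervalLength_isMeasure
  have hr : P.Represents Sum.inr (betaPush intervalLength) :=
    doubleContent_represents_inr realIntervals_isLocallyFinite intervalLength_isMeasure
  obtain ⟨ε, hε, hεT⟩ := Metric.nhds_basis_closedBall.mem_iff.1 hT
  obtain ⟨η, hη, hsum⟩ := ENNReal.exists_pos_sum_of_countable (ε := ENNReal.ofReal ε)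
    (by simpa using hε) (({p, q} : Set ℝ) × ℕ)
  -- The interval of level `n` has length `η / (n + 1)`, hence contributes at most `n * η / (n + 1)
  -- ≤ η`.
  let δ : ({p, q} : Set ℝ) × ℕ → ℝ := fun i => η i / (2 * (i.2 + 1))
  have hδ : ∀ i, 0 < δ i := fun i => div_pos (hη i) (by positivity)
  let I : ({p, q} : Set ℝ) × ℕ → Set ℝ := fun i => Ioo (i.1 - δ i) (i.1 + δ i)
  have hI : ∀ i, double realIntervals (I i) ∈ P.sets := fun i =>
    ⟨I i, finitelyDecomposes_of_mem (Ioo_mem_realIntervals _ _), rfl⟩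
  let J : Set ℝ := Ioo (p - 1) (p + 1) ∪ Ioo (q - 1) (q + 1)
  have hJ : double realIntervals J ∈ P.sets :=
    ⟨J, (finitelyDecomposes_of_mem (Ioo_mem_realIntervals _ _)).sup realIntervals_isLocallyFinite
      (finitelyDecomposes_of_mem (Ioo_mem_realIntervals _ _)), rfl⟩
  let 𝒜 : Set (ℝ × (ℝ ⊕ StoneSpace realIntervals)) :=
    {a | a.1 = 0 ∨ ∃ i, |a.1| ≤ (i : _ × ℕ).2 ∧ a.2 ∈ double realIntervals (I i)}
  have hcov : RingContent.Covers P Sum.inr (double realIntervals J) 𝒜 f := by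
    refine ⟨⟨insert (double realIntervals J) (range fun i => double realIntervals (I i)), ?_,
      (countable_range _).insert _, ?_⟩, ⟨0, RingContent.isStep_zero, fun _ _ => .inl rfl⟩, ?_⟩
    · rintro _ (rfl | ⟨i, rfl⟩)
      exacts [hJ, hI i]
    · rintro v ω hω (hv | ⟨i, hv, hi⟩)
      · exact ⟨_, mem_insert _ _, hω, fun _ _ => .inl hv⟩
      · exact ⟨_, .inr ⟨i, rfl⟩, hi, fun _ h => .inr ⟨i, hv, h⟩⟩
    · intro y hy
      by_cases hyN : y ∈ N
      · obtain ⟨n, hn⟩ := exists_nat_ge |f y|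
        refine .inr ⟨⟨⟨limMap h y, hN hyN⟩, n⟩, hn, ?_⟩
        have hd := hδ ⟨⟨limMap h y, hN hyN⟩, n⟩
        exact Ioo_mem_of_limMap (h := h) (y := y) ⟨sub_lt_self _ hd, lt_add_of_pos_right _ hd⟩
      · exact .inl (hf y hyN)
  obtain ⟨𝒜', h1, h2, h3⟩ := hr.exists_envelope (L := AddMonoidHom.mul) continuous_mul_apply hJ hcov
    fun y hy => hf y fun hyN => hy (by
      have hJc : Constructible realIntervals J :=
        (Constructible.basic (Ioo_mem_realIntervals _ _)).union
          (.basic (Ioo_mem_realIntervals _ _))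
      rcases hN hyN with hp | hq
      · refine y.mem_of_subset (Ioo_mem_of_limMap (h := h) (a := p - 1) (b := p + 1) ?_) hJc
          subset_union_left
        rw [hp]
        constructor <;> linarith
      · refine y.mem_of_subset (Ioo_mem_of_limMap (h := h) (a := q - 1) (b := q + 1) ?_) hJc
          subset_union_right
        rw [show limMap h y = q from hq]
        constructor <;> linarith)
  refine ⟨𝒜', h1, h2, fun z hz => hεT ?_⟩
  rw [sub_zero]
  refine closure_minimal ?_ Metric.isClosed_closedBall (h3 hz)
  rintro _ ⟨s, hs, hs', hs0, rfl⟩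
  obtain ⟨hint, heq⟩ := hl.integrable hs
  rw [heq, mem_closedBall_zero_iff]
  refine (norm_integral_le_lintegral_norm _).trans ?_
  refine ENNReal.toReal_le_of_le_ofReal hε.le ?_
  refine le_trans ?_ hsum.le
  have hbound : ∀ x, ENNReal.ofReal ‖s (Sum.inl x)‖ ≤
      ∑' i, (I i).indicator (fun _ => (i.2 : ENNReal)) x := by
    intro x
    have hx : s (Sum.inl x) = 0 ∨ ∃ i, |s (Sum.inl x)| ≤ (i : _ × ℕ).2 ∧ x ∈ I i := by
      by_cases hxJ : Sum.inl x ∈ double realIntervals J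
      · exact hs' _ hxJ
      · exact .inl (hs0 _ hxJ)
    rcases hx with h0 | ⟨i, hi, hxi⟩
    · simp [h0]
    · refine le_trans ?_ (ENNReal.le_tsum i)
      rw [indicator_of_mem hxi, ← ENNReal.ofReal_natCast]
      exact ENNReal.ofReal_le_ofReal hi
  refine (lintegral_mono hbound).trans ?_
  rw [lintegral_tsum fun i => (measurable_const.indicator measurableSet_Ioo).aemeasurable]
  refine ENNReal.tsum_le_tsum fun i => ?_
  rw [lintegral_indicator_const measurableSet_Ioo, Real.volume_Ioo, ← ENNReal.ofReal_natCast,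
    ← ENNReal.ofReal_mul (by positivity), ← ENNReal.ofReal_coe_nnreal]
  refine ENNReal.ofReal_le_ofReal ?_
  have h2 : (i.1 : ℝ) + δ i - (i.1 - δ i) = η i / (i.2 + 1) := by
    simp only [δ]
    field_simp
    ring
  rw [h2, mul_div_assoc', div_le_iff₀ (by positivity)]
  nlinarith [(η i).2]

/-- Where `S` and `β S` disagree, the limit point lies in the closure but not in the interior of
`S`, so it is an endpoint. Principal filters show that `S \ lim (β S)` is empty. -/
theorem hasExtendedIntegral_iff_hasMcShaneIntegral (h : IsCompatible realIntervals) (f : ℝ → ℝ)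
    (a : ℝ) : HasExtendedIntegral AddMonoidHom.mul intervalLength f a ↔
      HasMcShaneIntegral h AddMonoidHom.mul intervalLength f a := by
  constructor
  · refine hasMcShaneIntegral_of_hasExtendedIntegral realIntervals_isLocallyFinite h
      intervalLength_isMeasure continuous_mul_apply fun S hS B _ => ?_
    refine isWeaklyNegligible_limMap_preimage h (sInf S) (sSup S) ?_
    rintro y (⟨hyS, hy⟩ | ⟨⟨-, hy⟩, hyS⟩)
    · exact closure_diff_subset_endpoints hS (limMap_mem_closure h hyS)
        fun h' => hy (show limMap h y ∈ S from interior_subset h')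
    · refine closure_diff_subset_endpoints hS (subset_closure hy) fun h' => hyS ?_
      obtain ⟨A, hA, hAS⟩ := limMap_spec h y (isOpen_interior.mem_nhds h')
      exact y.mem_of_subset hA (.basic hS) (hAS.trans interior_subset)
  · refine hasExtendedIntegral_of_hasMcShaneIntegral realIntervals_isLocallyFinite h
      intervalLength_isMeasure continuous_mul_apply fun S hS B _ => ?_
    refine isWeaklyNegligible_subset_pair (sInf S) (sSup S) ?_
    rintro x (⟨⟨-, y, hyS, rfl⟩, hx⟩ | ⟨hxS, hx⟩)
    · exact closure_diff_subset_endpoints hS (limMap_mem_closure h hyS)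
        fun h' => hx (interior_subset h')
    · exact absurd (mem_limMap_image h hS hxS) hx

end RealIntervals


section Classical

open MeasureTheory

/-! ### Riemann sums of integrable functions -/

theorem exists_setIntegral_compl_Icc_lt {f : ℝ → ℝ} (hf : Integrable f) {ε : ℝ} (hε : 0 < ε) :
    ∃ R : ℝ, ∫ x in (Icc (-R) R)ᶜ, |f x| < ε := by
  have h1 := (aecover_Icc (μ := volume) tendsto_neg_atTop_atBot
    tendsto_id).integral_tendsto_of_countably_generated (l := (atTop : Filter ℝ)) hf.abs
  obtain ⟨R, hR⟩ := (h1.eventually (lt_mem_nhds (sub_lt_self _ hε))).exists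
  refine ⟨R, ?_⟩
  have h2 := integral_add_compl (measurableSet_Icc (a := -R) (b := R)) hf.abs
  simp only [id] at hR
  linarith

/-- By Vitali–Carathéodory there is a lower semicontinuous `g > f` of almost the same integral. The
gauge at `t` is chosen so that `g > f t` nearby; then each term of the Riemann sum is at most the
integral of `g` over its interval. -/
theorem exists_gauge_sum_lt {f : ℝ → ℝ} (hf : Integrable f) {ε : ℝ} (hε : 0 < ε) :
    ∃ δ : ℝ → ℝ, (∀ t, 0 < δ t) ∧ ∃ R : ℝ, ∀ (n : ℕ) (t u v : Fin n → ℝ), (∀ i, u i ≤ v i) →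
      Pairwise (fun i j => Disjoint (Ioo (u i) (v i)) (Ioo (u j) (v j))) →
      (∀ i, Icc (u i) (v i) ⊆ Ioo (t i - δ (t i)) (t i + δ (t i))) →
      Icc (-R) R ⊆ ⋃ i, Icc (u i) (v i) →
        ∑ i, f (t i) * (v i - u i) < (∫ x, f x) + ε := by
  obtain ⟨g, hfg, hg, hgi, hgt, hlt⟩ :=
    exists_lt_lowerSemicontinuous_integral_lt f hf (half_pos hε)
  obtain ⟨R, hR⟩ := exists_setIntegral_compl_Icc_lt hf (half_pos hε)
  have hδ : ∀ t, ∃ δ > 0, ∀ x ∈ Ioo (t - δ) (t + δ), (f t : EReal) < g x := fun t => by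
    obtain ⟨δ, hδ, h⟩ := Metric.eventually_nhds_iff_ball.1 (hg t _ (hfg t))
    exact ⟨δ, hδ, fun x hx => h x (by rwa [Real.ball_eq_Ioo])⟩
  choose δ hδ0 hδ using hδ
  have htoReal : ∀ {c : ℝ} {x : ℝ}, g x < ⊤ → (c : EReal) < g x → c ≤ (g x).toReal := by
    intro c x h1 h2
    rw [← EReal.coe_le_coe_iff, EReal.coe_toReal h1.ne (bot_lt_iff_ne_bot.1 (bot_le.trans_lt h2))]
    exact h2.le
  refine ⟨δ, hδ0, R, fun n t u v huv hdisj hfine hcover => ?_⟩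
  set E := ⋃ i, Ioo (u i) (v i)
  have hE : MeasurableSet E := .iUnion fun i => measurableSet_Ioo
  have h1 : ∑ i, f (t i) * (v i - u i) ≤ ∫ x in E, (g x).toReal := by
    rw [integral_iUnion_fintype (fun i => measurableSet_Ioo) hdisj fun i => hgi.integrableOn]
    refine Finset.sum_le_sum fun i _ => ?_
    have h2 : ∫ x in Ioo (u i) (v i), f (t i) = f (t i) * (v i - u i) := by
      rw [setIntegral_const, Real.volume_real_Ioo_of_le (huv i), smul_eq_mul, mul_comm]
    rw [← h2]
    refine setIntegral_mono_on_ae (integrableOn_const (by simp)) hgi.integrableOn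
      measurableSet_Ioo ?_
    filter_upwards [hgt] with x hx hxI
    exact htoReal hx (hδ _ _ (hfine i (Ioo_subset_Icc_self hxI)))
  -- Off the intervals `g > f ≥ -|f|`, and up to endpoints this region lies outside `[-R, R]`, so at
  -- most `ε / 2` is lost there.
  have h2 : ∫ x in Eᶜ, -|f x| ≤ ∫ x in Eᶜ, (g x).toReal := by
    refine setIntegral_mono_on_ae hf.abs.neg.integrableOn hgi.integrableOn hE.compl ?_
    filter_upwards [hgt] with x hx _
    exact (neg_abs_le _).trans (htoReal hx (hfg x))
  have h3 : ∫ x in Eᶜ, |f x| ≤ ∫ x in (Icc (-R) R)ᶜ, |f x| := by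
    refine setIntegral_mono_set hf.abs.integrableOn (.of_forall fun x => abs_nonneg _) ?_
    have hfin : (range u ∪ range v).Finite := (finite_range u).union (finite_range v)
    filter_upwards [compl_mem_ae_iff.2 (hfin.measure_zero volume)] with x hx hxE hxR
    obtain ⟨i, hi⟩ := mem_iUnion.1 (hcover hxR)
    refine hxE (mem_iUnion.2 ⟨i, hi.1.lt_of_ne ?_, hi.2.lt_of_ne ?_⟩)
    · exact fun h => hx (.inl ⟨i, h⟩)
    · exact fun h => hx (.inr ⟨i, h.symm⟩)
  rw [integral_neg] at h2
  have h4 := integral_add_compl hE hgi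
  linarith

theorem hasClassicalMcShaneIntegral_of_integrable {f : ℝ → ℝ} (hf : Integrable f) :
    HasClassicalMcShaneIntegral f (∫ x, f x) := by
  intro ε hε
  obtain ⟨δ₁, h1, R₁, hR₁⟩ := exists_gauge_sum_lt hf hε
  obtain ⟨δ₂, h2, R₂, hR₂⟩ := exists_gauge_sum_lt hf.neg hε
  refine ⟨fun t => min (δ₁ t) (δ₂ t), fun t => lt_min (h1 t) (h2 t), max R₁ R₂,
    fun n t u v huv hd hfine hcov => ?_⟩
  have h3 := hR₁ n t u v huv hd
    (fun i => (hfine i).trans (Ioo_subset_Ioo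
      (sub_le_sub_left (min_le_left _ _) _) (add_le_add_right (min_le_left _ _) _)))
    ((Icc_subset_Icc (neg_le_neg (le_max_left _ _)) (le_max_left _ _)).trans hcov)
  have h4 := hR₂ n t u v huv hd
    (fun i => (hfine i).trans (Ioo_subset_Ioo
      (sub_le_sub_left (min_le_right _ _) _) (add_le_add_right (min_le_right _ _) _)))
    ((Icc_subset_Icc (neg_le_neg (le_max_right _ _)) (le_max_right _ _)).trans hcov)
  simp only [Pi.neg_apply, neg_mul, Finset.sum_neg_distrib, integral_neg] at h4
  rw [abs_lt]
  constructor <;> linarith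

end Classical


/-! ### Step functions as limits of Riemann sums -/

namespace RingContent

variable {Ω W V : Type*} [AddCommGroup W] [AddCommGroup V] {P : RingContent Ω W} {A : Set Ω}
  {s : Ω → V}

theorem IsStep.simpleOn (hs : P.IsStep s) (hA : A ∈ P.sets) : P.SimpleOn s A := by
  refine ⟨?_, fun v => hs.inter_preimage_mem hA {v}⟩
  obtain ⟨𝔇, -, h2, h3⟩ := hs.exists_finite_cover hA
  refine ((h2.subset (sep_subset 𝔇 fun D => ∀ x ∈ D, ∀ y ∈ D, s x = s y)).biUnion
    (t := fun D => s '' D) fun D hD => ?_).subset ?_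
  · refine Subsingleton.finite ?_
    rintro _ ⟨x, hx, rfl⟩ _ ⟨y, hy, rfl⟩
    exact hD.2 x hx y hy
  · rintro _ ⟨x, hx, rfl⟩
    obtain ⟨D, hD, hxD, h⟩ := h3 x hx
    exact mem_biUnion ⟨hD, fun y hy z hz => (h y hy).trans (h z hz).symm⟩ ⟨x, hxD, rfl⟩

end RingContent

section Classical

open MeasureTheory

/-- `z` is the Riemann sum of a `δ`-fine free tagged family of non-overlapping compact intervals
filling `A` up to endpoints. -/
def TaggedSum (f δ : ℝ → ℝ) (A : Set ℝ) (z : ℝ) : Prop :=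
  ∃ (κ : Type) (_ : Fintype κ) (t u v : κ → ℝ), (∀ i, u i ≤ v i) ∧
    Pairwise (fun i j => Disjoint (Ioo (u i) (v i)) (Ioo (u j) (v j))) ∧
    (∀ i, Icc (u i) (v i) ⊆ Ioo (t i - δ (t i)) (t i + δ (t i))) ∧
    (∀ i, Ioo (u i) (v i) ⊆ A) ∧ A ⊆ ⋃ i, Icc (u i) (v i) ∧ ∑ i, f (t i) * (v i - u i) = z

variable {f δ : ℝ → ℝ} {A B : Set ℝ} {z w : ℝ}

theorem taggedSum_empty : TaggedSum f δ ∅ 0 :=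
  ⟨Empty, inferInstance, nofun, nofun, nofun, nofun, nofun, nofun, nofun, empty_subset _, by simp⟩

theorem taggedSum_single {t u v : ℝ} (huv : u ≤ v) (h : Icc u v ⊆ Ioo (t - δ t) (t + δ t))
    (h1 : Ioo u v ⊆ A) (h2 : A ⊆ Icc u v) : TaggedSum f δ A (f t * (v - u)) :=
  ⟨Unit, inferInstance, fun _ => t, fun _ => u, fun _ => v, fun _ => huv,
    fun _ _ h => absurd rfl h, fun _ => h, fun _ => h1,
    h2.trans_eq (iUnion_const _).symm, by simp⟩

theorem TaggedSum.union (hA : TaggedSum f δ A z) (hB : TaggedSum f δ B w) (h : Disjoint A B) :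
    TaggedSum f δ (A ∪ B) (z + w) := by
  obtain ⟨κ, _, t, u, v, h1, h2, h3, h4, h5, h6⟩ := hA
  obtain ⟨κ', _, t', u', v', h1', h2', h3', h4', h5', h6'⟩ := hB
  refine ⟨κ ⊕ κ', inferInstance, Sum.elim t t', Sum.elim u u', Sum.elim v v', ?_, ?_, ?_, ?_, ?_, ?_⟩
  · rintro (i | i)
    exacts [h1 i, h1' i]
  · rintro (i | i) (k | k) hik
    · exact h2 fun h => hik (h ▸ rfl)
    · exact h.mono (h4 i) (h4' k)
    · exact h.symm.mono (h4' i) (h4 k)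
    · exact h2' fun h => hik (h ▸ rfl)
  · rintro (i | i)
    exacts [h3 i, h3' i]
  · rintro (i | i)
    exacts [(h4 i).trans subset_union_left, (h4' i).trans subset_union_right]
  · rw [iUnion_sum]
    exact union_subset_union h5 h5'
  · rw [Fintype.sum_sum_type, ← h6, ← h6']
    rfl

/-- By compactness of `[p, q]` a fine enough subdivision has each piece inside the gauge interval of
one tag with value `c`. -/
theorem taggedSum_Ico {c p q : ℝ} (hpq : p ≤ q)
    (h : ∀ x ∈ Icc p q, ∃ t, f t = c ∧ x ∈ Ioo (t - δ t) (t + δ t)) :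
    TaggedSum f δ (Ico p q) (c * (q - p)) := by
  obtain ⟨x, hx0, hx, ⟨m, hm⟩, hx'⟩ := exists_monotone_Icc_subset_open_cover_Icc hpq
    (c := fun t : {t // f t = c} => Subtype.val ⁻¹' Ioo (t.1 - δ t) (t.1 + δ t))
    (fun t => isOpen_Ioo.preimage continuous_subtype_val) fun y _ => by
      obtain ⟨t, ht, hy⟩ := h y y.2
      exact mem_iUnion.2 ⟨⟨t, ht⟩, hy⟩
  have key : ∀ n, TaggedSum f δ (Ico p (x n)) (c * (x n - p)) := by
    intro n
    induction n with
    | zero => simpa [hx0] using taggedSum_empty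
    | succ n ih =>
      obtain ⟨⟨t, ht⟩, hsub⟩ := hx' n
      have hle : (x n : ℝ) ≤ x (n + 1) := hx n.le_succ
      have h1 : TaggedSum f δ (Ico (x n : ℝ) (x (n + 1))) (f t * (x (n + 1) - x n)) :=
        taggedSum_single hle (fun y hy => hsub (a := ⟨y, (x n).2.1.trans hy.1,
          hy.2.trans (x (n + 1)).2.2⟩) ⟨hy.1, hy.2⟩) Ioo_subset_Ico_self Ico_subset_Icc_self
      have h2 := ih.union h1 (disjoint_left.2 fun y a b => a.2.not_ge b.1)
      rw [Ico_union_Ico_eq_Ico (x n).2.1 hle, ht] at h2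
      convert h2 using 1
      ring
  have := key m
  rwa [hm m le_rfl] at this

/-- The endpoints may not belong to `A`, so tags with value `c` need not reach them. Two end pieces
of length `η` are tagged by the endpoints instead, and the compact middle is filled by
`taggedSum_Ico`. -/
theorem exists_taggedSum_near_interval (hδ : ∀ t, 0 < δ t) {c : ℝ} (hA : A ∈ realIntervals)
    (h : ∀ x ∈ A, ∃ t, f t = c ∧ x ∈ Ioo (t - δ t) (t + δ t)) {θ : ℝ} (hθ : 0 < θ) :
    ∃ z, TaggedSum f δ A z ∧ |z - c * volume.real A| ≤ θ := by
  rcases A.eq_empty_or_nonempty with rfl | hne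
  · exact ⟨0, taggedSum_empty, by simpa using hθ.le⟩
  set p := sInf A
  set q := sSup A
  have hAs : A ⊆ Icc p q := fun x hx =>
    ⟨csInf_le hA.2.bddBelow hx, le_csSup hA.2.bddAbove hx⟩
  have hsA : Ioo p q ⊆ A := fun x hx => by
    obtain ⟨y, hy, hyx⟩ := exists_lt_of_csInf_lt hne hx.1
    obtain ⟨y', hy', hxy⟩ := exists_lt_of_lt_csSup hne hx.2
    exact hA.1.out hy hy' ⟨hyx.le, hxy.le⟩
  have hpq : p ≤ q := by
    obtain ⟨x, hx⟩ := hne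
    exact (hAs hx).1.trans (hAs hx).2
  have hvol : volume.real A = q - p := by
    refine le_antisymm ?_ ?_
    · rw [← Real.volume_real_Icc_of_le hpq]
      exact measureReal_mono hAs (by simp)
    · rw [← Real.volume_real_Ioo_of_le hpq]
      exact measureReal_mono hsA (volume_ne_top hA)
  rw [hvol]
  rcases hpq.eq_or_lt with heq | hlt
  · have hp := hδ p
    refine ⟨_, taggedSum_single (t := p) hpq ?_ hsA hAs, ?_⟩
    · rw [← heq, Icc_self, singleton_subset_iff]
      constructor <;> linarith
    · rw [← heq]
      simpa using hθ.le
  -- The last condition bounds the error of the end pieces: `f p` and `f q` stand in for `c` on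
  -- length `η` each.
  obtain ⟨η, hη, hηp, hηq, hη2, hηθ⟩ : ∃ η > 0, η < δ p ∧ η < δ q ∧ η < (q - p) / 2 ∧
      η * (|f p| + |f q| + 2 * |c|) < θ := by
    have h1 : Tendsto (fun η : ℝ => η * (|f p| + |f q| + 2 * |c|)) (𝓝[>] 0) (𝓝 0) := by
      refine Tendsto.mono_left ?_ nhdsWithin_le_nhds
      exact Continuous.tendsto' (by fun_prop) _ _ (by simp)
    have h2 : ∀ {b : ℝ}, 0 < b → ∀ᶠ η in 𝓝[>] (0 : ℝ), η < b := fun hb =>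
      eventually_nhdsWithin_of_eventually_nhds (gt_mem_nhds hb)
    obtain ⟨η, a, b, c, d, e⟩ := (eventually_mem_nhdsWithin.and ((h2 (hδ p)).and ((h2 (hδ q)).and
      ((h2 (half_pos (sub_pos.2 hlt))).and (h1.eventually (gt_mem_nhds hθ)))))).exists
    exact ⟨η, a, b, c, d, e⟩
  have h1 : TaggedSum f δ (A ∩ Iio (p + η)) (f p * (p + η - p)) := by
    refine taggedSum_single (by linarith) (fun x hx => ⟨?_, ?_⟩)
      (fun x hx => ⟨hsA ⟨hx.1, ?_⟩, hx.2⟩) fun x hx => ⟨(hAs hx.1).1, le_of_lt hx.2⟩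
    · linarith [hx.1]
    · linarith [hx.2]
    · linarith [hx.2]
  have h2 : TaggedSum f δ (Ico (p + η) (q - η)) (c * (q - η - (p + η))) :=
    taggedSum_Ico (by linarith) fun x hx =>
      h x (hsA ⟨by linarith [hx.1], by linarith [hx.2]⟩)
  have h3 : TaggedSum f δ (A ∩ Ici (q - η)) (f q * (q - (q - η))) := by
    refine taggedSum_single (by linarith) (fun x hx => ⟨?_, ?_⟩)
      (fun x hx => ⟨hsA ⟨?_, hx.2⟩, hx.1.le⟩) fun x hx => ⟨hx.2, (hAs hx.1).2⟩
    · linarith [hx.1]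
    · linarith [hx.2]
    · linarith [hx.1]
  have h4 := (h1.union h2 (disjoint_left.2 fun x a b => not_le.2 a.2 b.1)).union h3
    (disjoint_left.2 fun x a b => by
      have hb : q - η ≤ x := b.2
      rcases a with a | a
      · have : x < p + η := a.2
        linarith
      · exact not_le.2 a.2 hb)
  have hAeq : A ∩ Iio (p + η) ∪ Ico (p + η) (q - η) ∪ A ∩ Ici (q - η) = A := by
    ext x
    constructor
    · rintro ((h | h) | h)
      exacts [h.1, hsA ⟨by linarith [h.1], by linarith [h.2]⟩, h.1]
    · intro hx
      rcases lt_or_ge x (p + η) with h | h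
      · exact .inl (.inl ⟨hx, h⟩)
      rcases lt_or_ge x (q - η) with h' | h'
      · exact .inl (.inr ⟨h, h'⟩)
      · exact .inr ⟨hx, h'⟩
  rw [hAeq] at h4
  refine ⟨_, h4, le_trans ?_ hηθ.le⟩
  have : f p * (p + η - p) + c * (q - η - (p + η)) + f q * (q - (q - η)) - c * (q - p) =
      η * (f p + f q - 2 * c) := by ring
  rw [this, abs_mul, abs_of_pos hη]
  refine mul_le_mul_of_nonneg_left ?_ hη.le
  refine (abs_sub _ _).trans (add_le_add (abs_add_le _ _) ?_)
  rw [abs_mul, abs_two]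

/-- `B` splits into finitely many intervals on which `s` is constant; the error is halved with each
interval added. -/
theorem exists_taggedSum_near (hδ : ∀ t, 0 < δ t) {s : ℝ → ℝ} (hs : intervalContent.IsStep s)
    (hB : B ∈ intervalContent.sets)
    (h : ∀ x ∈ B, ∃ t, f t = s x ∧ x ∈ Ioo (t - δ t) (t + δ t)) {θ : ℝ} (hθ : 0 < θ) :
    ∃ z, TaggedSum f δ B z ∧ |z - ∫ x in B, s x| ≤ θ := by
  have hsimple := hs.simpleOn hB
  have hsi : Integrable s := (intervalContent_represents.integrable hs).1
  obtain ⟨𝔈, h1, h2, h3, h4⟩ :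
      FinitelyDecomposes {I ∈ realIntervals | I ⊆ B ∧ ∃ c, ∀ x ∈ I, s x = c} B := by
    have hfin := hsimple.1.to_subtype
    have hBU : B = ⋃ v : s '' B, B ∩ s ⁻¹' {v.1} := by
      ext x
      simp only [mem_iUnion, mem_inter_iff, mem_preimage, mem_singleton_iff]
      exact ⟨fun hx => ⟨⟨s x, x, hx, rfl⟩, hx, rfl⟩, fun ⟨_, hx, _⟩ => hx⟩
    have hdec : ∀ v : s '' B, FinitelyDecomposes
        {I ∈ realIntervals | I ⊆ B ∧ ∃ c, ∀ x ∈ I, s x = c} (B ∩ s ⁻¹' {v.1}) := by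
      intro v
      obtain ⟨𝔈, h1, h2, h3, h4⟩ := hsimple.2 v.1
      refine ⟨𝔈, fun I hI => ⟨h1 hI, fun x hx => ?_, v.1, fun x hx => ?_⟩, h2, h3, h4⟩
      · exact (h4.subset ⟨I, hI, hx⟩).1
      · exact (h4.subset ⟨I, hI, hx⟩).2
    have := FinitelyDecomposes.iUnion hdec fun v w hvw => disjoint_left.2 fun x a b =>
      hvw (Subtype.ext (a.2.symm.trans b.2))
    rwa [← hBU] at this
  clear hB hsimple
  have key : ∀ θ > 0, ∃ z, TaggedSum f δ (⋃₀ 𝔈) z ∧ |z - ∫ x in ⋃₀ 𝔈, s x| ≤ θ := by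
    clear h4
    induction 𝔈, h2 using Set.Finite.induction_on with
    | empty =>
      intro θ hθ
      exact ⟨0, by simpa using taggedSum_empty, by simpa using hθ.le⟩
    | @insert I 𝔈 hI hfin ih =>
      intro θ hθ
      obtain ⟨z, hz, hzθ⟩ := ih ((subset_insert _ _).trans h1) (h3.subset (subset_insert _ _)) _
        (half_pos hθ)
      obtain ⟨hI1, hI2, c, hI3⟩ := h1 (mem_insert _ _)
      obtain ⟨w, hw, hwθ⟩ := exists_taggedSum_near_interval (f := f) (c := c) hδ hI1
        (fun x hx => by rw [← hI3 x hx]; exact h x (hI2 hx)) (half_pos hθ)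
      have hd : Disjoint I (⋃₀ 𝔈) := disjoint_sUnion_right.2 fun J hJ =>
        h3 (mem_insert _ _) (mem_insert_of_mem _ hJ) fun e => hI (e ▸ hJ)
      have hm : MeasurableSet (⋃₀ 𝔈) := .sUnion hfin.countable fun J hJ =>
        (h1 (mem_insert_of_mem _ hJ)).1.1.measurableSet
      rw [sUnion_insert]
      refine ⟨w + z, hw.union hz hd, ?_⟩
      rw [setIntegral_union hd hm hsi.integrableOn hsi.integrableOn,
        setIntegral_congr_fun hI1.1.measurableSet hI3, setIntegral_const, smul_eq_mul, mul_comm]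
      rw [show ∀ a b : ℝ, w + z - (a + b) = (w - a) + (z - b) by intros; ring]
      exact (abs_add_le _ _).trans (by linarith)
  rw [h4] at key
  exact key θ hθ

/-! ### From Riemann sums to envelopes -/

theorem isOpenOver_gauge (f δ : ℝ → ℝ) (U : Set ℝ) : intervalContent.IsOpenOver U
    {p : ℝ × ℝ | ∃ t, f t = p.1 ∧ p.2 ∈ Ioo (t - δ t) (t + δ t)} := by
  refine ⟨range fun q : ℚ × ℚ => Ioo (q.1 : ℝ) q.2, ?_, countable_range _, ?_⟩
  · rintro _ ⟨q, rfl⟩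
    exact mem_intervalContent_sets (Ioo_mem_realIntervals _ _)
  · rintro v x - ⟨t, rfl, hx⟩
    obtain ⟨q, hq, hqx⟩ := exists_rat_btwn hx.1
    obtain ⟨r, hxr, hr⟩ := exists_rat_btwn hx.2
    exact ⟨_, ⟨(q, r), rfl⟩, ⟨hqx, hxr⟩, fun y hy => ⟨t, rfl, hq.trans hy.1, hy.2.trans hr⟩⟩

/-- Finitely many gauge intervals cover the compact closure of `B`; patching the constants `f x`
gives the step function. -/
theorem exists_step_gauge (f : ℝ → ℝ) (hδ : ∀ t, 0 < δ t) (hB : Bornology.IsBounded B) :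
    ∃ r, intervalContent.IsStep r ∧
      ∀ x ∈ B, ∃ t, f t = r x ∧ x ∈ Ioo (t - δ t) (t + δ t) := by
  obtain ⟨C, -, hC, r, hr, hr'⟩ := hB.isCompact_closure.induction_on
    (p := fun S => ∃ C ∈ intervalContent.sets, S ⊆ C ∧ ∃ r, intervalContent.IsStep r ∧
      ∀ x ∈ C, ∃ t, f t = r x ∧ x ∈ Ioo (t - δ t) (t + δ t))
    ⟨∅, intervalContent.empty_mem, subset_rfl, 0, RingContent.isStep_zero, fun _ h => h.elim⟩
    (fun S T hST ⟨C, h1, h2, h3⟩ => ⟨C, h1, hST.trans h2, h3⟩)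
    (fun S T ⟨C, h1, h2, r, h3, h4⟩ ⟨D, h1', h2', r', h3', h4'⟩ => by
      refine ⟨C ∪ D, intervalContent.union_mem h1 h1', union_subset_union h2 h2',
        C.indicator r + (D \ C).indicator r',
        (h3.indicator h1).add (h3'.indicator (intervalContent.diff_mem h1' h1)), fun x hx => ?_⟩
      rw [Pi.add_apply]
      by_cases hxC : x ∈ C
      · simpa [hxC] using h4 x hxC
      · have hxD : x ∈ D := hx.resolve_left hxC
        simpa [hxC, hxD] using h4' x hxD)
    fun x _ => ⟨Ioo (x - δ x) (x + δ x), mem_nhdsWithin_of_mem_nhds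
      (Ioo_mem_nhds (by linarith [hδ x]) (by linarith [hδ x])), _,
      mem_intervalContent_sets (Ioo_mem_realIntervals _ _), subset_rfl, _,
      RingContent.isStep_const (mem_intervalContent_sets (Ioo_mem_realIntervals _ _)) (f x),
      fun y hy => ⟨x, by rw [indicator_of_mem hy], hy⟩⟩
  exact ⟨r, hr, fun x hx => hr' x (hC (subset_closure hx))⟩

/-- The envelope over `x` consists of the values `f t` at tags whose gauge interval contains `x`.
Its step functions have integrals near Riemann sums of `δ`-fine families filling `B`, which cover
`[-R, R]`. -/
theorem HasClassicalMcShaneIntegral.hasExtendedIntegral {a : ℝ}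
    (h : HasClassicalMcShaneIntegral f a) :
    HasExtendedIntegral AddMonoidHom.mul intervalLength f a := by
  intro T hT
  obtain ⟨ε, hε, hεT⟩ := Metric.mem_nhds_iff.1 hT
  obtain ⟨δ, hδ, R, hR⟩ := h (ε / 3) (by positivity)
  refine ⟨Icc (-R) R, ⟨{Icc (-R) R}, by simpa using Icc_mem_realIntervals _ _,
    finite_singleton _, sUnion_singleton _⟩, fun B hB hAB => ?_⟩
  have hBs : B ∈ intervalContent.sets :=
    finitelyDecomposes_of_mem_finiteUnions realIntervals_isLocallyFinite hB
  obtain ⟨𝒜, h1, h2, h3⟩ := intervalContent_represents.exists_envelope (L := AddMonoidHom.mul)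
    (f := B.indicator f) continuous_mul_apply hBs
    ⟨isOpenOver_gauge f δ B, exists_step_gauge f hδ (isBounded_of_mem_sets hBs), fun x hx => by
      have hx : x ∈ B := hx
      exact ⟨x, by simp [hx], by constructor <;> simp [hδ x]⟩⟩
    fun x hx => indicator_of_notMem hx _
  refine ⟨𝒜, h1, h2, fun z hz => hεT ?_⟩
  have hcl : closure (intervalContent.values AddMonoidHom.mul B
      {p : ℝ × ℝ | ∃ t, f t = p.1 ∧ p.2 ∈ Ioo (t - δ t) (t + δ t)}) ⊆
      Metric.closedBall a (ε / 3 + ε / 3) := by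
    refine closure_minimal ?_ Metric.isClosed_closedBall
    rintro _ ⟨s, hs, hs1, hs0, rfl⟩
    obtain ⟨z, ⟨κ, _, t, u, v, g1, g2, g3, -, g5, g6⟩, hz⟩ :=
      exists_taggedSum_near (θ := ε / 3) hδ hs hBs hs1 (by positivity)
    let e := (Fintype.equivFin κ).symm
    have h4 := hR _ (t ∘ e) (u ∘ e) (v ∘ e) (fun i => g1 _)
      (fun i k hik => g2 (e.injective.ne hik)) (fun i => g3 _)
      (hAB.trans (g5.trans (e.surjective.iUnion_comp fun i => Icc (u i) (v i)).superset))
    have h5 : ∑ i, f ((t ∘ e) i) * ((v ∘ e) i - (u ∘ e) i) = z := by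
      rw [← g6]
      exact e.sum_comp fun i => f (t i) * (v i - u i)
    rw [h5] at h4
    rw [setIntegral_eq_integral_of_forall_compl_eq_zero hs0] at hz
    rw [(intervalContent_represents.integrable hs).2, Metric.mem_closedBall, Real.dist_eq]
    have h6 := abs_sub_le (∫ x, s (id x)) z a
    rw [abs_sub_comm _ z] at h6
    exact h6.trans (add_le_add hz h4.le)
  have := hcl (h3 hz)
  rw [Metric.mem_closedBall, Real.dist_eq] at this
  rw [Metric.mem_ball, Real.dist_0_eq_abs]
  linarith

end Classical


section Classical

open MeasureTheory
open scoped ENNReal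

/-! ### The extended integral is the Lebesgue integral -/

variable {f : ℝ → ℝ} {U : Set ℝ}

/-- A set containing the zero function all of whose step functions have small integral is bounded
by a function with small integral. -/
theorem exists_bound_of_forall_step {𝒜 : Set (ℝ × ℝ)} (hU : U ∈ intervalContent.sets)
    (h𝒜 : intervalContent.IsOpenOver U 𝒜) (h0 : ∀ x ∈ U, (0, x) ∈ 𝒜) {κ : ℝ}
    (h : ∀ s, intervalContent.IsStep s → (∀ x ∈ U, (s x, x) ∈ 𝒜) → (∀ x ∉ U, s x = 0) →
      |∫ x, s x| ≤ κ) :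
    ∃ w : ℝ → ℝ≥0∞, Measurable w ∧ (∀ x ∈ U, ∀ v, (v, x) ∈ 𝒜 → ‖v‖ₑ ≤ w x) ∧
      ∫⁻ x, w x ≤ ENNReal.ofReal (2 * κ) := by
  obtain ⟨𝔇, h1, h2, h3⟩ := h𝒜
  have hint : ∀ {s}, intervalContent.IsStep s → Integrable s := fun hs =>
    (intervalContent_represents.integrable hs).1
  have habs : ∀ s, intervalContent.IsStep s → (∀ x ∈ U, (s x, x) ∈ 𝒜) → (∀ x ∉ U, s x = 0) →
      ∫⁻ x, ‖s x‖ₑ ≤ ENNReal.ofReal (2 * κ) := by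
    intro s hs hs1 hs0
    -- Since zero lies in `𝒜`, cutting `s` off to a sign region stays admissible; the two signs
    -- account for the factor 2.
    have hpart : ∀ Q : Set ℝ, |∫ x, (U ∩ s ⁻¹' Q).indicator s x| ≤ κ := by
      intro Q
      refine h _ (hs.indicator (hs.inter_preimage_mem hU Q)) (fun x hx => ?_)
        fun x hx => indicator_of_notMem (fun h => hx h.1) _
      by_cases hxQ : x ∈ U ∩ s ⁻¹' Q
      · rw [indicator_of_mem hxQ]
        exact hs1 x hx
      · rw [indicator_of_notMem hxQ]
        exact h0 x hx
    have hsplit : ∀ x, |s x| = (U ∩ s ⁻¹' Ioi 0).indicator s x - (U ∩ s ⁻¹' Iio 0).indicator s x := by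
      intro x
      by_cases hx : x ∈ U
      · rcases lt_trichotomy (s x) 0 with h | h | h
        · simp [indicator, hx, h, h.not_gt, abs_of_neg h]
        · simp [indicator, h]
        · simp [indicator, hx, h, h.not_gt, abs_of_pos h]
      · simp [indicator, hx, hs0 x hx]
    rw [← ofReal_integral_norm_eq_lintegral_enorm (hint hs)]
    refine ENNReal.ofReal_le_ofReal ?_
    simp only [Real.norm_eq_abs, hsplit]
    rw [integral_sub (hint (hs.indicator (hs.inter_preimage_mem hU _)))
      (hint (hs.indicator (hs.inter_preimage_mem hU _)))]
    linarith [(abs_le.1 (hpart (Ioi 0))).2, (abs_le.1 (hpart (Iio 0))).1]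
  -- A countable dense part of each fibre has the same norm bounds as the whole fibre and keeps the
  -- supremum measurable.
  choose t ht1 ht2 ht3 using fun D : Set ℝ =>
    (TopologicalSpace.IsSeparable.of_separableSpace
      {v : ℝ | ∀ x ∈ D, (v, x) ∈ 𝒜}).exists_countable_dense_subset
  obtain ⟨q, hq⟩ := Set.Countable.exists_eq_range
    (s := (⋃ D ∈ 𝔇, (fun v => (D, v)) '' t D) ∪ {((∅ : Set ℝ), (0 : ℝ))})
    ((h2.biUnion fun D _ => (ht2 D).image _).union (countable_singleton _)) ⟨_, .inr rfl⟩
  have hq' : ∀ k, (q k).1 ∈ intervalContent.sets ∧ ∀ x ∈ (q k).1, ((q k).2, x) ∈ 𝒜 := by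
    intro k
    have : q k ∈ (⋃ D ∈ 𝔇, (fun v => (D, v)) '' t D) ∪ {((∅ : Set ℝ), (0 : ℝ))} :=
      hq ▸ mem_range_self k
    rcases this with hk | hk
    · simp only [mem_iUnion] at hk
      obtain ⟨D, hD, v, hv, hk⟩ := hk
      rw [← hk]
      exact ⟨h1 hD, ht1 D hv⟩
    · rw [mem_singleton_iff] at hk
      rw [hk]
      exact ⟨intervalContent.empty_mem, fun _ h => h.elim⟩
  let g : ℕ → ℝ → ℝ≥0∞ := fun k => ((q k).1 ∩ U).indicator fun _ => ‖(q k).2‖ₑ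
  have hg : ∀ k, Measurable (g k) := fun k => measurable_const.indicator
    (measurableSet_of_mem_sets (intervalContent.inter_mem (hq' k).1 hU))
  -- The first `n` constants are dominated by one admissible step function: `C` is where the next
  -- constant is larger in norm, and there it replaces `s`.
  have hstep : ∀ n, ∃ s, intervalContent.IsStep s ∧ (∀ x ∈ U, (s x, x) ∈ 𝒜) ∧
      (∀ x ∉ U, s x = 0) ∧ ∀ k < n, ∀ x, g k x ≤ ‖s x‖ₑ := by
    intro n
    induction n with
    | zero => exact ⟨0, RingContent.isStep_zero, h0, fun _ _ => rfl, fun _ h => absurd h (by simp)⟩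
    | succ n ih =>
      obtain ⟨s, hs, hs1, hs0, hsg⟩ := ih
      set C := (q n).1 ∩ (U ∩ s ⁻¹' {y | ‖y‖ₑ < ‖(q n).2‖ₑ}) with hC
      have hCs : C ∈ intervalContent.sets :=
        intervalContent.inter_mem (hq' n).1 (hs.inter_preimage_mem hU _)
      have hCU : C ⊆ U := fun x hx => hx.2.1
      have hin : ∀ x ∈ C, (C.indicator (fun _ => (q n).2) + (U \ C).indicator s) x = (q n).2 :=
        fun x hx => by simp [hx]
      have hout : ∀ x ∉ C, (C.indicator (fun _ => (q n).2) + (U \ C).indicator s) x = s x := by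
        intro x hx
        by_cases hxU : x ∈ U
        · simp [hx, hxU]
        · simp [hx, hxU, hs0 x hxU]
      refine ⟨C.indicator (fun _ => (q n).2) + (U \ C).indicator s,
        (RingContent.isStep_const hCs _).add (hs.indicator (intervalContent.diff_mem hU hCs)),
        fun x hx => ?_, fun x hx => ?_, fun k hk x => ?_⟩
      · by_cases hxC : x ∈ C
        · rw [hin x hxC]
          exact (hq' n).2 x hxC.1
        · rw [hout x hxC]
          exact hs1 x hx
      · rw [hout x fun h => hx (hCU h), hs0 x hx]
      · by_cases hxC : x ∈ C
        · rw [hin x hxC]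
          rcases (Nat.lt_succ_iff_lt_or_eq.1 hk) with hk | rfl
          · exact (hsg k hk x).trans (le_of_lt hxC.2.2)
          · exact indicator_apply_le' (fun _ => le_rfl) fun _ => zero_le
        · rw [hout x hxC]
          rcases (Nat.lt_succ_iff_lt_or_eq.1 hk) with hk | rfl
          · exact hsg k hk x
          · refine indicator_apply_le' (fun hx => ?_) fun _ => zero_le
            exact not_lt.1 fun hlt => hxC ⟨hx.1, hx.2, hlt⟩
  refine ⟨fun x => ⨆ k, g k x, Measurable.iSup hg, fun x hx v hv => ?_, ?_⟩
  · obtain ⟨D, hD, hxD, hv'⟩ := h3 v x hx hv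
    have hcl : IsClosed {v : ℝ | ‖v‖ₑ ≤ ⨆ k, g k x} := isClosed_le continuous_enorm continuous_const
    refine closure_minimal (fun v' hv' => ?_) hcl (ht3 D hv')
    obtain ⟨k, hk⟩ : (D, v') ∈ range q := by
      rw [← hq]
      exact .inl (mem_biUnion hD ⟨v', hv', rfl⟩)
    refine le_trans ?_ (le_iSup (fun k => g k x) k)
    simp only [g, hk]
    rw [indicator_of_mem (s := D ∩ U) ⟨hxD, hx⟩]
  · have heq : (fun x => ⨆ k, g k x) = fun x => ⨆ n, partialSups g n x := by
      funext x
      rw [← iSup_apply, ← iSup_partialSups_eq g, iSup_apply]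
    rw [heq, lintegral_iSup (fun n => ?_) (partialSups_monotone g)]
    · refine iSup_le fun n => ?_
      obtain ⟨s, hs, hs1, hs0, hsg⟩ := hstep (n + 1)
      refine (lintegral_mono ?_).trans (habs s hs hs1 hs0)
      exact partialSups_le g n _ fun k hk => hsg k (Nat.lt_succ_of_le hk)
    · induction n with
      | zero => simpa using hg 0
      | succ n ih =>
        rw [partialSups_add_one]
        exact ih.sup (hg _)

/-- Translating the envelope by `-r` puts zero into it. The translated step functions have integrals
at most `ε / 4 + ε / 4`, so the bound of `exists_bound_of_forall_step` has integral at most `ε` and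
dominates the distance from `f` to `r` on `B`. -/
theorem HasExtendedIntegral.exists_step {a : ℝ}
    (h : HasExtendedIntegral AddMonoidHom.mul intervalLength f a) {ε : ℝ} (hε : 0 < ε) :
    ∃ A ∈ intervalContent.sets, ∀ B ∈ intervalContent.sets, A ⊆ B →
      ∃ r, intervalContent.IsStep r ∧ |(∫ x, r x) - a| ≤ ε ∧ ∃ w : ℝ → ℝ≥0∞, Measurable w ∧
        (∀ x, ‖B.indicator f x - r x‖ₑ ≤ w x) ∧ ∫⁻ x, w x ≤ ENNReal.ofReal ε := by
  obtain ⟨A, hA, hAB⟩ := h _ (Metric.ball_mem_nhds 0 (show 0 < ε / 4 by positivity))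
  refine ⟨A, finitelyDecomposes_of_mem_finiteUnions realIntervals_isLocallyFinite hA,
    fun B hB hsub => ?_⟩
  obtain ⟨𝒜, h𝒜, happ, hz⟩ := hAB B (by
    obtain ⟨𝔈, h1, h2, -, h4⟩ := hB
    exact ⟨𝔈, h1, h2, h4⟩) hsub
  obtain ⟨U, hU, hBU, hcov⟩ := intervalContent_represents.exists_covers (L := AddMonoidHom.mul)
    h𝒜 happ hB fun x hx => indicator_of_notMem hx _
  obtain ⟨𝒜', ⟨hopen, ⟨r, hr, hr'⟩, happ'⟩, hval⟩ := hcov U hU subset_rfl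
  have hint : ∀ {s}, intervalContent.IsStep s → Integrable s := fun hs =>
    (intervalContent_represents.integrable hs).1
  have hstep : ∀ s, intervalContent.IsStep s → (∀ x ∈ U, (s x, x) ∈ 𝒜') → (∀ x ∉ U, s x = 0) →
      |(∫ x, s x) - a| ≤ ε / 4 := by
    intro s hs hs1 hs0
    have := hz _ (hval ⟨s, hs, hs1, hs0, rfl⟩)
    rw [(intervalContent_represents.integrable hs).2, Metric.mem_ball, Real.dist_0_eq_abs] at this
    exact this.le
  have hrU : ∀ x ∈ U, U.indicator r x = r x := fun x hx => indicator_of_mem hx _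
  have hr1 := hstep _ (hr.indicator hU) (fun x hx => by rw [hrU x hx]; exact hr' x hx)
    fun x hx => indicator_of_notMem hx _
  obtain ⟨w, hw, hwb, hwi⟩ := exists_bound_of_forall_step (κ := ε / 2) hU
    (hopen.comp_step hU (hr.indicator hU) fun c v => v + c)
    (fun x hx => by
      simp only [mem_ofPred_eq, zero_add, hrU x hx]
      exact hr' x hx)
    fun s hs hs1 hs0 => by
      have h2 := hstep _ (hs.add (hr.indicator hU)) hs1 fun x hx => by
        rw [Pi.add_apply, hs0 x hx, indicator_of_notMem hx, add_zero]
      simp only [Pi.add_apply] at h2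
      rw [integral_add (hint hs) (hint (hr.indicator hU))] at h2
      rw [abs_le] at *
      constructor <;> linarith
  refine ⟨_, hr.indicator hU, hr1.trans (by linarith), w, hw, fun x => ?_, hwi.trans_eq (by congr 1; ring)⟩
  by_cases hx : x ∈ U
  · refine hwb x hx _ ?_
    simp only [mem_ofPred_eq, sub_add_cancel]
    exact happ' x hx
  · rw [indicator_of_notMem fun h => hx (hBU h), indicator_of_notMem hx]
    simp

/-- The bounds for `ε = (1 / 2) ^ n` have a summable total, so they tend to zero almost everywhere
and the step functions converge to `f`; enlarging the domains by `[-n, n]` eventually catches every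
point. -/
theorem HasExtendedIntegral.aestronglyMeasurable {a : ℝ}
    (h : HasExtendedIntegral AddMonoidHom.mul intervalLength f a) :
    AEStronglyMeasurable f := by
  choose A hA hAB using fun n : ℕ => h.exists_step (ε := (1 / 2) ^ n) (by positivity)
  choose r hr _ w hw hwb hwi using fun n : ℕ => hAB n (A n ∪ Icc (-n) n)
    (intervalContent.union_mem (hA n) (mem_intervalContent_sets (Icc_mem_realIntervals _ _)))
    subset_union_left
  have hsum : ∫⁻ x, ∑' n, w n x ≠ ⊤ := by
    rw [lintegral_tsum fun n => (hw n).aemeasurable]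
    refine ne_top_of_le_ne_top ?_ (ENNReal.tsum_le_tsum hwi)
    rw [← ENNReal.ofReal_tsum_of_nonneg (fun n => by positivity) summable_geometric_two]
    exact ENNReal.ofReal_ne_top
  refine aestronglyMeasurable_of_tendsto_ae atTop (f := r) (fun n =>
    (intervalContent_represents.integrable (hr n)).1.aestronglyMeasurable) ?_
  filter_upwards [ae_lt_top (Measurable.tsum hw) hsum] with x hx
  have h0 := ENNReal.tendsto_atTop_zero_of_tsum_ne_top hx.ne
  rw [tendsto_iff_edist_tendsto_0]
  refine tendsto_of_tendsto_of_tendsto_of_le_of_le' tendsto_const_nhds h0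
    (.of_forall fun _ => zero_le) ?_
  obtain ⟨N, hN⟩ := exists_nat_ge |x|
  filter_upwards [eventually_ge_atTop N] with n hn
  have hxn : x ∈ A n ∪ Icc (-n : ℝ) n := by
    have : |x| ≤ n := hN.trans (by exact_mod_cast hn)
    exact .inr (abs_le.1 this)
  have := hwb n x
  rwa [indicator_of_mem hxn, ← edist_eq_enorm_sub, edist_comm] at this

theorem HasExtendedIntegral.exists_integrableOn {a : ℝ}
    (h : HasExtendedIntegral AddMonoidHom.mul intervalLength f a) {ε : ℝ} (hε : 0 < ε) :
    ∃ A ∈ intervalContent.sets, ∀ B ∈ intervalContent.sets, A ⊆ B →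
      IntegrableOn f B ∧ |(∫ x in B, f x) - a| ≤ ε ∧
        ∃ r, intervalContent.IsStep r ∧ ∫ x in B, |f x - r x| ≤ ε := by
  obtain ⟨A, hA, hAB⟩ := h.exists_step (half_pos hε)
  refine ⟨A, hA, fun B hB hsub => ?_⟩
  obtain ⟨r, hr, hra, w, hw, hwb, hwi⟩ := hAB B hB hsub
  have hBm := measurableSet_of_mem_sets hB
  have hri : Integrable r := (intervalContent_represents.integrable hr).1
  have hdm : AEStronglyMeasurable (fun x => B.indicator f x - r x) :=
    (h.aestronglyMeasurable.indicator hBm).sub hri.aestronglyMeasurable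
  have hdl : ∫⁻ x, ‖B.indicator f x - r x‖ₑ ≤ ENNReal.ofReal (ε / 2) :=
    (lintegral_mono hwb).trans hwi
  have hdi : Integrable (fun x => B.indicator f x - r x) :=
    ⟨hdm, hdl.trans_lt ENNReal.ofReal_lt_top⟩
  have hdn : ∫ x, ‖B.indicator f x - r x‖ ≤ ε / 2 := by
    rw [integral_norm_eq_lintegral_enorm hdm]
    exact ENNReal.toReal_le_of_le_ofReal (by positivity) hdl
  have hfi : Integrable (B.indicator f) := by
    exact (hdi.add hri).congr (.of_forall fun x => by simp)
  refine ⟨(integrable_indicator_iff hBm).1 hfi, ?_, r, hr, ?_⟩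
  · rw [← integral_indicator hBm]
    have h1 := norm_integral_le_integral_norm (μ := volume) fun x => B.indicator f x - r x
    rw [integral_sub hfi hri, Real.norm_eq_abs] at h1
    have h2 := abs_sub_le (∫ x, B.indicator f x) (∫ x, r x) a
    linarith
  · have h1 : ∫ x in B, |f x - r x| = ∫ x in B, ‖B.indicator f x - r x‖ :=
      setIntegral_congr_fun hBm fun x hx => by simp [hx]
    rw [h1]
    refine (setIntegral_le_integral hdi.norm (.of_forall fun x => norm_nonneg _)).trans ?_
    linarith

/-- Integrals over `A` and over larger ring sets are all within 1 of `a`, so the integral of `f`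
over any ring set outside `A` is at most 2 in absolute value. Splitting by the sign of `r` turns
this into a bound for `|f|`. -/
theorem HasExtendedIntegral.integrable {a : ℝ}
    (h : HasExtendedIntegral AddMonoidHom.mul intervalLength f a) : Integrable f := by
  obtain ⟨A, hA, hAB⟩ := h.exists_integrableOn one_pos
  have hbound : ∀ B ∈ intervalContent.sets, A ⊆ B → ∫ x in B \ A, |f x| ≤ 7 := by
    intro B hB hsub
    obtain ⟨hfB, -, r, hr, hrf⟩ := hAB B hB hsub
    have hri : Integrable r := (intervalContent_represents.integrable hr).1
    have hD : B \ A ∈ intervalContent.sets := intervalContent.diff_mem hB hA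
    have hsmall : ∀ C ∈ intervalContent.sets, C ⊆ B \ A → |∫ x in C, f x| ≤ 2 := by
      intro C hC hCD
      obtain ⟨hi, hai, -⟩ := hAB (A ∪ C) (intervalContent.union_mem hA hC) subset_union_left
      obtain ⟨-, haA, -⟩ := hAB A hA subset_rfl
      rw [setIntegral_union (disjoint_left.2 fun x hx hx' => (hCD hx').2 hx)
        (measurableSet_of_mem_sets hC) (hi.mono_set subset_union_left)
        (hi.mono_set subset_union_right)] at hai
      rw [abs_le] at *
      constructor <;> linarith
    have hg : IntegrableOn (fun x => |f x - r x|) B := (hfB.sub hri.integrableOn).abs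
    set C := (B \ A) ∩ r ⁻¹' Ioi 0
    set C' := (B \ A) ∩ r ⁻¹' (Ioi 0)ᶜ
    have hC : C ∈ intervalContent.sets := hr.inter_preimage_mem hD _
    have hC' : C' ∈ intervalContent.sets := hr.inter_preimage_mem hD _
    have hCB : C ⊆ B := fun x hx => hx.1.1
    have hCB' : C' ⊆ B := fun x hx => hx.1.1
    -- Where `r > 0`, a negative value of `f` is at most as large as `|f - r|`, hence `|f| ≤ f + 2 *
    -- |f - r|`.
    have h1 : ∫ x in C, |f x| ≤ ∫ x in C, (f x + 2 * |f x - r x|) := by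
      refine setIntegral_mono_on (hfB.mono_set hCB).abs
        ((hfB.mono_set hCB).add ((hg.mono_set hCB).const_mul 2)) (measurableSet_of_mem_sets hC)
        fun x hx => ?_
      have hrx : 0 < r x := hx.2
      have := neg_abs_le (f x - r x)
      have := abs_nonneg (f x - r x)
      rw [abs_le]
      constructor <;> linarith
    have h2 : ∫ x in C', |f x| ≤ ∫ x in C', (-f x + 2 * |f x - r x|) := by
      refine setIntegral_mono_on (hfB.mono_set hCB').abs
        ((hfB.mono_set hCB').neg.add ((hg.mono_set hCB').const_mul 2))
        (measurableSet_of_mem_sets hC') fun x hx => ?_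
      have hrx : r x ≤ 0 := not_lt.1 hx.2
      have := le_abs_self (f x - r x)
      have := abs_nonneg (f x - r x)
      rw [abs_le]
      constructor <;> linarith
    rw [integral_add (hfB.mono_set hCB) ((hg.mono_set hCB).const_mul 2), integral_const_mul] at h1
    rw [integral_add (f := fun x => -f x) (hfB.mono_set hCB').neg ((hg.mono_set hCB').const_mul 2), integral_const_mul,
      integral_neg] at h2
    have hd : Disjoint C C' := disjoint_left.2 fun x a b => b.2 a.2
    have hCC : C ∪ C' = B \ A := by
      rw [← inter_union_distrib_left, ← preimage_union, union_compl_self, preimage_univ, inter_univ]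
    have h3 : (∫ x in C, |f x - r x|) + ∫ x in C', |f x - r x| ≤ 1 := by
      rw [← setIntegral_union hd (measurableSet_of_mem_sets hC') (hg.mono_set hCB)
        (hg.mono_set hCB')]
      exact (setIntegral_mono_set hg (.of_forall fun x => abs_nonneg _)
        (union_subset hCB hCB').eventuallyLE).trans hrf
    rw [← hCC, setIntegral_union hd (measurableSet_of_mem_sets hC') (hfB.mono_set hCB).abs
      (hfB.mono_set hCB').abs]
    have h4 := (abs_le.1 (hsmall C hC inter_subset_left)).2
    have h5 := (abs_le.1 (hsmall C' hC' inter_subset_left)).1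
    linarith
  have hAm := measurableSet_of_mem_sets hA
  refine (aecover_Icc (μ := volume) tendsto_neg_atTop_atBot
    tendsto_id).integrable_of_lintegral_enorm_bounded (l := (atTop : Filter ℝ))
    ((∫ x in A, |f x|) + 7) h.aestronglyMeasurable (.of_forall fun R => ?_)
  have hB : A ∪ Icc (-R) R ∈ intervalContent.sets :=
    intervalContent.union_mem hA (mem_intervalContent_sets (Icc_mem_realIntervals _ _))
  have hfB := (hAB _ hB subset_union_left).1
  refine (lintegral_mono_set (subset_union_right (s := A))).trans ?_
  simp only [id]
  rw [← ofReal_integral_norm_eq_lintegral_enorm hfB]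
  refine ENNReal.ofReal_le_ofReal ?_
  have h1 := hbound _ hB subset_union_left
  have h2 := setIntegral_union (disjoint_sdiff_right (s := A) (t := A ∪ Icc (-R) R))
    ((measurableSet_of_mem_sets hB).diff hAm) (hfB.mono_set subset_union_left).abs
    (hfB.mono_set sdiff_subset).abs
  rw [union_sdiff_cancel subset_union_left] at h2
  simp only [Real.norm_eq_abs]
  linarith

theorem HasExtendedIntegral.integral_eq {a : ℝ}
    (h : HasExtendedIntegral AddMonoidHom.mul intervalLength f a) : ∫ x, f x = a := by
  refine eq_of_forall_dist_le fun ε hε => ?_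
  obtain ⟨A, hA, hAB⟩ := h.exists_integrableOn hε
  have hB : ∀ R : ℝ, A ∪ Icc (-R) R ∈ intervalContent.sets := fun R =>
    intervalContent.union_mem hA (mem_intervalContent_sets (Icc_mem_realIntervals _ _))
  have h1 := ((aecover_Icc (μ := volume) tendsto_neg_atTop_atBot tendsto_id).superset
    (ψ := fun R : ℝ => A ∪ Icc (-R) R) (fun R => subset_union_right)
    fun R => measurableSet_of_mem_sets (hB R)).integral_tendsto_of_countably_generated h.integrable
  refine (Metric.isClosed_closedBall (x := a) (ε := ε)).mem_of_tendsto h1 (.of_forall fun R => ?_)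
  exact (hAB _ (hB R) subset_union_left).2.1

end Classical

end LMInt

/-! ### The theorem. -/

theorem mainTheorem5 :
    (∀ (X : Type*) [TopologicalSpace X] (V : Type*) [AddCommGroup V]
      (W : Type*) [AddCommGroup W] [UniformSpace W] [IsUniformAddGroup W] [CompleteSpace W]
      [T2Space W]
      (Z : Type*) [AddCommGroup Z] [UniformSpace Z] [IsUniformAddGroup Z] [CompleteSpace Z]
      [T2Space Z]
      (𝔖 : Set (Set X)) (μ : 𝔖 → W) (L : V →+ W →+ Z)
      (_h𝔖 : LMInt.IsIntervalSystem 𝔖) (_hfin : LMInt.IsLocallyFinite 𝔖)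
      (hX : LMInt.IsCompatible 𝔖) (_hμ : LMInt.IsMeasure 𝔖 μ) (_hL : ∀ c, Continuous (L c))
      (_h1 : ∀ S ∈ 𝔖, ∀ B ∈ 𝔖, LMInt.IsWeaklyNegligible L μ
        (((B ∩ LMInt.limMap hX '' LMInt.beta 𝔖 S) \ S) ∪
          (S \ LMInt.limMap hX '' LMInt.beta 𝔖 S)))
      (_h2 : ∀ S ∈ 𝔖, ∀ B ∈ 𝔖, LMInt.IsWeaklyNegligible L (LMInt.betaPush μ)
        ((LMInt.beta 𝔖 S \ LMInt.limMap hX ⁻¹' S) ∪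
          ((LMInt.beta 𝔖 B ∩ LMInt.limMap hX ⁻¹' S) \ LMInt.beta 𝔖 S)))
      (f : X → V),
      ((∃ a, LMInt.HasExtendedIntegral L μ f a) ↔ ∃ a, LMInt.HasMcShaneIntegral hX L μ f a) ∧
        ∀ a b, LMInt.HasExtendedIntegral L μ f a → LMInt.HasMcShaneIntegral hX L μ f b → a = b) ∧
    ∃ hR : LMInt.IsCompatible LMInt.realIntervals, ∀ (f : ℝ → ℝ) (a : ℝ),
      List.TFAE [
        MeasureTheory.Integrable f ∧ ∫ x, f x = a,
        LMInt.HasExtendedIntegral AddMonoidHom.mul LMInt.intervalLength f a,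
        LMInt.HasMcShaneIntegral hR AddMonoidHom.mul LMInt.intervalLength f a,
        LMInt.HasClassicalMcShaneIntegral f a] := by
  refine ⟨fun X _ V _ W _ _ _ _ _ Z _ _ _ _ _ 𝔖 μ L _ h𝔖 hX hμ hL h1 h2 f => ?_,
    LMInt.realIntervals_isCompatible, fun f a => ?_⟩
  · have hext : ∀ b, LMInt.HasMcShaneIntegral hX L μ f b → LMInt.HasExtendedIntegral L μ f b :=
      fun b hb => LMInt.hasExtendedIntegral_of_hasMcShaneIntegral h𝔖 hX hμ hL h1 hb
    exact ⟨⟨fun ⟨a, ha⟩ => ⟨a, LMInt.hasMcShaneIntegral_of_hasExtendedIntegral h𝔖 hX hμ hL h2 ha⟩,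
      fun ⟨b, hb⟩ => ⟨b, hext b hb⟩⟩,
      fun a b ha hb => LMInt.hasExtendedIntegral_unique h𝔖 hμ hL ha (hext b hb)⟩
  · tfae_have 1 → 4 := fun ⟨hf, ha⟩ => ha ▸ LMInt.hasClassicalMcShaneIntegral_of_integrable hf
    tfae_have 4 → 2 := fun h => h.hasExtendedIntegral
    tfae_have 2 → 1 := fun h => ⟨h.integrable, h.integral_eq⟩
    tfae_have 2 ↔ 3 := LMInt.hasExtendedIntegral_iff_hasMcShaneIntegral _ f a
    tfae_finish
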